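/- Let $Y$ be a smooth complex variety (a separated scheme of finite type over $\mathbb{C}$, smooth of pure dimension $n$; for example a smooth quasi-projective variety), and let $X \subset Y$ be a closed subvariety (reduced, possibly reducible) of pure codimension $1$. A point $P \in X$ is called a quadratic point of rank $r$ if there are analytic coordinates $z = (z_1,\dots,z_n)$ of $Y$ centred at $P$ and a quadratic form $q_2(z)$ of rank $r$ such that the germ of $X$ at $P$ is given (as a scheme) by an equation $q_2(z) + (\text{terms of degree} \ge 3) = 0$. Fix $r \ge 0$ and assume that every point of $X$ is either a smooth point of $X$ or a quadratic point of some rank $\ge r$. Let $B \subset X$ be an irreducible closed subvariety. Then there is a Zariski open set $U \subset Y$ such that (i) $B \cap U$ is non-empty and smooth, and (ii) the blow-up $\widetilde{X}_U$ of $X \cap U$ along $B \cap U$, which is a reduced closed subscheme of pure codimension $1$ (possibly empty) in the blow-up $\widetilde{Y}_U$ of $U$ along $B \cap U$, where $\widetilde{Y}_U$ is again a smooth variety of dimension $n$, has at most quadratic points of rank $\ge r$ as singularities: every point of $\widetilde{X}_U \subset \widetilde{Y}_U$ is either a smooth point of $\widetilde{X}_U$ or a quadratic point of some rank $\ge r$.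 ("Point" means closed point.) -/

import Mathlib

open AlgebraicGeometry CategoryTheory Topology Asymptotics

noncomputable section

namespace QuadraticPoints

/-! ### Varieties -/

/-- The base scheme `Spec ℂ`. -/
abbrev SpecC : Scheme.{0} := Spec (CommRingCat.of ℂ)

/-- `s : Y ⟶ Spec ℂ` makes `Y` a smooth complex variety of (pure) dimension `n`. Irreducibility
(equivalently, connectedness) of `Y` is not required. -/
structure IsSmoothVariety {Y : Scheme.{0}} (s : Y ⟶ SpecC) (n : ℕ) : Prop where
  separated : IsSeparated s
  quasiCompact : QuasiCompact s
  smooth : SmoothOfRelativeDimension n s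

/-- `i : X ⟶ Y` is the inclusion of a (closed, reduced, possibly reducible) subvariety all of whose
irreducible components have codimension one in `Y`. -/
structure IsHypersurface {X Y : Scheme.{0}} (i : X ⟶ Y) : Prop where
  closedImmersion : IsClosedImmersion i
  reduced : IsReduced X
  codim_one : ∀ x : X, closure {x} ∈ irreducibleComponents X → Order.coheight (i x) = 1

/-! ### Analytic coordinates and quadratic points -/

/-- The ring of germs at the origin of holomorphic functions on `ℂⁿ`. -/
def HolGerm (n : ℕ) : Subring (Filter.Germ (𝓝 (0 : Fin n → ℂ)) ℂ) where
  carrier := {φ | ∃ f : (Fin n → ℂ) → ℂ, AnalyticAt ℂ f 0 ∧ φ = (f : Filter.Germ _ ℂ)}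
  mul_mem' := by
    rintro _ _ ⟨f, hf, rfl⟩ ⟨g, hg, rfl⟩
    exact ⟨f * g, hf.mul hg, rfl⟩
  one_mem' := ⟨fun _ => 1, analyticAt_const, rfl⟩
  add_mem' := by
    rintro _ _ ⟨f, hf, rfl⟩ ⟨g, hg, rfl⟩
    exact ⟨f + g, hf.add hg, rfl⟩
  zero_mem' := ⟨fun _ => 0, analyticAt_const, rfl⟩
  neg_mem' := by
    rintro _ ⟨f, hf, rfl⟩
    exact ⟨-f, hf.neg, rfl⟩

/-- The germ at the origin of a function that is holomorphic there. -/
def HolGerm.mk {n : ℕ} (f : (Fin n → ℂ) → ℂ) (hf : AnalyticAt ℂ f 0) : HolGerm n :=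
  ⟨(f : Filter.Germ (𝓝 (0 : Fin n → ℂ)) ℂ), f, hf, rfl⟩

/-- The germ of the constant function `c`. -/
def HolGerm.const {n : ℕ} (c : ℂ) : HolGerm n := HolGerm.mk (fun _ => c) analyticAt_const

/-- The germ of the coordinate function `z_k`. -/
def HolGerm.coord {n : ℕ} (k : Fin n) : HolGerm n :=
  HolGerm.mk (fun z => z k) ((ContinuousLinearMap.proj (R := ℂ) (φ := fun _ : Fin n => ℂ) k).analyticAt 0)

/-- The constants in the local ring of a complex scheme at a point. -/
def constants {Y : Scheme.{0}} (s : Y ⟶ SpecC) (y : Y) : ℂ →+* Y.presheaf.stalk y :=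
  (Y.presheaf.germ ⊤ y trivial).hom.comp
    (s.appTop.hom.comp (Scheme.ΓSpecIso (CommRingCat.of ℂ)).inv.hom)

/-- Analytic coordinates `z_1, …, z_n` centred at a point `y` of a smooth complex variety of
dimension `n`, given by the homomorphism `φ` that writes a germ of a regular function as a
holomorphic function of the coordinates. Such a `φ` is the pullback of functions along a germ of a
holomorphic map from `(ℂⁿ, 0)` to the complex manifold underlying `Y`, centred at `y`; this map
germ is biholomorphic exactly when the functions vanishing at `y` generate the maximal ideal
`(z_1, …, z_n)` of the ring of holomorphic germs. -/
structure IsAnalyticCoordinates {Y : Scheme.{0}} (s : Y ⟶ SpecC) (n : ℕ) (y : Y)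
    (φ : Y.presheaf.stalk y →+* HolGerm n) : Prop where
  map_constants : ∀ c : ℂ, φ (constants s y c) = HolGerm.const c
  map_maximalIdeal : (IsLocalRing.maximalIdeal (Y.presheaf.stalk y)).map φ =
    Ideal.span (Set.range HolGerm.coord)

/-- `x` is a quadratic point of rank `r` of the hypersurface `i : X ⟶ Y`: in suitable analytic
coordinates `z` of `Y` around `x`, the ideal of the germ of `X` is generated by
`g(z) = q(z) + (terms of degree ≥ 3)`, where `q(z) = zᵀ A z` is a quadratic form of rank `r`. -/
def IsQuadraticPoint {X Y : Scheme.{0}} (s : Y ⟶ SpecC) (n : ℕ) (i : X ⟶ Y) (r : ℕ) (x : X) :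
    Prop :=
  ∃ φ : Y.presheaf.stalk (i x) →+* HolGerm n, IsAnalyticCoordinates s n (i x) φ ∧
    ∃ A : Matrix (Fin n) (Fin n) ℂ, A.IsSymm ∧ A.rank = r ∧
      ∃ (g : (Fin n → ℂ) → ℂ) (hg : AnalyticAt ℂ g 0),
        (fun z => g z - z ⬝ᵥ A.mulVec z) =O[𝓝 0] (fun z => ‖z‖ ^ 3) ∧
        (RingHom.ker (i.stalkMap x).hom).map φ = Ideal.span {HolGerm.mk g hg}

/-- The complex scheme `s : X ⟶ Spec ℂ` is smooth at the point `x`. -/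
def IsSmoothPoint {X : Scheme.{0}} (s : X ⟶ SpecC) (x : X) : Prop :=
  ∃ V : X.Opens, x ∈ V ∧ Smooth (V.ι ≫ s)

/-- The hypersurface `i : X ⟶ Y` has at most quadratic points of rank `≥ r` as singularities: every
(closed) point of `X` is a smooth point of `X` or a quadratic point of some rank `≥ r`. -/
def HasAtMostQuadraticPoints {X Y : Scheme.{0}} (s : Y ⟶ SpecC) (n : ℕ) (i : X ⟶ Y) (r : ℕ) :
    Prop :=
  ∀ x : X, IsClosed ({x} : Set X) →
    IsSmoothPoint (i ≫ s) x ∨ ∃ r' : ℕ, r ≤ r' ∧ IsQuadraticPoint s n i r' x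

/-! ### Blow-ups -/

/-- An ideal sheaf that defines an effective Cartier divisor: locally it is generated by one
nonzerodivisor. -/
def IsCartier {X : Scheme.{0}} (I : X.IdealSheafData) : Prop :=
  ∀ x : X, ∃ V : X.affineOpens, x ∈ V.1 ∧
    ∃ a ∈ nonZeroDivisors Γ(X, V), I.ideal V = Ideal.span {a}

/-- `π : X' ⟶ X` is the blow-up of `X` along the closed subscheme `b : B ⟶ X`: the inverse image of
`B` is an effective Cartier divisor on `X'`, and `π` is universal with this property. -/
structure IsBlowUp {X' X B : Scheme.{0}} (π : X' ⟶ X) (b : B ⟶ X) : Prop where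
  cartier : IsCartier (b.ker.comap π)
  existsUnique_lift : ∀ {T : Scheme.{0}} (f : T ⟶ X), IsCartier (b.ker.comap f) →
    ∃! g : T ⟶ X', g ≫ π = f

end QuadraticPoints

end

/-! It is enough to work near the generic point of `B`. There `Y` has an affine chart Spec A with
étale coordinates t_1, ..., t_n in which the ideal I of `B` is generated by the t_i with i in a set
S, and `X` has one equation f (`exists_normal_chart`). The coordinates exist because the residue
field at the generic point is formally smooth over ℂ: the conormal sequence splits, and elements of
I with independent differentials generate I locally (`exists_adapted_coordinates`). `X` is locally
principal (`exists_locally_principal`). At a smooth point this follows from adapted coordinates and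
codimension one. At a quadratic point the ideal becomes principal among holomorphic germs, and a
generator descends because germs are approximated by regular functions to every order and Krull's
intersection theorem applies.

After shrinking, f has a normal form (`exists_hasNormalForm`). Either f = ∑ b_i t_i with some b_i
invertible, or f lies in I² and f = ∑ a_ij t_i t_j with a symmetric.

In the chart of the blow-up where t_k generates the exceptional ideal, t_i = t_k u_i, and the chart
is again étale over affine space (`exists_blowupCoordinates`). The exceptional divisor t_k = 0 is an
affine space bundle over `B`, hence prime, so the strict transform is F = 0, where F is f divided by
the highest possible power of t_k (`IsBlowupChart.ker_eq_span`). Off the exceptional divisor nothing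
has changed (`IsBlowupChart.quadratic_of_ne_zero`).

On the exceptional divisor, in the first case F = ∑ b_i u_i with u_k = 1. This is affine linear on
each fibre, with coefficients not all zero, so F = 0 is smooth there
(`BlowupCoordinates.not_mem_sq_of_eq_sum`).

In the second case let the point lie over y in `B` and let F vanish there to second order. Since f
lies in I², y is not a smooth point of `X`, so it is a quadratic point of some rank r' ≥ r. The
quadratic part of f at y comes from α = (a_ij(y)) by linear substitution, so r' ≤ rank α
(`HolGerm.rank_le_rank_of_eq`). On the fibre over y, F is the polynomial uᵀαu with u_k = 1. It is
singular at the point c in question, hence αc = 0. As c_k = 1, α loses no rank when restricted to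
the fibre directions, where it agrees with the quadratic part H of F. So rank α ≤ rank H
(`rank_le_rank_of_isBigO`).

The blow-up itself is Proj of the Rees algebra. Its universal property is checked on charts, and
each chart ring is pinned down by the properties in `IsBlowupChart`. This allows replacing it by the
flat base change of the explicit monomial chart of affine space. -/

noncomputable section
namespace QuadraticPoints

/-! ### Charts of blow-ups -/

section Chart

variable {A : Type*} [CommRing A]

/-- The `A`-algebra `R` is the affine blow-up algebra `A[I/x]`. -/
structure IsBlowupChart (I : Ideal A) (x : A) (R : Type*) [CommRing R] [Algebra A R] : Prop where
  nzd : algebraMap A R x ∈ nonZeroDivisors R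
  map_eq : I.map (algebraMap A R) = Ideal.span {algebraMap A R x}
  exists_frac : ∀ r : R, ∃ m : ℕ, ∃ a ∈ I ^ m, algebraMap A R x ^ m * r = algebraMap A R a
  eq_zero : ∀ a : A, algebraMap A R a = 0 → ∃ N : ℕ, x ^ N * a = 0

namespace IsBlowupChart

variable {I : Ideal A} {x : A} {R : Type*} [CommRing R] [Algebra A R] (h : IsBlowupChart I x R)
  {C : Type*} [CommRing C] [Algebra A C]

lemma mul_left_cancel_of_nzd {c d : C} {a : C} (hx : a ∈ nonZeroDivisors C) {m : ℕ}
    (e : a ^ m * c = a ^ m * d) : c = d := by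
  have := (pow_mem hx m : a ^ m ∈ nonZeroDivisors C)
  exact (mul_cancel_left_mem_nonZeroDivisors this).mp e

-- An element r with x^m r = a must go to the c with x^m c = a. Such a c exists since a lies in I^m,
-- and it does not depend on the representation, because two of them differ by x-power torsion,
-- which dies where x is a nonzerodivisor.
include h in
lemma exists_lift (hx : algebraMap A C x ∈ nonZeroDivisors C)
    (hI : I.map (algebraMap A C) ≤ Ideal.span {algebraMap A C x}) : Nonempty (R →ₐ[A] C) := by
  have key (r : R) : ∃ c : C, ∀ m : ℕ, ∀ a : A, algebraMap A R x ^ m * r = algebraMap A R a →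
      algebraMap A C x ^ m * c = algebraMap A C a := by
    obtain ⟨m, a, ha, e⟩ := h.exists_frac r
    have h1 : algebraMap A C a ∈ Ideal.span {algebraMap A C x ^ m} := by
      rw [← Ideal.span_singleton_pow]
      refine Ideal.pow_right_mono hI m ?_
      rw [← Ideal.map_pow]
      exact Ideal.mem_map_of_mem _ ha
    obtain ⟨c, hc⟩ := Ideal.mem_span_singleton'.mp h1
    refine ⟨c, fun m' a' e' ↦ ?_⟩
    have h2 : algebraMap A R (x ^ m' * a - x ^ m * a') = 0 := by
      simp only [map_sub, map_mul, map_pow, ← e, ← e']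
      ring
    obtain ⟨N, hN⟩ := h.eq_zero _ h2
    have h3 := congr(algebraMap A C $hN)
    simp only [map_sub, map_mul, map_pow, ← hc, map_zero] at h3
    refine mul_left_cancel_of_nzd hx (m := N + m) ?_
    rw [← sub_eq_zero, ← h3]
    ring
  choose g hg using key
  have uniq (r : R) (c : C) (m : ℕ) (a : A) (e : algebraMap A R x ^ m * r = algebraMap A R a)
      (e' : algebraMap A C x ^ m * c = algebraMap A C a) : g r = c :=
    mul_left_cancel_of_nzd hx (m := m) ((hg r m a e).trans e'.symm)
  refine ⟨⟨⟨⟨⟨g, ?_⟩, ?_⟩, ?_, ?_⟩, ?_⟩⟩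
  · exact uniq 1 1 0 1 (by simp) (by simp)
  · intro r s
    obtain ⟨m, a, -, e⟩ := h.exists_frac r
    obtain ⟨m', a', -, e'⟩ := h.exists_frac s
    refine uniq _ _ (m + m') (a * a') ?_ ?_
    · rw [map_mul, ← e, ← e']; ring
    · rw [map_mul, ← hg _ _ _ e, ← hg _ _ _ e']; ring
  · exact uniq 0 0 0 0 (by simp) (by simp)
  · intro r s
    obtain ⟨m, a, -, e⟩ := h.exists_frac r
    obtain ⟨m', a', -, e'⟩ := h.exists_frac s
    refine uniq _ _ (m + m') (x ^ m' * a + x ^ m * a') ?_ ?_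
    · simp only [map_add, map_mul, map_pow, ← e, ← e']; ring
    · simp only [map_add, map_mul, map_pow, ← hg _ _ _ e, ← hg _ _ _ e']; ring
  · intro a
    exact uniq _ _ 0 a (by simp) (by simp)

include h in
lemma hom_ext (hx : algebraMap A C x ∈ nonZeroDivisors C) (f g : R →ₐ[A] C) : f = g := by
  ext r
  obtain ⟨m, a, -, e⟩ := h.exists_frac r
  refine mul_left_cancel_of_nzd hx (m := m) ?_
  have e1 := congr(f $e)
  have e2 := congr(g $e)
  simp only [map_mul, map_pow, AlgHom.commutes] at e1 e2
  rw [e1, e2]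

-- The defining properties determine the algebra, so the Rees chart may be exchanged for a base
-- change of the explicit polynomial chart.
include h in
lemma exists_algEquiv {R' : Type*} [CommRing R'] [Algebra A R'] (h' : IsBlowupChart I x R') :
    Nonempty (R ≃ₐ[A] R') := by
  obtain ⟨f⟩ := h.exists_lift h'.nzd h'.map_eq.le
  obtain ⟨g⟩ := h'.exists_lift h.nzd h.map_eq.le
  exact ⟨AlgEquiv.ofAlgHom f g (h'.hom_ext h'.nzd _ _) (h.hom_ext h.nzd _ _)⟩

end IsBlowupChart

end Chart

/-! ### The Rees algebra as a graded ring -/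

section Rees

open Polynomial

variable {A : Type*} [CommRing A] (I : Ideal A)

/-- The homogeneous part of degree `m` of the Rees algebra. -/
def reesGrading (m : ℕ) : Submodule A (reesAlgebra I) :=
  (LinearMap.range (monomial m : A →ₗ[A] A[X])).comap (reesAlgebra I).val.toLinearMap

variable {I}

/-- The element `a Xᵐ` of the Rees algebra. -/
def reesMonomial (m : ℕ) (a : A) (ha : a ∈ I ^ m) : reesAlgebra I :=
  ⟨monomial m a, reesAlgebra.monomial_mem.mpr ha⟩

lemma reesMonomial_mem (m : ℕ) (a : A) (ha : a ∈ I ^ m) :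
    reesMonomial m a ha ∈ reesGrading I m := ⟨a, rfl⟩

lemma exists_eq_reesMonomial {m : ℕ} {p : reesAlgebra I} (hp : p ∈ reesGrading I m) :
    ∃ a, ∃ ha : a ∈ I ^ m, p = reesMonomial m a ha := by
  obtain ⟨a, ha⟩ := hp
  have : a ∈ I ^ m := reesAlgebra.monomial_mem.mp (ha ▸ p.2)
  exact ⟨a, this, Subtype.ext ha.symm⟩

instance : SetLike.GradedMonoid (reesGrading I) where
  one_mem := ⟨1, by simp⟩
  mul_mem := by
    rintro i j p q ⟨a, ha⟩ ⟨b, hb⟩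
    refine ⟨a * b, ?_⟩
    change _ = (p : A[X]) * (q : A[X])
    rw [← show _ = (p : A[X]) from ha, ← show _ = (q : A[X]) from hb]
    rw [monomial_mul_monomial]

/-- The homogeneous component of degree `i`. -/
def reesComponent (p : reesAlgebra I) (i : ℕ) : reesGrading I i :=
  ⟨reesMonomial i ((p : A[X]).coeff i) (p.2 i), reesMonomial_mem _ _ _⟩

lemma coeff_coe_directSum (x : DirectSum ℕ fun i ↦ reesGrading I i) (i : ℕ) :
    (DirectSum.coeAddMonoidHom (reesGrading I) x : A[X]).coeff i =
      ((x i : reesAlgebra I) : A[X]).coeff i := by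
  classical
  induction x using DirectSum.induction_on with
  | zero => simp
  | of j y =>
    rw [DirectSum.coeAddMonoidHom_of]
    by_cases h : j = i
    · subst h; simp
    · rw [DirectSum.of_eq_of_ne _ _ _ (Ne.symm h)]
      obtain ⟨a, ha⟩ := y.2
      rw [← show _ = ((y : reesAlgebra I) : A[X]) from ha, coeff_monomial_of_ne _ (Ne.symm h)]
      simp
  | add x y hx hy => simp [hx, hy]

instance : GradedAlgebra (reesGrading I) where
  decompose' p := DFinsupp.mk (p : A[X]).support fun i ↦ reesComponent p i
  left_inv p := by
    apply Subtype.ext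
    ext i
    rw [coeff_coe_directSum]
    erw [DFinsupp.mk_apply]
    split_ifs with h
    · simp [reesComponent, reesMonomial]
    · simpa using (notMem_support_iff.mp h).symm
  right_inv x := by
    apply DFinsupp.ext
    intro i
    erw [DFinsupp.mk_apply]
    obtain ⟨a, ha, e⟩ := exists_eq_reesMonomial (x i).2
    have h2 := coeff_coe_directSum x i
    have h3 : ((x i : reesAlgebra I) : A[X]).coeff i = a := by
      rw [e]; simp [reesMonomial]
    split_ifs with h
    · apply Subtype.ext
      apply Subtype.ext
      simp only [reesComponent, reesMonomial]
      rw [h2, h3, e]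
      rfl
    · have := notMem_support_iff.mp h
      rw [h2, h3] at this
      apply Subtype.ext
      apply Subtype.ext
      rw [e]
      simp [reesMonomial, this]

lemma reesMonomial_mul {m k : ℕ} {a b : A} (ha : a ∈ I ^ m) (hb : b ∈ I ^ k) :
    reesMonomial m a ha * reesMonomial k b hb =
      reesMonomial (m + k) (a * b) (by rw [pow_add]; exact Ideal.mul_mem_mul ha hb) :=
  Subtype.ext (monomial_mul_monomial _ _ _ _)

end Rees

/-! ### Standard charts of Proj of the Rees algebra. -/

section ReesChart

open HomogeneousLocalization

variable {A : Type*} [CommRing A] (I : Ideal A)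

/-- The subring of degree zero elements of the Rees algebra is the base ring. -/
def reesZero : A →+* reesGrading I 0 := algebraMap A (reesGrading I 0)

lemma reesZero_bijective : Function.Bijective (reesZero I) := by
  constructor
  · intro a b h
    have := congr(((($h : reesGrading I 0) : reesAlgebra I) : Polynomial A).coeff 0)
    simpa [reesZero] using this
  · intro p
    obtain ⟨a, ha⟩ := p.2
    refine ⟨a, Subtype.ext (Subtype.ext ?_)⟩
    exact ha

variable {I} {x : A} (hx : x ∈ I)

/-- The degree one element `x t` of the Rees algebra. -/
def reesT : reesAlgebra I := reesMonomial 1 x (by simpa using hx)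

lemma reesT_mem : reesT hx ∈ reesGrading I 1 := reesMonomial_mem _ _ _

lemma reesT_pow (n : ℕ) : reesT hx ^ n = reesMonomial n (x ^ n) (Ideal.pow_mem_pow hx n) := by
  apply Subtype.ext
  simp [reesT, reesMonomial, Polynomial.monomial_pow]

/-- The coordinate ring of the chart of the blow-up where `x` generates the exceptional ideal. -/
def ReesChart : Type _ := Away (reesGrading I) (reesT hx)

instance : CommRing (ReesChart hx) :=
  inferInstanceAs (CommRing (Away (reesGrading I) (reesT hx)))

instance : Algebra A (ReesChart hx) :=
  RingHom.toAlgebra (S := ReesChart hx)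
    ((fromZeroRingHom (reesGrading I) (Submonoid.powers (reesT hx))).comp (reesZero I))

/-- The fraction `a / x ^ n` with `a ∈ I ^ n`. -/
def reesFrac (n : ℕ) (a : A) (ha : a ∈ I ^ n) : ReesChart hx :=
  Away.mk (reesGrading I) (reesT_mem hx) n (reesMonomial n a ha)
    (by simpa using reesMonomial_mem n a ha)

lemma exists_eq_reesFrac (r : ReesChart hx) : ∃ n a, ∃ ha : a ∈ I ^ n, r = reesFrac hx n a ha := by
  obtain ⟨n, p, hp, rfl⟩ :=
    HomogeneousLocalization.Away.mk_surjective (reesGrading I) (reesT_mem hx) r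
  obtain ⟨a, ha, e⟩ := exists_eq_reesMonomial hp
  have h1 : n • 1 = n := by simp
  refine ⟨n, a, by simpa using ha, ?_⟩
  subst e
  unfold reesFrac
  congr 1
  exact Subtype.ext (by simp [reesMonomial])

lemma algebraMap_reesChart (a : A) :
    algebraMap A (ReesChart hx) a = reesFrac hx 0 a (by simp) := by
  apply HomogeneousLocalization.val_injective
  change HomogeneousLocalization.val (fromZeroRingHom (reesGrading I)
    (Submonoid.powers (reesT hx)) (reesZero I a)) = _
  rw [reesFrac, Away.val_mk]
  change Localization.mk _ _ = _
  congr 1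

lemma reesFrac_mul {n m : ℕ} {a b : A} (ha : a ∈ I ^ n) (hb : b ∈ I ^ m) :
    reesFrac hx n a ha * reesFrac hx m b hb =
      reesFrac hx (n + m) (a * b) (by rw [pow_add]; exact Ideal.mul_mem_mul ha hb) := by
  apply HomogeneousLocalization.val_injective
  refine (val_mul _ _).trans ?_
  simp only [reesFrac, Away.val_mk, Localization.mk_mul]
  congr 1
  · exact reesMonomial_mul ha hb
  · exact Subtype.ext (by simp [pow_add])

lemma reesFrac_eq_iff {n m : ℕ} {a b : A} (ha : a ∈ I ^ n) (hb : b ∈ I ^ m) :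
    reesFrac hx n a ha = reesFrac hx m b hb ↔ ∃ N, x ^ N * (x ^ m * a) = x ^ N * (x ^ n * b) := by
  refine (HomogeneousLocalization.ext_iff_val _ _).trans ?_
  simp only [reesFrac, Away.val_mk, Localization.mk_eq_mk_iff, Localization.r_iff_exists]
  constructor
  · rintro ⟨⟨_, N, rfl⟩, e⟩
    refine ⟨N, ?_⟩
    simp only [reesT_pow, reesMonomial_mul] at e
    have := congr((($e : reesAlgebra I) : Polynomial A).coeff (N + (m + n)))
    rw [reesMonomial, reesMonomial, Polynomial.coeff_monomial_same, add_comm m n,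
      Polynomial.coeff_monomial_same] at this
    exact this
  · rintro ⟨N, e⟩
    refine ⟨⟨_, N, rfl⟩, ?_⟩
    simp only [reesT_pow, reesMonomial_mul]
    apply Subtype.ext
    simp only [reesMonomial]
    rw [e, add_comm m n]

lemma isBlowupChart_reesChart : IsBlowupChart I x (ReesChart hx) where
  nzd := by
    refine mem_nonZeroDivisors_iff_right.mpr fun r hr ↦ ?_
    rw [mul_comm] at hr
    obtain ⟨n, a, ha, rfl⟩ := exists_eq_reesFrac hx r
    rw [algebraMap_reesChart, reesFrac_mul,
      ← map_zero (algebraMap A (ReesChart hx)), algebraMap_reesChart, reesFrac_eq_iff] at hr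
    rw [← map_zero (algebraMap A (ReesChart hx)), algebraMap_reesChart, reesFrac_eq_iff]
    obtain ⟨N, hN⟩ := hr
    exact ⟨N + 1, by linear_combination hN⟩
  map_eq := by
    apply le_antisymm
    · rw [Ideal.map_le_iff_le_comap]
      intro y hy
      rw [Ideal.mem_comap, Ideal.mem_span_singleton']
      refine ⟨reesFrac hx 1 y (by simpa using hy), ?_⟩
      rw [algebraMap_reesChart, algebraMap_reesChart, reesFrac_mul, reesFrac_eq_iff]
      exact ⟨0, by ring⟩
    · rw [Ideal.span_singleton_le_iff_mem]
      exact Ideal.mem_map_of_mem _ hx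
  exists_frac r := by
    obtain ⟨n, a, ha, rfl⟩ := exists_eq_reesFrac hx r
    refine ⟨n, a, ha, ?_⟩
    rw [← map_pow, algebraMap_reesChart, algebraMap_reesChart, reesFrac_mul, reesFrac_eq_iff]
    exact ⟨0, by ring⟩
  eq_zero a ha := by
    rw [← map_zero (algebraMap A (ReesChart hx)), algebraMap_reesChart, algebraMap_reesChart,
      reesFrac_eq_iff] at ha
    obtain ⟨N, hN⟩ := ha
    exact ⟨N, by linear_combination hN⟩

/-- Two charts overlap where the fraction y/x is invertible; this identifies that fraction with any
solution u of x u = y, unique because x is a nonzerodivisor. -/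
lemma isLocalizationElem_eq {y : A} (hy : y ∈ I) (u : ReesChart hx)
    (hu : algebraMap A (ReesChart hx) x * u = algebraMap A (ReesChart hx) y) :
    HomogeneousLocalization.Away.isLocalizationElem (reesT_mem hx) (reesT_mem hy) = u := by
  have h1 : HomogeneousLocalization.Away.isLocalizationElem (reesT_mem hx) (reesT_mem hy) =
      reesFrac hx 1 y (by simpa using hy) := by
    unfold HomogeneousLocalization.Away.isLocalizationElem reesFrac
    congr 1
    exact pow_one _
  have h2 : algebraMap A (ReesChart hx) x * reesFrac hx 1 y (by simpa using hy) =
      algebraMap A (ReesChart hx) x * u := by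
    rw [hu, algebraMap_reesChart, algebraMap_reesChart, reesFrac_mul, reesFrac_eq_iff]
    exact ⟨0, by ring⟩
  exact h1.trans ((mul_cancel_left_mem_nonZeroDivisors (isBlowupChart_reesChart hx).nzd).mp h2)

end ReesChart

/-! ### The blow-up of an affine scheme -/

/-- A blow-up of `Spec A` along the ideal generated by the family `x`, with its standard charts. -/
structure BlowUpAtlas {A : Type} [CommRing A] {ι : Type} (x : ι → A) where
  /-- The blow-up. -/
  scheme : Scheme.{0}
  /-- The blow-down morphism. -/
  π : scheme ⟶ Spec (.of A)
  /-- The coordinate rings of the charts. -/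
  R : ι → Type
  [commRing : ∀ k, CommRing (R k)]
  [algebra : ∀ k, Algebra A (R k)]
  /-- The charts. -/
  chart : ∀ k, Spec (.of (R k)) ⟶ scheme
  isOpenImmersion : ∀ k, IsOpenImmersion (chart k)
  covers : ∀ p, ∃ k, p ∈ Set.range (chart k)
  chart_π : ∀ k, chart k ≫ π = Spec.map (CommRingCat.ofHom (algebraMap A (R k)))
  isBlowupChart : ∀ k, IsBlowupChart (Ideal.span (Set.range x)) (x k) (R k)
  mem_range_iff : ∀ k l, ∀ u : R k, algebraMap A (R k) (x k) * u = algebraMap A (R k) (x l) →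
    ∀ p, chart k p ∈ Set.range (chart l) ↔ p ∈ PrimeSpectrum.basicOpen u
  isSeparated : IsSeparated π

attribute [instance] BlowUpAtlas.commRing BlowUpAtlas.algebra BlowUpAtlas.isOpenImmersion
  BlowUpAtlas.isSeparated

section Atlas

variable {A : Type} [CommRing A] {ι : Type} (x : ι → A)

/-- This makes the charts of the generators cover Proj: an element of positive degree is a sum of
terms y b t^(m+1) = (y t)(b t^m) with y in I and b in I^m. -/
lemma irrelevant_le_span :
    (HomogeneousIdeal.irrelevant (reesGrading (Ideal.span (Set.range x)))).toIdeal ≤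
      Ideal.span (Set.range fun k ↦ reesT (Ideal.subset_span (Set.mem_range_self k) :
        x k ∈ Ideal.span (Set.range x))) := by
  classical
  intro z hz
  rw [← DirectSum.sum_support_decompose (reesGrading (Ideal.span (Set.range x))) z]
  refine Ideal.sum_mem _ fun m hm ↦ ?_
  have hz := (HomogeneousIdeal.mem_irrelevant_iff _ _).mp hz
  rcases m with - | m
  · rw [GradedRing.proj_apply] at hz
    rw [hz]
    exact zero_mem _
  obtain ⟨a, ha, e⟩ := exists_eq_reesMonomial
    (DirectSum.decompose (reesGrading (Ideal.span (Set.range x))) z (m + 1)).2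
  rw [e]
  clear e hm
  have : a ∈ Ideal.span (Set.range x) * Ideal.span (Set.range x) ^ m := by
    rwa [← pow_succ']
  suffices H : ∃ ha : a ∈ Ideal.span (Set.range x) ^ (m + 1), reesMonomial (m + 1) a ha ∈
      Ideal.span (Set.range fun k ↦ reesT (Ideal.subset_span (Set.mem_range_self k) :
        x k ∈ Ideal.span (Set.range x))) from H.2
  clear ha
  induction this using Submodule.mul_induction_on' with
  | mem_mul_mem y hy b hb =>
    refine ⟨by rw [pow_succ']; exact Ideal.mul_mem_mul hy hb, ?_⟩
    induction hy using Submodule.span_induction with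
    | mem y hy =>
      obtain ⟨k, rfl⟩ := hy
      have : reesMonomial (m + 1) (x k * b) (by
          rw [pow_succ']; exact Ideal.mul_mem_mul (Ideal.subset_span ⟨k, rfl⟩) hb) =
          reesMonomial m b hb * reesT (Ideal.subset_span (Set.mem_range_self k) :
            x k ∈ Ideal.span (Set.range x)) := by
        rw [reesT, reesMonomial_mul]
        apply Subtype.ext
        simp [reesMonomial, mul_comm]
      rw [this]
      exact Ideal.mul_mem_left _ _ (Ideal.subset_span ⟨k, rfl⟩)
    | zero =>
      convert! zero_mem (Ideal.span _)
      exact Subtype.ext (by simp [reesMonomial])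
    | add y y' hy hy' h h' =>
      convert! add_mem h h'
      exact Subtype.ext (by simp [reesMonomial, add_mul])
    | smul c y hy h =>
      convert! Ideal.mul_mem_left _ (algebraMap A _ c) h
      exact Subtype.ext (by
        simp [reesMonomial, mul_assoc, Polynomial.C_mul_monomial])
  | add a _ b _ ha hb =>
    obtain ⟨ha, ha'⟩ := ha
    obtain ⟨hb, hb'⟩ := hb
    refine ⟨add_mem ha hb, ?_⟩
    convert! add_mem ha' hb'
    exact Subtype.ext (by simp [reesMonomial])

variable {x}

/-- The inclusion of a chart of the blow-up. -/
def reesChartι {I : Ideal A} {y : A} (hy : y ∈ I) :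
    Spec (.of (ReesChart hy)) ⟶ Proj (reesGrading I) :=
  Proj.awayι (reesGrading I) (reesT hy) (reesT_mem hy) one_pos

instance {I : Ideal A} {y : A} (hy : y ∈ I) : IsOpenImmersion (reesChartι hy) :=
  inferInstanceAs (IsOpenImmersion (Proj.awayι (reesGrading I) (reesT hy) (reesT_mem hy) one_pos))

lemma range_reesChartι {I : Ideal A} {y : A} (hy : y ∈ I) :
    Set.range (reesChartι hy) = Proj.basicOpen (reesGrading I) (reesT hy) := by
  have := Proj.opensRange_awayι (reesGrading I) (reesT hy) (reesT_mem hy) one_pos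
  rw [← this]
  rfl

lemma reesChartι_π {I : Ideal A} {y : A} (hy : y ∈ I) :
    reesChartι hy ≫ Proj.toSpecZero (reesGrading I) ≫
      Spec.map (CommRingCat.ofHom (R := A) (S := reesGrading I 0) (reesZero I)) =
    Spec.map (CommRingCat.ofHom (algebraMap A (ReesChart hy))) := by
  have := Proj.awayι_toSpecZero_assoc (reesGrading I) (reesT hy) (reesT_mem hy) one_pos
    (Spec.map (CommRingCat.ofHom (R := A) (S := reesGrading I 0) (reesZero I)))
  refine this.trans ?_
  rw [← Spec.map_comp]
  rfl

variable (x)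

/-- The blow-up of `Spec A` as the projective spectrum of the Rees algebra. -/
def reesAtlas : BlowUpAtlas x :=
  let I := Ideal.span (Set.range x)
  have hx (k : ι) : x k ∈ I := Ideal.subset_span (Set.mem_range_self k)
  have : IsIso (CommRingCat.ofHom (R := A) (S := reesGrading I 0) (reesZero I)) := by
    exact (ConcreteCategory.isIso_iff_bijective (CommRingCat.ofHom (R := A) (S := reesGrading I 0) (reesZero I))).mpr
      (reesZero_bijective I)
  { scheme := Proj (reesGrading I)
    π := Proj.toSpecZero (reesGrading I) ≫ Spec.map (CommRingCat.ofHom (R := A) (S := reesGrading I 0) (reesZero I))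
    R := fun k ↦ ReesChart (hx k)
    chart := fun k ↦ reesChartι (hx k)
    isOpenImmersion := fun k ↦ inferInstance
    covers := by
      intro p
      have := (Proj.iSup_basicOpen_eq_top (reesGrading I) _ (irrelevant_le_span x)).ge
        (Set.mem_univ p)
      obtain ⟨k, hk⟩ := TopologicalSpace.Opens.mem_iSup.mp this
      exact ⟨k, (range_reesChartι (hx k)).ge hk⟩
    chart_π := fun k ↦ reesChartι_π (hx k)
    isBlowupChart := fun k ↦ isBlowupChart_reesChart (hx k)
    mem_range_iff := by
      intro k l u hu p
      rw [range_reesChartι]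
      have h0 := Proj.awayι_preimage_basicOpen (reesGrading I) (reesT_mem (hx k)) one_pos
        (reesT_mem (hx l)) one_pos
      refine Iff.trans (b := p ∈ Proj.awayι (reesGrading I) (reesT (hx k)) (reesT_mem (hx k))
        one_pos ⁻¹ᵁ (Proj.basicOpen (reesGrading I) (reesT (hx l)))) Iff.rfl ?_
      rw [h0]
      have := isLocalizationElem_eq (hx k) (hx l) u hu
      exact iff_of_eq congr(p ∈ PrimeSpectrum.basicOpen (R := ReesChart (hx k)) $this)
    isSeparated := inferInstance }

end Atlas

/-! ### Ideal sheaves on affine schemes -/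

/-- Pullback of ideal sheaves is left adjoint to pushforward, and on affine schemes an ideal sheaf
is its global ideal; both sides therefore have the same upper bounds J. -/
lemma ideal_top_comap {X Y : Scheme.{0}} [IsAffine X] [IsAffine Y] (f : X ⟶ Y)
    (I : Y.IdealSheafData) :
    (I.comap f).ideal ⟨⊤, isAffineOpen_top X⟩ =
      (I.ideal ⟨⊤, isAffineOpen_top Y⟩).map f.appTop.hom := by
  have key (J : X.IdealSheafData) : I.comap f ≤ J ↔
      (I.ideal ⟨⊤, isAffineOpen_top Y⟩).map f.appTop.hom ≤ J.ideal ⟨⊤, isAffineOpen_top X⟩ := by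
    rw [← Scheme.IdealSheafData.le_map_iff_comap_le, Ideal.map_le_iff_le_comap]
    have := Scheme.IdealSheafData.ideal_map_of_isAffineHom J f ⟨⊤, isAffineOpen_top Y⟩
    constructor
    · intro h
      exact (h ⟨⊤, isAffineOpen_top Y⟩).trans this.le
    · intro h
      exact Scheme.IdealSheafData.le_of_isAffine (h.trans this.ge)
  apply le_antisymm
  · have h := (key (.ofIdealTop ((I.ideal ⟨⊤, isAffineOpen_top Y⟩).map f.appTop.hom))).mpr
      (by simp [Scheme.IdealSheafData.ofIdealTop_ideal])
    refine (h ⟨⊤, isAffineOpen_top X⟩).trans (by simp)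
  · exact (key _).mp le_rfl

/-- The ideal of `A` defining a closed subscheme of `Spec A`. -/
def specIdeal {A : Type} [CommRing A] (K : (Spec (.of A)).IdealSheafData) : Ideal A :=
  (K.ideal ⟨⊤, isAffineOpen_top _⟩).comap (Scheme.ΓSpecIso (.of A)).inv.hom

section

variable {A C : Type} [CommRing A] [CommRing C]

lemma ΓSpecIso_inv_bijective : Function.Bijective (Scheme.ΓSpecIso (.of A)).inv.hom :=
  ConcreteCategory.bijective_of_isIso (Scheme.ΓSpecIso (.of A)).inv

lemma map_specIdeal (K : (Spec (.of A)).IdealSheafData) :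
    (specIdeal K).map (Scheme.ΓSpecIso (.of A)).inv.hom = K.ideal ⟨⊤, isAffineOpen_top _⟩ :=
  Ideal.map_comap_of_surjective _ ΓSpecIso_inv_bijective.2 _

lemma specIdeal_comap (ψ : A →+* C) (K : (Spec (.of A)).IdealSheafData) :
    specIdeal (K.comap (Spec.map (CommRingCat.ofHom ψ))) = (specIdeal K).map ψ := by
  have h := ideal_top_comap (Spec.map (CommRingCat.ofHom ψ)) K
  rw [specIdeal, h, ← map_specIdeal, Ideal.map_map, ← CommRingCat.hom_comp,
    ← Scheme.ΓSpecIso_inv_naturality, CommRingCat.hom_comp, ← Ideal.map_map]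
  exact Ideal.comap_map_of_bijective _ ΓSpecIso_inv_bijective

lemma specIdeal_injective {K L : (Spec (.of A)).IdealSheafData} (h : specIdeal K = specIdeal L) :
    K = L := by
  apply Scheme.IdealSheafData.ext_of_isAffine
  rw [← map_specIdeal, ← map_specIdeal, h]


lemma specIdeal_comap_isOpenImmersion {X : Scheme.{0}} (K : X.IdealSheafData)
    (e : Spec (.of C) ⟶ X) [IsOpenImmersion e] :
    ∃ τ : C →+* Γ(X, e ''ᵁ ⊤), Function.Bijective τ ∧
      specIdeal (K.comap e) =
        (K.ideal ⟨e ''ᵁ ⊤, (isAffineOpen_top _).image_of_isOpenImmersion e⟩).comap τ := by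
  refine ⟨((e.appIso ⊤).inv.hom.comp (Scheme.ΓSpecIso (.of C)).inv.hom), ?_, ?_⟩
  · exact (ConcreteCategory.bijective_of_isIso (e.appIso ⊤).inv).comp ΓSpecIso_inv_bijective
  · rw [specIdeal, Scheme.IdealSheafData.ideal_comap_of_isOpenImmersion, Ideal.comap_comap]

lemma mem_nonZeroDivisors_of_bijective {τ : A →+* C} (h : Function.Bijective τ) {a : A}
    (ha : a ∈ nonZeroDivisors A) : τ a ∈ nonZeroDivisors C := by
  refine mem_nonZeroDivisors_iff_right.mpr fun c hc ↦ ?_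
  obtain ⟨b, rfl⟩ := h.2 c
  rw [← map_mul, ← map_zero τ] at hc
  rw [mem_nonZeroDivisors_iff_right.mp ha b (h.1 hc), map_zero]

/-- Allows the Cartier condition to be tested on arbitrary charts Spec C ⟶ X, where ideals live in a
fixed ring. -/
lemma isCartier_of_forall {X : Scheme.{0}} (K : X.IdealSheafData)
    (h : ∀ x : X, ∃ (C : Type) (_ : CommRing C) (e : Spec (.of C) ⟶ X), IsOpenImmersion e ∧
      x ∈ Set.range e ∧ ∃ a ∈ nonZeroDivisors C, specIdeal (K.comap e) = Ideal.span {a}) :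
    IsCartier K := by
  intro x
  obtain ⟨C, _, e, _, ⟨y, rfl⟩, a, ha, hK⟩ := h x
  obtain ⟨τ, hτ, hτ'⟩ := specIdeal_comap_isOpenImmersion K e
  refine ⟨⟨e ''ᵁ ⊤, (isAffineOpen_top _).image_of_isOpenImmersion e⟩, ⟨y, trivial, rfl⟩, τ a,
    mem_nonZeroDivisors_of_bijective hτ ha, ?_⟩
  refine (Ideal.map_comap_of_surjective τ hτ.2
    (K.ideal ⟨e ''ᵁ ⊤, (isAffineOpen_top _).image_of_isOpenImmersion e⟩)).symm.trans ?_
  rw [← hτ', hK, Ideal.map_span, Set.image_singleton]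

lemma exists_specIdeal_eq_of_eq_image {X : Scheme.{0}} (K : X.IdealSheafData)
    (e : Spec (.of C) ⟶ X) [IsOpenImmersion e] (V : X.affineOpens) (hV : V.1 = e ''ᵁ ⊤)
    {a : Γ(X, V.1)} (ha : a ∈ nonZeroDivisors Γ(X, V.1)) (h : K.ideal V = Ideal.span {a}) :
    ∃ c ∈ nonZeroDivisors C, specIdeal (K.comap e) = Ideal.span {c} := by
  obtain ⟨V, hV'⟩ := V
  change V = _ at hV
  subst hV
  obtain ⟨τ, hτ, hτ'⟩ := specIdeal_comap_isOpenImmersion K e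
  let τ' := RingEquiv.ofBijective τ hτ
  refine ⟨τ'.symm a, mem_nonZeroDivisors_of_bijective (τ := τ'.symm.toRingHom)
    τ'.symm.bijective ha, ?_⟩
  rw [hτ', h]
  change Ideal.comap τ' _ = _
  rw [← Ideal.map_symm, Ideal.map_span, Set.image_singleton]

lemma IsCartier.exists_spec {X : Scheme.{0}} {K : X.IdealSheafData} (h : IsCartier K) (x : X) :
    ∃ (C : Type) (_ : CommRing C) (e : Spec (.of C) ⟶ X), IsOpenImmersion e ∧
      x ∈ Set.range e ∧ ∃ a ∈ nonZeroDivisors C, specIdeal (K.comap e) = Ideal.span {a} := by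
  obtain ⟨V, hx, a, ha, hK⟩ := h x
  have : IsOpenImmersion (IsAffineOpen.fromSpec V.2) := IsAffineOpen.isOpenImmersion_fromSpec _
  refine ⟨Γ(X, V), inferInstance, IsAffineOpen.fromSpec V.2, this, ?_, ?_⟩
  · rw [IsAffineOpen.range_fromSpec V.2]; exact hx
  · refine exists_specIdeal_eq_of_eq_image K (C := Γ(X, V)) (IsAffineOpen.fromSpec V.2) V ?_ ha hK
    have h2 := IsAffineOpen.opensRange_fromSpec V.2
    exact ((Scheme.Hom.image_top_eq_opensRange (f := IsAffineOpen.fromSpec V.2)).trans h2).symm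

/-- Nonzerodivisors survive because an open immersion is flat. -/
lemma exists_ringHom_of_isOpenImmersion (e : Spec (.of C) ⟶ Spec (.of A)) [IsOpenImmersion e] :
    ∃ ψ : A →+* C, e = Spec.map (CommRingCat.ofHom ψ) ∧
      ∀ a ∈ nonZeroDivisors A, ψ a ∈ nonZeroDivisors C := by
  refine ⟨(Spec.preimage e).hom, (Spec.map_preimage e).symm, fun a ha ↦ ?_⟩
  have : Flat (Spec.map (Spec.preimage e)) := by rw [Spec.map_preimage]; infer_instance
  have hf := Flat.SpecMap_iff.mp this
  algebraize [(Spec.preimage e).hom]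
  have h := Module.Flat.isSMulRegular_of_nonZeroDivisors (M := C) ha
  refine mem_nonZeroDivisors_iff_right.mpr fun c hc ↦ ?_
  refine h ?_
  simp only [Algebra.smul_def, mul_zero]
  rw [mul_comm]; exact hc

lemma exists_spec_range_subset {X : Scheme.{0}} (x : X) (U : Set X) (hU : IsOpen U) (hx : x ∈ U) :
    ∃ (C : Type) (_ : CommRing C) (e : Spec (.of C) ⟶ X), IsOpenImmersion e ∧
      x ∈ Set.range e ∧ Set.range e ⊆ U := by
  obtain ⟨R, f, hf, h1, h2⟩ :=
    Scheme.exists_affine_mem_range_and_range_subset (U := (⟨U, hU⟩ : X.Opens)) hx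
  exact ⟨R, inferInstance, f, hf, h1, h2⟩

lemma IsCartier.comap_isOpenImmersion {X Z : Scheme.{0}} {K : X.IdealSheafData}
    (h : IsCartier K) (e : Z ⟶ X) [IsOpenImmersion e] : IsCartier (K.comap e) := by
  refine isCartier_of_forall _ fun z ↦ ?_
  obtain ⟨C, _, e', _, ⟨y, hy⟩, a, ha, hK⟩ := h.exists_spec (e z)
  obtain ⟨D, _, d, _, ⟨w, hw⟩, hd⟩ := exists_spec_range_subset y (e' ⁻¹' Set.range e)
    (e.isOpenEmbedding.isOpen_range.preimage e'.continuous) ⟨z, hy.symm⟩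
  obtain ⟨ψ, rfl, hψ⟩ := exists_ringHom_of_isOpenImmersion d
  have hr : Set.range (Spec.map (CommRingCat.ofHom ψ) ≫ e') ⊆ Set.range e := by
    rintro _ ⟨v, rfl⟩
    exact hd ⟨v, rfl⟩
  refine ⟨D, inferInstance, IsOpenImmersion.lift e _ hr, ?_, ⟨w, ?_⟩, ψ a, hψ a ha, ?_⟩
  · have : IsOpenImmersion (IsOpenImmersion.lift e _ hr ≫ e) := by
      rw [IsOpenImmersion.lift_fac]; infer_instance
    exact IsOpenImmersion.of_comp _ e
  · apply e.isOpenEmbedding.injective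
    rw [← Scheme.Hom.comp_apply, IsOpenImmersion.lift_fac, Scheme.Hom.comp_apply, hw, hy]
  · rw [← Scheme.IdealSheafData.comap_comp, IsOpenImmersion.lift_fac,
      Scheme.IdealSheafData.comap_comp, specIdeal_comap, hK, Ideal.map_span, Set.image_singleton]

end

/-! ### The universal property of the blow-up -/

section

variable {A : Type} [CommRing A] {ι : Type} {x : ι → A}

/-- On a test scheme, one of the generators of the ideal locally generates its extension. -/
lemma exists_generator_of_isCartier {T : Scheme.{0}} (f : T ⟶ Spec (.of A))
    {K : (Spec (.of A)).IdealSheafData} (hK : specIdeal K = Ideal.span (Set.range x))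
    (h : IsCartier (K.comap f)) (t : T) :
    ∃ (C : Type) (_ : CommRing C) (e : Spec (.of C) ⟶ T) (k : ι) (ψ : A →+* C),
      IsOpenImmersion e ∧ t ∈ Set.range e ∧ e ≫ f = Spec.map (CommRingCat.ofHom ψ) ∧
      ψ (x k) ∈ nonZeroDivisors C ∧
      (Ideal.span (Set.range x)).map ψ = Ideal.span {ψ (x k)} := by
  obtain ⟨C, _, e, _, ⟨y, rfl⟩, a, ha, hKa⟩ := h.exists_spec t
  obtain ⟨ψ, hψ⟩ : ∃ ψ : A →+* C, e ≫ f = Spec.map (CommRingCat.ofHom ψ) :=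
    ⟨(Spec.preimage (e ≫ f)).hom, (Spec.map_preimage _).symm⟩
  rw [← Scheme.IdealSheafData.comap_comp, hψ, specIdeal_comap, hK] at hKa
  have hb (k : ι) : ∃ b, b * a = ψ (x k) := by
    rw [← Ideal.mem_span_singleton', ← hKa]
    exact Ideal.mem_map_of_mem _ (Ideal.subset_span ⟨k, rfl⟩)
  choose b hb using hb
  -- Otherwise the extended ideal (a) would lie in y·(a), and cancelling the nonzerodivisor a would
  -- put 1 into the prime y.
  obtain ⟨k, hk⟩ : ∃ k, b k ∉ y.asIdeal := by
    by_contra! H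
    have h1 : a ∈ (Ideal.span (Set.range x)).map ψ := by
      rw [hKa]; exact Ideal.mem_span_singleton_self a
    rw [Ideal.map_span] at h1
    have h2 : Ideal.span (ψ '' Set.range x) ≤ y.asIdeal * Ideal.span {a} := by
      rw [Ideal.span_le]
      rintro _ ⟨_, ⟨k, rfl⟩, rfl⟩
      rw [← hb]
      exact Ideal.mul_mem_mul (H k) (Ideal.mem_span_singleton_self a)
    obtain ⟨c, hc, hca⟩ := Ideal.mem_mul_span_singleton.mp (h2 h1)
    have : c = 1 := (mul_cancel_right_mem_nonZeroDivisors ha).mp (by rw [hca, one_mul])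
    exact y.2.ne_top ((Ideal.eq_top_iff_one _).mpr (this ▸ hc))
  let j : Spec (.of (Localization.Away (b k))) ⟶ Spec (.of C) :=
    Spec.map (CommRingCat.ofHom (algebraMap C (Localization.Away (b k))))
  have : IsOpenImmersion j := inferInstance
  obtain ⟨φ, hφ, hφ'⟩ := exists_ringHom_of_isOpenImmersion j
  have e1 : algebraMap C (Localization.Away (b k)) = φ :=
    congr_arg CommRingCat.Hom.hom (Spec.map_injective hφ)
  have hu : IsUnit (φ (b k)) := by
    rw [← e1]; exact IsLocalization.Away.algebraMap_isUnit (b k)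
  refine ⟨Localization.Away (b k), inferInstance, j ≫ e, k, φ.comp ψ, inferInstance, ?_, ?_, ?_, ?_⟩
  · have : y ∈ Set.range j := by
      have := PrimeSpectrum.localization_away_comap_range (Localization.Away (b k)) (b k)
      have h3 : y ∈ (PrimeSpectrum.basicOpen (b k) : Set (PrimeSpectrum C)) := hk
      rw [← this] at h3
      exact h3
    obtain ⟨z, rfl⟩ := this
    exact ⟨z, rfl⟩
  · rw [Category.assoc, hψ, hφ, ← Spec.map_comp, ← CommRingCat.ofHom_comp]
  · rw [RingHom.comp_apply, ← hb, map_mul]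
    exact mul_mem hu.mem_nonZeroDivisors (hφ' a ha)
  · rw [← Ideal.map_map, hKa, Ideal.map_span, Set.image_singleton, RingHom.comp_apply, ← hb, map_mul,
      Ideal.span_singleton_mul_left_unit hu]

section Glue

variable {T Z : Scheme.{0}} {X : T → Scheme.{0}} (ε : ∀ t, X t ⟶ T) (hε : ∀ t, IsOpenImmersion (ε t))
  (h : ∀ t, t ∈ Set.range (ε t))

include hε h

lemma hom_ext_of_mem_range {f g : T ⟶ Z} (H : ∀ t, ε t ≫ f = ε t ≫ g) : f = g := by
  let 𝒰 : T.OpenCover := Scheme.Cover.mkOfCovers T X ε (fun t ↦ ⟨t, h t⟩) hε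
  exact Scheme.Cover.hom_ext 𝒰 _ _ H

lemma exists_glue (g : ∀ t, X t ⟶ Z) (H : ∀ s t : T, Limits.pullback.fst (ε s) (ε t) ≫ g s =
      Limits.pullback.snd (ε s) (ε t) ≫ g t) : ∃ f : T ⟶ Z, ∀ t, ε t ≫ f = g t := by
  let 𝒰 : T.OpenCover := Scheme.Cover.mkOfCovers T X ε (fun t ↦ ⟨t, h t⟩) hε
  exact ⟨𝒰.glueMorphisms g H, fun t ↦ 𝒰.ι_glueMorphisms g H t⟩

end Glue

namespace BlowUpAtlas

variable (W : BlowUpAtlas x) {C : Type} [CommRing C]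

/-- If x_k generates the ideal on Spec C and a point goes to the chart of x_l, then near it x_k/x_l
and x_l/x_k are both regular, hence units, so the point already goes to the chart of x_k. -/
lemma range_subset_range_chart {h : Spec (.of C) ⟶ W.scheme} {ψ : A →+* C}
    (hψ : h ≫ W.π = Spec.map (CommRingCat.ofHom ψ)) {k : ι} (hk : ψ (x k) ∈ nonZeroDivisors C)
    (hI : (Ideal.span (Set.range x)).map ψ = Ideal.span {ψ (x k)}) :
    Set.range h ⊆ Set.range (W.chart k) := by
  rintro _ ⟨p, rfl⟩
  obtain ⟨l, hl⟩ := W.covers (h p)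
  obtain ⟨D, _, d, _, ⟨w, hw⟩, hd⟩ := exists_spec_range_subset p (h ⁻¹' Set.range (W.chart l))
    ((W.chart l).isOpenEmbedding.isOpen_range.preimage h.continuous) hl
  obtain ⟨φ, rfl, hφ⟩ := exists_ringHom_of_isOpenImmersion d
  have hr : Set.range (Spec.map (CommRingCat.ofHom φ) ≫ h) ⊆ Set.range (W.chart l) := by
    rintro _ ⟨v, rfl⟩
    exact hd ⟨v, rfl⟩
  let χ := (Spec.preimage (IsOpenImmersion.lift (W.chart l) _ hr)).hom
  have hχ : Spec.map (CommRingCat.ofHom χ) ≫ W.chart l = Spec.map (CommRingCat.ofHom φ) ≫ h := by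
    have : Spec.map (CommRingCat.ofHom χ) = IsOpenImmersion.lift (W.chart l) _ hr :=
      Spec.map_preimage _
    rw [this, IsOpenImmersion.lift_fac]
  have hA : χ.comp (algebraMap A (W.R l)) = φ.comp ψ := by
    have := congr($hχ ≫ W.π)
    rw [Category.assoc, Category.assoc, hψ, W.chart_π, ← Spec.map_comp, ← Spec.map_comp,
      ← CommRingCat.ofHom_comp, ← CommRingCat.ofHom_comp] at this
    exact congr_arg CommRingCat.Hom.hom (Spec.map_injective this)
  obtain ⟨u, hu⟩ : ∃ u, u * algebraMap A (W.R l) (x l) = algebraMap A (W.R l) (x k) := by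
    rw [← Ideal.mem_span_singleton', ← (W.isBlowupChart l).map_eq]
    exact Ideal.mem_map_of_mem _ (Ideal.subset_span ⟨k, rfl⟩)
  obtain ⟨v, hv⟩ : ∃ v, v * ψ (x k) = ψ (x l) := by
    rw [← Ideal.mem_span_singleton', ← hI]
    exact Ideal.mem_map_of_mem _ (Ideal.subset_span ⟨l, rfl⟩)
  have e1 : χ u * φ v * φ (ψ (x k)) = 1 * φ (ψ (x k)) := by
    have h1 := congr(χ $hu)
    have hA' (a : A) : χ (algebraMap A (W.R l) a) = φ (ψ a) := congr($hA a)
    rw [map_mul, hA', hA', ← hv, map_mul] at h1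
    rw [mul_assoc, h1, one_mul]
  have hunit : IsUnit (χ u) :=
    IsUnit.of_mul_eq_one _ ((mul_cancel_right_mem_nonZeroDivisors (hφ _ hk)).mp e1)
  have h3 : h p = W.chart l (Spec.map (CommRingCat.ofHom χ) w) := by
    rw [← Scheme.Hom.comp_apply, hχ, Scheme.Hom.comp_apply, hw]
  rw [h3, W.mem_range_iff l k u (by rw [mul_comm, hu])]
  exact fun hmem ↦ w.2.ne_top (Ideal.eq_top_of_isUnit_mem _ hmem hunit)

lemma eq_of_comp_π_eq_spec {h h' : Spec (.of C) ⟶ W.scheme} {ψ : A →+* C}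
    (hψ : h ≫ W.π = Spec.map (CommRingCat.ofHom ψ))
    (hψ' : h' ≫ W.π = Spec.map (CommRingCat.ofHom ψ)) {k : ι} (hk : ψ (x k) ∈ nonZeroDivisors C)
    (hI : (Ideal.span (Set.range x)).map ψ = Ideal.span {ψ (x k)}) : h = h' := by
  have key {h : Spec (.of C) ⟶ W.scheme} (hψ : h ≫ W.π = Spec.map (CommRingCat.ofHom ψ)) :
      ∃ χ : W.R k →+* C, χ.comp (algebraMap A (W.R k)) = ψ ∧
        h = Spec.map (CommRingCat.ofHom χ) ≫ W.chart k := by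
    have hr := W.range_subset_range_chart hψ hk hI
    let χ := (Spec.preimage (IsOpenImmersion.lift (W.chart k) _ hr)).hom
    have hχ : Spec.map (CommRingCat.ofHom χ) ≫ W.chart k = h := by
      have : Spec.map (CommRingCat.ofHom χ) = IsOpenImmersion.lift (W.chart k) _ hr :=
        Spec.map_preimage _
      rw [this, IsOpenImmersion.lift_fac]
    refine ⟨χ, ?_, hχ.symm⟩
    have := congr($hχ ≫ W.π)
    rw [Category.assoc, hψ, W.chart_π, ← Spec.map_comp, ← CommRingCat.ofHom_comp] at this
    exact congr_arg CommRingCat.Hom.hom (Spec.map_injective this)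
  obtain ⟨χ, hχ, rfl⟩ := key hψ
  obtain ⟨χ', hχ', rfl⟩ := key hψ'
  let := ψ.toAlgebra
  have := (W.isBlowupChart k).hom_ext (C := C) hk ⟨χ, fun a ↦ congr($hχ a)⟩
    ⟨χ', fun a ↦ congr($hχ' a)⟩
  have : χ = χ' := congr_arg AlgHom.toRingHom this
  rw [this]

lemma exists_lift_spec {ψ : A →+* C} {k : ι} (hk : ψ (x k) ∈ nonZeroDivisors C)
    (hI : (Ideal.span (Set.range x)).map ψ = Ideal.span {ψ (x k)}) :
    ∃ h : Spec (.of C) ⟶ W.scheme, h ≫ W.π = Spec.map (CommRingCat.ofHom ψ) := by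
  let := ψ.toAlgebra
  obtain ⟨χ⟩ := (W.isBlowupChart k).exists_lift (C := C) hk hI.le
  refine ⟨Spec.map (CommRingCat.ofHom χ.toRingHom) ≫ W.chart k, ?_⟩
  rw [Category.assoc, W.chart_π, ← Spec.map_comp, ← CommRingCat.ofHom_comp]
  congr 2
  ext a
  exact χ.commutes a

lemma eq_of_comp_π_eq {K : (Spec (.of A)).IdealSheafData}
    (hK : specIdeal K = Ideal.span (Set.range x)) {T : Scheme.{0}} {g g' : T ⟶ W.scheme}
    (h : IsCartier (K.comap (g ≫ W.π))) (e : g ≫ W.π = g' ≫ W.π) : g = g' := by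
  choose C _ ε k ψ h1 h2 h3 h4 h5 using
    fun t ↦ exists_generator_of_isCartier (g ≫ W.π) hK h t
  refine hom_ext_of_mem_range ε h1 h2 fun t ↦ ?_
  exact W.eq_of_comp_π_eq_spec (ψ := ψ t) (by rw [Category.assoc, h3])
    (by rw [Category.assoc, ← e, h3]) (h4 t) (h5 t)

lemma exists_lift {K : (Spec (.of A)).IdealSheafData}
    (hK : specIdeal K = Ideal.span (Set.range x)) {T : Scheme.{0}} (f : T ⟶ Spec (.of A))
    (h : IsCartier (K.comap f)) : ∃ g : T ⟶ W.scheme, g ≫ W.π = f := by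
  choose C _ ε k ψ h1 h2 h3 h4 h5 using fun t ↦ exists_generator_of_isCartier f hK h t
  choose g hg using fun t ↦ W.exists_lift_spec (h4 t) (h5 t)
  -- On overlaps the local lifts agree by uniqueness, since the ideal stays Cartier on an open
  -- subscheme.
  have hglue (s t : T) : Limits.pullback.fst (ε s) (ε t) ≫ g s =
      Limits.pullback.snd (ε s) (ε t) ≫ g t := by
    refine W.eq_of_comp_π_eq hK ?_ ?_
    · rw [Category.assoc, hg, ← h3, ← Category.assoc, Scheme.IdealSheafData.comap_comp]
      exact h.comap_isOpenImmersion _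
    · rw [Category.assoc, hg, Category.assoc, hg, ← h3, ← h3, Limits.pullback.condition_assoc]
  obtain ⟨g', hg'⟩ := exists_glue ε h1 h2 g hglue
  refine ⟨g', hom_ext_of_mem_range ε h1 h2 fun t ↦ ?_⟩
  rw [reassoc_of% hg', hg, h3]

lemma isCartier_comap_π {K : (Spec (.of A)).IdealSheafData}
    (hK : specIdeal K = Ideal.span (Set.range x)) : IsCartier (K.comap W.π) := by
  refine isCartier_of_forall _ fun p ↦ ?_
  obtain ⟨k, hk⟩ := W.covers p
  refine ⟨W.R k, inferInstance, W.chart k, inferInstance, hk, _, (W.isBlowupChart k).nzd, ?_⟩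
  rw [← Scheme.IdealSheafData.comap_comp, W.chart_π, specIdeal_comap, hK,
    (W.isBlowupChart k).map_eq]

/-- An atlas of blow-up charts for the ideal of a closed subscheme `B` of `Spec A` is a blow-up
along `B`. -/
theorem isBlowUp {B : Scheme.{0}} (b : B ⟶ Spec (.of A))
    (hb : specIdeal b.ker = Ideal.span (Set.range x)) : IsBlowUp W.π b where
  cartier := W.isCartier_comap_π hb
  existsUnique_lift f hf := by
    obtain ⟨g, hg⟩ := W.exists_lift hb f hf
    exact ⟨g, hg, fun g' hg' ↦ W.eq_of_comp_π_eq hb (by rwa [hg']) (hg'.trans hg.symm)⟩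

end BlowUpAtlas

/-- Blow-ups do not change under isomorphisms of the base. -/
lemma IsBlowUp.of_iso {X' X B X₁ B₁ : Scheme.{0}} {π : X' ⟶ X} {b : B ⟶ X} (h : IsBlowUp π b)
    (e : X ≅ X₁) (b₁ : B₁ ⟶ X₁) (hb : b₁.ker.comap e.hom = b.ker) :
    IsBlowUp (π ≫ e.hom) b₁ where
  cartier := by
    rw [Scheme.IdealSheafData.comap_comp, hb]
    exact h.cartier
  existsUnique_lift f hf := by
    obtain ⟨g, hg, hu⟩ := h.existsUnique_lift (f ≫ e.inv) (by
      rw [← hb, ← Scheme.IdealSheafData.comap_comp]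
      simpa using hf)
    refine ⟨g, by simp [reassoc_of% hg], fun g' hg' ↦ hu g' ?_⟩
    change g' ≫ _ = _
    rw [← hg']
    simp

end

/-! ### Blow-up charts in étale coordinates -/

open scoped TensorProduct

section BaseChange

variable {P : Type*} [CommRing P] {I : Ideal P} {x : P} {Q : Type*} [CommRing Q] [Algebra P Q]
  (h : IsBlowupChart I x Q) (A : Type*) [CommRing A] [Algebra P A]

include h in
/-- The affine blow-up algebra commutes with flat base change. -/
lemma IsBlowupChart.baseChange [Module.Flat P A] (hxI : x ∈ I) :
    letI : Algebra A (Q ⊗[P] A) := Algebra.TensorProduct.includeRight.toRingHom.toAlgebra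
    IsBlowupChart (I.map (algebraMap P A)) (algebraMap P A x) (Q ⊗[P] A) := by
  let : Algebra A (Q ⊗[P] A) := Algebra.TensorProduct.includeRight.toRingHom.toAlgebra
  have hA (a : A) : algebraMap A (Q ⊗[P] A) a = 1 ⊗ₜ a := rfl
  have hP (p : P) : algebraMap A (Q ⊗[P] A) (algebraMap P A p) = algebraMap P Q p ⊗ₜ 1 := by
    rw [hA, Algebra.TensorProduct.tmul_one_eq_one_tmul]
  refine ⟨?_, ?_, fun r ↦ ?_, fun a ha ↦ ?_⟩
  · rw [hP]
    -- Flatness of A over P makes the tensor product flat over Q.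
    have hf := Module.Flat.isSMulRegular_of_nonZeroDivisors (R := Q) (M := Q ⊗[P] A) h.nzd
    refine mem_nonZeroDivisors_iff_right.mpr fun c hc ↦ hf ?_
    simp only [Algebra.smul_def, mul_zero]
    rw [mul_comm]; exact hc
  · have e : (algebraMap A (Q ⊗[P] A)).comp (algebraMap P A) =
        (algebraMap Q (Q ⊗[P] A)).comp (algebraMap P Q) := by
      ext p
      exact hP p
    rw [Ideal.map_map, e, ← Ideal.map_map, h.map_eq, Ideal.map_span, Set.image_singleton, hP]
    rfl
  · induction r with
    | zero => exact ⟨0, 0, by simp⟩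
    | tmul q a =>
      obtain ⟨m, p, hp, e⟩ := h.exists_frac q
      refine ⟨m, algebraMap P A p * a, Ideal.mul_mem_right _ _ ?_, ?_⟩
      · rw [← Ideal.map_pow]
        exact Ideal.mem_map_of_mem _ hp
      · rw [map_mul, hP, hP, ← e, hA]
        simp [Algebra.TensorProduct.tmul_mul_tmul, Algebra.TensorProduct.tmul_pow]
    | add r s hr hs =>
      obtain ⟨m, a, ha, e⟩ := hr
      obtain ⟨m', a', ha', e'⟩ := hs
      have hx : algebraMap P A x ∈ I.map (algebraMap P A) := Ideal.mem_map_of_mem _ hxI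
      refine ⟨m + m', algebraMap P A x ^ m' * a + algebraMap P A x ^ m * a', add_mem ?_ ?_, ?_⟩
      · rw [add_comm, pow_add]
        exact Ideal.mul_mem_mul (Ideal.pow_mem_pow hx _) ha
      · rw [pow_add]
        exact Ideal.mul_mem_mul (Ideal.pow_mem_pow hx _) ha'
      · simp only [map_add, map_mul, map_pow, ← e, ← e']; ring
  -- Since x is a unit in A[1/x], Q maps to A[1/x], and so does Q ⊗ A. An element a that dies in Q ⊗
  -- A therefore dies in A[1/x].
  · have : IsScalarTower P A (Localization.Away (algebraMap P A x)) := inferInstance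
    have hu : IsUnit (algebraMap P (Localization.Away (algebraMap P A x)) x) := by
      rw [IsScalarTower.algebraMap_apply P A (Localization.Away (algebraMap P A x))]
      exact IsLocalization.Away.algebraMap_isUnit (algebraMap P A x)
    obtain ⟨g⟩ := h.exists_lift (C := Localization.Away (algebraMap P A x))
      hu.mem_nonZeroDivisors (by rw [Ideal.span_singleton_eq_top.mpr hu]; exact le_top)
    let G := Algebra.TensorProduct.lift g (IsScalarTower.toAlgHom P A _) fun _ _ ↦ Commute.all _ _
    have h1 : G (1 ⊗ₜ a) = algebraMap A _ a := by
      simp [G]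
    have h2 : algebraMap A (Localization.Away (algebraMap P A x)) a = 0 := by
      rw [← h1]
      have : (1 ⊗ₜ a : Q ⊗[P] A) = 0 := ha
      rw [this, map_zero]
    obtain ⟨⟨_, N, rfl⟩, hN⟩ := (IsLocalization.map_eq_zero_iff
      (Submonoid.powers (algebraMap P A x)) _ a).mp h2
    exact ⟨N, hN⟩

end BaseChange

/-- The polynomial ring of affine space. -/
abbrev Poly (n : ℕ) : Type := MvPolynomial (Fin n) ℂ

section Poly

open MvPolynomial

variable {n : ℕ} (S : Finset (Fin n)) (k : Fin n)

/-- The monomial substitution that describes a chart of the blow-up of a linear subspace. -/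
def blowupSubst : Poly n →ₐ[ℂ] Poly n :=
  aeval fun i ↦ if i ∈ S ∧ i ≠ k then X k * X i else X i

lemma blowupSubst_X_of_mem {i : Fin n} (hi : i ∈ S ∧ i ≠ k) :
    blowupSubst S k (X i) = X k * X i := by
  simp [blowupSubst, hi]

lemma blowupSubst_X_of_not {i : Fin n} (hi : ¬ (i ∈ S ∧ i ≠ k)) :
    blowupSubst S k (X i) = X i := by
  simp only [blowupSubst, aeval_X, if_neg hi]

lemma blowupSubst_X_self : blowupSubst S k (X k) = X k :=
  blowupSubst_X_of_not S k (by simp)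

/-- The coordinate ring of a chart of the blow-up of a linear subspace. -/
def PolyChart (_S : Finset (Fin n)) (_k : Fin n) : Type := Poly n

instance : CommRing (PolyChart S k) := inferInstanceAs (CommRing (Poly n))

instance : Algebra (Poly n) (PolyChart S k) := (blowupSubst S k).toRingHom.toAlgebra

lemma isBlowupChart_polyChart (hk : k ∈ S) :
    IsBlowupChart (Ideal.span (X '' S : Set (Poly n))) (X k) (PolyChart S k) := by
  -- `PolyChart` is a copy of the polynomial ring with the substitution as structure map; everything
  -- is restated for honest polynomials.
  have key : IsBlowupChart (A := Poly n) (Ideal.span (X '' S : Set (Poly n))) (X k)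
      (PolyChart S k) ↔ (X k : Poly n) ∈ nonZeroDivisors (Poly n) ∧
      (Ideal.span (X '' S : Set (Poly n))).map (blowupSubst S k) = Ideal.span {X k} ∧
      (∀ r : Poly n, ∃ m : ℕ, ∃ a ∈ (Ideal.span (X '' S : Set (Poly n))) ^ m,
        X k ^ m * r = blowupSubst S k a) ∧
      ∀ a : Poly n, blowupSubst S k a = 0 → ∃ N : ℕ, X k ^ N * a = 0 := by
    have e : algebraMap (Poly n) (PolyChart S k) (X k) = (X k : Poly n) :=
      blowupSubst_X_self S k
    constructor
    · intro h
      have h1 := h.nzd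
      have h2 := h.map_eq
      have h3 := h.exists_frac
      rw [e] at h1 h2 h3
      exact ⟨h1, h2, h3, h.eq_zero⟩
    · rintro ⟨h1, h2, h3, h4⟩
      refine ⟨?_, ?_, ?_, h4⟩ <;> rw [e]
      exacts [h1, h2, h3]
  rw [key]
  refine ⟨mem_nonZeroDivisors_of_ne_zero (X_ne_zero k), ?_, fun r ↦ ?_, fun a ha ↦ ?_⟩
  · apply le_antisymm
    · rw [Ideal.map_le_iff_le_comap, Ideal.span_le]
      rintro _ ⟨i, hi, rfl⟩
      rw [SetLike.mem_coe, Ideal.mem_comap, Ideal.mem_span_singleton]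
      by_cases hik : i = k
      · subst hik
        rw [blowupSubst_X_self]
      · rw [blowupSubst_X_of_mem S k ⟨hi, hik⟩]
        exact dvd_mul_right _ _
    · rw [Ideal.span_singleton_le_iff_mem, ← blowupSubst_X_self S k]
      exact Ideal.mem_map_of_mem _ (Ideal.subset_span ⟨k, hk, rfl⟩)
  · induction r using MvPolynomial.induction_on with
    | C c => exact ⟨0, C c, by simp, by simp [blowupSubst, ← MvPolynomial.algebraMap_eq]⟩
    | add p q hp hq =>
      obtain ⟨m, a, ha, e⟩ := hp
      obtain ⟨m', a', ha', e'⟩ := hq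
      have hx : (X k : Poly n) ∈ Ideal.span (X '' S : Set (Poly n)) :=
        Ideal.subset_span ⟨k, hk, rfl⟩
      refine ⟨m + m', X k ^ m' * a + X k ^ m * a', add_mem ?_ ?_, ?_⟩
      · rw [add_comm, pow_add]
        exact Ideal.mul_mem_mul (Ideal.pow_mem_pow hx _) ha
      · rw [pow_add]
        exact Ideal.mul_mem_mul (Ideal.pow_mem_pow hx _) ha'
      · simp only [map_add, map_mul, map_pow, ← e, ← e', blowupSubst_X_self]; ring
    | mul_X p i hp =>
      obtain ⟨m, a, ha, e⟩ := hp
      by_cases hi : i ∈ S ∧ i ≠ k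
      · refine ⟨m + 1, a * X i, ?_, ?_⟩
        · rw [pow_succ]
          exact Ideal.mul_mem_mul ha (Ideal.subset_span ⟨i, hi.1, rfl⟩)
        · rw [map_mul, ← e, blowupSubst_X_of_mem S k hi]; ring
      · refine ⟨m, a * X i, Ideal.mul_mem_right _ _ ha, ?_⟩
        rw [map_mul, ← e, blowupSubst_X_of_not S k hi]; ring
  -- One factor X k suffices: it takes care of the points with x_k = 0, and every point with x_k ≠ 0
  -- lies in the image of the substitution on points.
  · refine ⟨1, ?_⟩
    rw [pow_one]
    refine MvPolynomial.funext fun x ↦ ?_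
    rw [map_mul, eval_X, map_zero]
    by_cases hx : x k = 0
    · rw [hx, zero_mul]
    let z : Fin n → ℂ := fun i ↦ if i ∈ S ∧ i ≠ k then x i / x k else x i
    have hz : (aeval z).comp (blowupSubst S k) = (aeval x : Poly n →ₐ[ℂ] ℂ) := by
      ext i
      have hzk : z k = x k := by simp [z]
      by_cases hi : i ∈ S ∧ i ≠ k
      · rw [AlgHom.comp_apply, blowupSubst_X_of_mem S k hi, map_mul, aeval_X, aeval_X, aeval_X, hzk]
        simp only [z, if_pos hi]
        field_simp
      · rw [AlgHom.comp_apply, blowupSubst_X_of_not S k hi, aeval_X, aeval_X]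
        simp only [z, if_neg hi]
    have := congr($hz a)
    rw [AlgHom.comp_apply, ha, map_zero] at this
    rw [← MvPolynomial.coe_aeval_eq_eval, RingHom.coe_coe, ← this, mul_zero]

end Poly

/-! ### Étale coordinates on a blow-up chart and its exceptional divisor. -/

section Coordinates

open MvPolynomial

variable {n : ℕ} (S : Finset (Fin n)) (k : Fin n) (A : Type*) [CommRing A] [Algebra (Poly n) A]
  (R : Type*) [CommRing R] [Algebra A R]

/-- The étale coordinates of a chart of the blow-up of `t_i = 0`, `i ∈ S`, where `t` are étale
coordinates of the base. -/
structure BlowupCoordinates where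
  /-- The coordinates of the chart. -/
  ψ : Poly n →+* R
  etale : ψ.Etale
  ψ_subst : ∀ p, ψ (blowupSubst S k p) = algebraMap A R (algebraMap (Poly n) A p)
  exists_poly : ∀ r : R, ∃ p : MvPolynomial {i : Fin n // i ∈ S ∧ i ≠ k} A,
    eval₂ (algebraMap A R) (fun i ↦ ψ (X i.1)) p = r
  exists_lift : ∀ {D : Type} [CommRing D] (g : A →+* D) (h : Poly n →+* D),
    (∀ p, g (algebraMap (Poly n) A p) = h (blowupSubst S k p)) →
    ∃ χ : R →+* D, χ.comp (algebraMap A R) = g ∧ χ.comp ψ = h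

/-- By flat base change R is `PolyChart` ⊗ A, so its map from the polynomial ring is a base change
of the étale map to A, and homomorphisms out of R come from the universal property of the tensor
product. -/
lemma exists_blowupCoordinates [Algebra.Etale (Poly n) A] (hk : k ∈ S)
    (h : IsBlowupChart (Ideal.span ((fun i ↦ algebraMap (Poly n) A (X i)) '' S))
      (algebraMap (Poly n) A (X k)) R) : Nonempty (BlowupCoordinates S k A R) := by
  let T := PolyChart S k ⊗[Poly n] A
  let : Algebra A T := Algebra.TensorProduct.includeRight.toRingHom.toAlgebra
  have hT : IsBlowupChart (Ideal.span ((fun i ↦ algebraMap (Poly n) A (X i)) '' S))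
      (algebraMap (Poly n) A (X k)) T := by
    have := (isBlowupChart_polyChart S k hk).baseChange A (Ideal.subset_span ⟨k, hk, rfl⟩)
    rwa [Ideal.map_span, Set.image_image] at this
  obtain ⟨e⟩ := hT.exists_algEquiv h
  let ψ : Poly n →+* R :=
    (e.toAlgHom.toRingHom.comp (algebraMap (PolyChart S k) T) : PolyChart S k →+* R)
  have hψe (q : Poly n) : ψ q = e ((id q : PolyChart S k) ⊗ₜ 1) := rfl
  have hψ : ∀ p : Poly n, ψ (blowupSubst S k p) = algebraMap A R (algebraMap (Poly n) A p) := by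
    intro p
    refine (hψe _).trans ?_
    rw [← e.commutes]
    congr 1
    change (algebraMap (Poly n) (PolyChart S k) p) ⊗ₜ[Poly n] (1 : A) = 1 ⊗ₜ _
    rw [Algebra.TensorProduct.tmul_one_eq_one_tmul]
  refine ⟨⟨ψ, ?_, hψ, fun r ↦ ?_, fun {D} _ g h hgh ↦ ?_⟩⟩
  · let : Algebra (PolyChart S k) R := RingHom.toAlgebra (R := PolyChart S k) ψ
    exact Algebra.Etale.of_equiv (R := PolyChart S k) (A := T)
      (AlgEquiv.ofRingEquiv (f := e.toRingEquiv) fun q ↦ rfl)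
  · obtain ⟨r, rfl⟩ := e.surjective r
    have hX (i : Fin n) : ∃ p : MvPolynomial {i : Fin n // i ∈ S ∧ i ≠ k} A,
        eval₂ (algebraMap A R) (fun i ↦ ψ (X i.1)) p = ψ (X i) := by
      by_cases hi : i ∈ S ∧ i ≠ k
      · exact ⟨X ⟨i, hi⟩, by rw [eval₂_X]⟩
      · refine ⟨C (algebraMap (Poly n) A (X i)), ?_⟩
        rw [eval₂_C, ← hψ, blowupSubst_X_of_not S k hi]
    induction r using TensorProduct.induction_on with
    | zero => exact ⟨0, by simp⟩
    | add r s hr hs =>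
      obtain ⟨p, hp⟩ := hr
      obtain ⟨q, hq⟩ := hs
      exact ⟨p + q, by rw [eval₂_add, hp, hq, map_add]⟩
    | tmul q a =>
      have hq (q : Poly n) : ∃ p : MvPolynomial {i : Fin n // i ∈ S ∧ i ≠ k} A,
          eval₂ (algebraMap A R) (fun i ↦ ψ (X i.1)) p = ψ q := by
        induction q using MvPolynomial.induction_on with
        | C c =>
          refine ⟨C (algebraMap (Poly n) A (C c)), ?_⟩
          rw [eval₂_C, ← hψ]
          congr 1
          exact (blowupSubst S k).commutes c
        | add p q hp hq =>
          obtain ⟨p', hp⟩ := hp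
          obtain ⟨q', hq⟩ := hq
          exact ⟨p' + q', by rw [eval₂_add, hp, hq, map_add]⟩
        | mul_X p i hp =>
          obtain ⟨p', hp⟩ := hp
          obtain ⟨q', hq⟩ := hX i
          exact ⟨p' * q', by rw [eval₂_mul, hp, hq, map_mul]⟩
      obtain ⟨p, hp⟩ := hq q
      refine ⟨p * C a, ?_⟩
      rw [eval₂_mul, hp, eval₂_C, ← e.commutes]
      change e (q ⊗ₜ[Poly n] (1 : A)) * e ((1 : PolyChart S k) ⊗ₜ[Poly n] a) = _
      rw [← map_mul, Algebra.TensorProduct.tmul_mul_tmul, mul_one, one_mul]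
  · let : Algebra (Poly n) D := (g.comp (algebraMap (Poly n) A)).toAlgebra
    let g' : A →ₐ[Poly n] D := ⟨g, fun _ ↦ rfl⟩
    let h' : PolyChart S k →ₐ[Poly n] D := ⟨(h : Poly n →+* D), fun p ↦ (hgh p).symm⟩
    let G : T →ₐ[Poly n] D := Algebra.TensorProduct.lift h' g' fun _ _ ↦ Commute.all _ _
    refine ⟨G.toRingHom.comp e.symm.toAlgHom.toRingHom, ?_, ?_⟩
    · ext a
      change G (e.symm (algebraMap A R a)) = g a
      rw [e.symm.commutes]
      change h' 1 * g' a = g' a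
      rw [map_one, one_mul]
    · refine RingHom.ext fun p ↦ ?_
      change G (e.symm (e ((p : PolyChart S k) ⊗ₜ 1))) = h' p
      rw [e.symm_apply_apply]
      change h' p * g' 1 = h' p
      rw [map_one, mul_one]

namespace BlowupCoordinates

variable {S k A R} (c : BlowupCoordinates S k A R)

include c in
lemma ringHom_ext {D : Type*} [CommRing D] {f g : R →+* D}
    (h1 : ∀ a, f (algebraMap A R a) = g (algebraMap A R a))
    (h2 : ∀ i, i ∈ S → i ≠ k → f (c.ψ (X i)) = g (c.ψ (X i))) : f = g := by
  ext r
  obtain ⟨p, rfl⟩ := c.exists_poly r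
  rw [eval₂_eq', map_sum, map_sum]
  refine Finset.sum_congr rfl fun d _ ↦ ?_
  simp only [map_mul, map_prod, map_pow, h1]
  congr 1
  exact Finset.prod_congr rfl fun i _ ↦ by rw [h2 i.1 i.2.1 i.2.2]

lemma algebraMap_mul_ψ {i : Fin n} (hi : i ∈ S) (hik : i ≠ k) :
    algebraMap A R (algebraMap (Poly n) A (X k)) * c.ψ (X i) =
      algebraMap A R (algebraMap (Poly n) A (X i)) := by
  rw [← c.ψ_subst, ← c.ψ_subst, blowupSubst_X_of_mem S k ⟨hi, hik⟩, blowupSubst_X_self, map_mul]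

lemma ψ_X_of_not {i : Fin n} (hi : ¬ (i ∈ S ∧ i ≠ k)) :
    c.ψ (X i) = algebraMap A R (algebraMap (Poly n) A (X i)) := by
  rw [← c.ψ_subst, blowupSubst_X_of_not S k hi]

lemma ψ_C (z : ℂ) : c.ψ (C z) = algebraMap A R (algebraMap (Poly n) A (C z)) := by
  rw [← c.ψ_subst]
  congr 1
  simp [blowupSubst, ← MvPolynomial.algebraMap_eq]

end BlowupCoordinates

/-- The exceptional divisor of a chart is an affine space over the centre of the blow-up. -/
lemma BlowupCoordinates.exists_exceptional {A : Type} [CommRing A] [Algebra (Poly n) A] {S k}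
    {R : Type*} [CommRing R] [Algebra A R] (c : BlowupCoordinates S k A R) (hk : k ∈ S) {I : Ideal A}
    (hI : I = Ideal.span ((fun i ↦ algebraMap (Poly n) A (X i)) '' S)) :
    ∃ θ : R →+* MvPolynomial {i : Fin n // i ∈ S ∧ i ≠ k} (A ⧸ I),
      (∀ p, θ (eval₂ (algebraMap A R) (fun i ↦ c.ψ (X i.1)) p) =
        MvPolynomial.map (Ideal.Quotient.mk I) p) ∧
      RingHom.ker θ = Ideal.span {algebraMap A R (algebraMap (Poly n) A (X k))} := by
  have hmem {i : Fin n} (hi : i ∈ S) : algebraMap (Poly n) A (X i) ∈ I := by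
    rw [hI]; exact Ideal.subset_span ⟨i, hi, rfl⟩
  let D := MvPolynomial {i : Fin n // i ∈ S ∧ i ≠ k} (A ⧸ I)
  let g : A →+* D := C.comp (Ideal.Quotient.mk I)
  have hg {i : Fin n} (hi : i ∈ S) : g (algebraMap (Poly n) A (X i)) = 0 := by
    simp only [g, RingHom.comp_apply]
    rw [Ideal.Quotient.eq_zero_iff_mem.mpr (hmem hi), map_zero]
  let h : Poly n →+* D := eval₂Hom (g.comp ((algebraMap (Poly n) A).comp C)) fun i ↦
    if hi : i ∈ S ∧ i ≠ k then X ⟨i, hi⟩ else g (algebraMap (Poly n) A (X i))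
  have hX {i : Fin n} (hi : ¬ (i ∈ S ∧ i ≠ k)) : h (X i) = g (algebraMap (Poly n) A (X i)) := by
    simp only [h, eval₂Hom_X', dif_neg hi]
  have hX' {i : Fin n} (hi : i ∈ S ∧ i ≠ k) : h (X i) = X ⟨i, hi⟩ := by
    simp only [h, eval₂Hom_X', dif_pos hi]
  -- The two maps are compatible because t_i and t_k u_i both go to zero for i in S, whatever value
  -- u_i takes.
  have comm : g.comp (algebraMap (Poly n) A) = h.comp (blowupSubst S k).toRingHom := by
    refine MvPolynomial.ringHom_ext (fun z ↦ ?_) fun i ↦ ?_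
    · simp [blowupSubst, h]
    · change _ = h (blowupSubst S k (X i))
      by_cases hi : i ∈ S ∧ i ≠ k
      · rw [blowupSubst_X_of_mem S k hi, map_mul, hX (i := k) (by simp), hg hk, zero_mul,
          RingHom.comp_apply, hg hi.1]
      · rw [blowupSubst_X_of_not S k hi, hX hi, RingHom.comp_apply]
  obtain ⟨θ, h1, h2⟩ := c.exists_lift g h fun p ↦ congr($comm p)
  have hθ (p) : θ (eval₂ (algebraMap A R) (fun i ↦ c.ψ (X i.1)) p) =
        MvPolynomial.map (Ideal.Quotient.mk I) p := by
    have : θ.comp (eval₂Hom (algebraMap A R) (fun i ↦ c.ψ (X i.1))) =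
        MvPolynomial.map (Ideal.Quotient.mk I) := by
      refine MvPolynomial.ringHom_ext (fun a ↦ ?_) fun i ↦ ?_
      · rw [RingHom.comp_apply, eval₂Hom_C, map_C]
        exact congr($h1 a)
      · rw [RingHom.comp_apply, eval₂Hom_X', map_X]
        exact congr($h2 (X i.1)).trans (hX' i.2)
    exact congr($this p)
  refine ⟨θ, hθ, le_antisymm (fun r hr ↦ ?_) ?_⟩
  -- An element of the kernel is a polynomial in the u_i with coefficients in I, and I extends into
  -- the ideal of t_k.
  · obtain ⟨p, rfl⟩ := c.exists_poly r
    have hp := (hθ p).symm.trans hr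
    rw [eval₂_eq']
    refine sum_mem fun d _ ↦ Ideal.mul_mem_right _ _ ?_
    have hd : coeff d p ∈ I := by
      have := congr(coeff d $hp)
      rw [coeff_map, coeff_zero] at this
      exact Ideal.Quotient.eq_zero_iff_mem.mp this
    have : I ≤ (Ideal.span {algebraMap A R (algebraMap (Poly n) A (X k))}).comap
        (algebraMap A R) := by
      rw [hI, Ideal.span_le]
      rintro _ ⟨i, hi, rfl⟩
      rw [SetLike.mem_coe, Ideal.mem_comap, Ideal.mem_span_singleton]
      by_cases hik : i = k
      · rw [hik]
      · exact ⟨_, (c.algebraMap_mul_ψ hi hik).symm⟩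
    exact this hd
  · rw [Ideal.span_singleton_le_iff_mem, RingHom.mem_ker]
    change (θ.comp (algebraMap A R)) _ = 0
    rw [h1, hg hk]

/-- The quotient embeds into a polynomial ring over the domain A/I. Primality is what lets powers of
t_k be cancelled when computing strict transforms. -/
lemma BlowupCoordinates.prime_exceptional {A : Type} [CommRing A] [Algebra (Poly n) A] {S k}
    {R : Type*} [CommRing R] [Algebra A R] (c : BlowupCoordinates S k A R) (hk : k ∈ S) {I : Ideal A} [I.IsPrime]
    (hI : I = Ideal.span ((fun i ↦ algebraMap (Poly n) A (X i)) '' S)) :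
    (Ideal.span {algebraMap A R (algebraMap (Poly n) A (X k))}).IsPrime := by
  obtain ⟨θ, -, h⟩ := c.exists_exceptional hk hI
  rw [← h]
  exact RingHom.ker_isPrime θ

end Coordinates

/-! ### Smoothness and differentials -/

open scoped TensorProduct
open KaehlerDifferential

section Retraction

variable (k : Type*) [CommRing k] {O : Type*} [CommRing O] [Algebra k O]

/-- If `O` and `O / I` are formally smooth, the conormal sequence of `I` is split injective. -/
lemma exists_conormal_retraction [Algebra.FormallySmooth k O] (I : Ideal O)
    [h : Algebra.FormallySmooth k (O ⧸ I)] :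
    ∃ l : Ω[O⁄k] →ₗ[O] O ⧸ I ^ 2, (∀ x ∈ I, l (D k O x) = Ideal.Quotient.mk _ x) ∧
      ∀ ω, l ω ∈ I.map (Ideal.Quotient.mk (I ^ 2)) := by
  obtain ⟨l, hl⟩ := (Algebra.FormallySmooth.iff_split_injection (R := k) (P := O) (A := O ⧸ I)
    Ideal.Quotient.mk_surjective).mp h
  have hk : RingHom.ker (algebraMap O (O ⧸ I)) = I := Ideal.mk_ker
  -- I/I² is viewed inside O/I², so that values of the retraction can be compared with classes of
  -- ring elements.
  let e : (RingHom.ker (algebraMap O (O ⧸ I))).Cotangent →ₗ[O] O ⧸ I ^ 2 :=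
    (Submodule.mapQ _ (I ^ 2) LinearMap.id (by rw [hk]; rfl)) ∘ₗ
      Ideal.cotangentToQuotientSquare (RingHom.ker (algebraMap O (O ⧸ I)))
  have he (x) : e (Ideal.toCotangent _ x) = Ideal.Quotient.mk (I ^ 2) x.1 := by
    simp only [e, LinearMap.comp_apply, Ideal.toCotangent_to_quotient_square]
    rfl
  refine ⟨e ∘ₗ l ∘ₗ (TensorProduct.mk O (O ⧸ I) Ω[O⁄k] 1), fun x hx ↦ ?_, fun ω ↦ ?_⟩
  · have hx' : x ∈ RingHom.ker (algebraMap O (O ⧸ I)) := by rwa [hk]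
    have := congr($hl (Ideal.toCotangent _ ⟨x, hx'⟩))
    simp only [LinearMap.comp_apply, kerCotangentToTensor_toCotangent, LinearMap.id_apply] at this
    simp only [LinearMap.comp_apply, TensorProduct.mk_apply]
    rw [this, he]
  · simp only [LinearMap.comp_apply]
    obtain ⟨x, hx⟩ := Ideal.toCotangent_surjective _ (l (TensorProduct.mk O (O ⧸ I) Ω[O⁄k] 1 ω))
    rw [← hx, he]
    exact Ideal.mem_map_of_mem _ (hk.le x.2)

variable {k} in
lemma D_mem_smul_top_of_mem_sq {m : Ideal O} {x : O} (hx : x ∈ m ^ 2) :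
    D k O x ∈ m • (⊤ : Submodule O Ω[O⁄k]) := by
  rw [pow_two] at hx
  refine Submodule.mul_induction_on hx (fun a ha b hb ↦ ?_) fun a b ha hb ↦ ?_
  · rw [Derivation.leibniz]
    exact add_mem (Submodule.smul_mem_smul ha trivial) (Submodule.smul_mem_smul hb trivial)
  · rw [map_add]; exact add_mem ha hb

/-- A singular hypersurface germ is not formally smooth. -/
lemma eq_zero_of_formallySmooth_quotient [Algebra.FormallySmooth k O] [IsLocalRing O] {F : O}
    [Algebra.FormallySmooth k (O ⧸ Ideal.span {F})] (hF : F ∈ IsLocalRing.maximalIdeal O ^ 2) :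
    F = 0 := by
  obtain ⟨l, h1, h2⟩ := exists_conormal_retraction k (Ideal.span {F})
  -- For F in m² the differential lies in mΩ, so the retraction gives F ∈ m(F) + (F²) ⊆ m(F), and 1
  -- - μ is a unit for μ in m.
  have hm : l (D k O F) ∈ (IsLocalRing.maximalIdeal O * Ideal.span {F}).map
      (Ideal.Quotient.mk (Ideal.span {F} ^ 2)) := by
    have := Submodule.mem_map_of_mem (f := l) (D_mem_smul_top_of_mem_sq (k := k) hF)
    rw [Submodule.map_smul''] at this
    refine Submodule.smul_induction_on this (fun a ha y hy ↦ ?_) fun _ _ ↦ add_mem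
    obtain ⟨ω, -, rfl⟩ := hy
    obtain ⟨y, hy, e⟩ := (Ideal.mem_map_iff_of_surjective _ Ideal.Quotient.mk_surjective).mp (h2 ω)
    rw [← e]
    exact Ideal.mem_map_of_mem (Ideal.Quotient.mk _) (Ideal.mul_mem_mul ha hy)
  rw [h1 F (Ideal.mem_span_singleton_self F)] at hm
  obtain ⟨y, hy, e⟩ := (Ideal.mem_map_iff_of_surjective _ Ideal.Quotient.mk_surjective).mp hm
  rw [Ideal.Quotient.eq] at e
  have hF1 : F ∈ IsLocalRing.maximalIdeal O :=
    Ideal.pow_le_self two_ne_zero hF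
  have h3 : F ∈ IsLocalRing.maximalIdeal O * Ideal.span {F} := by
    rw [pow_two] at e
    have := sub_mem hy (Ideal.mul_mono_left ((Ideal.span_singleton_le_iff_mem _).mpr hF1) e)
    rwa [sub_sub_cancel] at this
  obtain ⟨μ, hμ, e'⟩ := Ideal.mem_mul_span_singleton.mp h3
  have hu : IsUnit (1 - μ) := by
    by_contra hu
    exact (Ideal.ne_top_iff_one _).mp (IsLocalRing.maximalIdeal.isMaximal O).ne_top
      (by simpa using add_mem ((IsLocalRing.mem_maximalIdeal _).mpr hu) hμ)
  refine hu.mul_right_eq_zero.mp ?_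
  rw [sub_mul, e', one_mul, sub_self]

variable {k} in
/-- A hypersurface on which some derivation of its equation is invertible is formally smooth. -/
lemma formallySmooth_quotient_of_derivation [Algebra.FormallySmooth k O] {F : O}
    (d : Derivation k O O) (hd : IsUnit (d F)) :
    Algebra.FormallySmooth k (O ⧸ Ideal.span {F}) := by
  obtain ⟨v, hv⟩ := hd.exists_left_inv
  let f : O →ₐ[k] O ⧸ Ideal.span {F} := Ideal.Quotient.mkₐ k _
  let K : Ideal O := RingHom.ker f.toRingHom
  have hK : K = Ideal.span {F} := Ideal.mk_ker
  let q : O →+* O ⧸ K ^ 2 := Ideal.Quotient.mk (K ^ 2)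
  have hK2 {x : O} : q x = 0 ↔ ∃ c, x = c * F ^ 2 := by
    rw [Ideal.Quotient.eq_zero_iff_mem, hK, Ideal.span_singleton_pow, Ideal.mem_span_singleton']
    simp [eq_comm]
  -- With v = d(F)⁻¹, the map a ↦ a - v d(a) F is a Taylor shift: multiplicative modulo F², and it
  -- sends multiples of F into (F²). It thus splits O/F² → O/F.
  let g₀ : O →ₐ[k] O ⧸ K ^ 2 :=
    { toFun a := q (a - v * d a * F)
      map_one' := by simp
      map_mul' a b := by
        rw [← map_mul, ← sub_eq_zero, ← map_sub, hK2]
        refine ⟨- (v ^ 2 * d a * d b), ?_⟩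
        simp only [Derivation.leibniz, smul_eq_mul]
        ring
      map_zero' := by simp
      map_add' a b := by
        rw [← map_add, map_add d]; congr 1; ring
      commutes' r := by simp; rfl }
  have hg₀ (a : O) : g₀ a = q (a - v * d a * F) := rfl
  let g : (O ⧸ Ideal.span {F}) →ₐ[k] O ⧸ K ^ 2 :=
    Ideal.Quotient.liftₐ _ g₀ fun a ha ↦ by
      obtain ⟨c, rfl⟩ := Ideal.mem_span_singleton'.mp ha
      rw [hg₀, hK2]
      refine ⟨-(v * d c), ?_⟩
      simp only [Derivation.leibniz, smul_eq_mul]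
      linear_combination (-c * F) * hv
  refine Algebra.FormallySmooth.of_split f g ?_
  refine Ideal.Quotient.algHom_ext _ (AlgHom.ext fun a ↦ ?_)
  change f.kerSquareLift (g₀ a) = Ideal.Quotient.mk _ a
  rw [hg₀]
  change Ideal.Quotient.mk (Ideal.span {F}) _ = _
  rw [Ideal.Quotient.eq, Ideal.mem_span_singleton']
  exact ⟨-(v * d a), by ring⟩

end Retraction

/-! ### Étale coordinates from bases of differentials. -/

section Etale

open MvPolynomial

variable {n : ℕ} {O : Type} [CommRing O] [Algebra ℂ O] [Algebra (Poly n) O]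
  [IsScalarTower ℂ (Poly n) O]

/-- The hypothesis makes O ⊗ Ω of the polynomial ring isomorphic to Ω of O. In the Jacobi–Zariski
sequence surjectivity kills the relative differentials; injectivity and the vanishing of H₁ of O
over ℂ kill the relative H₁. -/
lemma formallyEtale_of_basis [Algebra.FormallySmooth ℂ O]
    (b : Module.Basis (Fin n) O Ω[O⁄ℂ]) (hb : ∀ i, b i = D ℂ O (algebraMap (Poly n) O (X i))) :
    Algebra.FormallyEtale (Poly n) O := by
  let b' : Module.Basis (Fin n) O (O ⊗[Poly n] Ω[Poly n⁄ℂ]) :=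
    (mvPolynomialBasis ℂ (Fin n)).baseChange O
  have hb' (i : Fin n) : mapBaseChange ℂ (Poly n) O (b' i) = b i := by
    simp [b', hb]
  have hbij : Function.Bijective (mapBaseChange ℂ (Poly n) O) := by
    have : mapBaseChange ℂ (Poly n) O = (b'.equiv b (.refl _)).toLinearMap :=
      b'.ext fun i ↦ by simp [hb']
    rw [this]
    exact (b'.equiv b (.refl _)).bijective
  constructor
  · refine (subsingleton_iff_forall_eq 0).mpr fun x ↦ ?_
    obtain ⟨y, rfl⟩ := KaehlerDifferential.map_surjective ℂ (Poly n) O x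
    obtain ⟨z, rfl⟩ := hbij.2 y
    exact (exact_mapBaseChange_map ℂ (Poly n) O _).mpr ⟨z, rfl⟩
  · refine (subsingleton_iff_forall_eq 0).mpr fun x ↦ ?_
    have h1 : Algebra.H1Cotangent.δ ℂ (Poly n) O x = 0 := hbij.1 <| by
      rw [map_zero]
      exact (Algebra.H1Cotangent.exact_δ_mapBaseChange ℂ (Poly n) O _).mpr ⟨x, rfl⟩
    obtain ⟨y, rfl⟩ := (Algebra.H1Cotangent.exact_map_δ ℂ (Poly n) O x).mp h1
    rw [Subsingleton.elim y 0, map_zero]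

/-- The partial derivatives in étale coordinates. -/
lemma exists_partialDerivative [Algebra.FormallyEtale (Poly n) O] (i : Fin n) :
    ∃ d : Derivation ℂ O O, ∀ j, d (algebraMap (Poly n) O (X j)) = if i = j then 1 else 0 := by
  let l : Ω[O⁄ℂ] →ₗ[O] O :=
    (((mvPolynomialBasis ℂ (Fin n)).baseChange O).coord i) ∘ₗ
      (tensorKaehlerEquivOfFormallyEtale ℂ (Poly n) O).symm.toLinearMap
  refine ⟨l.compDer (D ℂ O), fun j ↦ ?_⟩
  change (((mvPolynomialBasis ℂ (Fin n)).baseChange O).coord i)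
    ((tensorKaehlerEquivOfFormallyEtale ℂ (Poly n) O).symm (D ℂ O (algebraMap (Poly n) O (X j)))) = _
  rw [tensorKaehlerEquivOfFormallyEtale_symm_D_algebraMap]
  simp [Finsupp.single_apply, eq_comm]

end Etale

/-! ### Coordinates adapted to a smooth subscheme. -/

section Adapted

open MvPolynomial IsLocalRing

lemma ker_mk_residueField {O M : Type*} [CommRing O] [IsLocalRing O] [AddCommGroup M] [Module O M]
    {x : M} (hx : (1 : ResidueField O) ⊗ₜ[O] x = 0) :
    x ∈ maximalIdeal O • (⊤ : Submodule O M) := by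
  let f : ResidueField O ⊗[O] M →ₗ[O] M ⧸ (maximalIdeal O • (⊤ : Submodule O M)) :=
    (TensorProduct.quotTensorEquivQuotSMul M (maximalIdeal O)).toLinearMap
  have h := congr(f $hx)
  have h2 : f (1 ⊗ₜ x) = Submodule.Quotient.mk x :=
    TensorProduct.quotTensorEquivQuotSMul_mk_tmul (maximalIdeal O) 1 x |>.trans (by simp)
  rw [map_zero, h2] at h
  exact (Submodule.Quotient.mk_eq_zero _).mp h

variable {n : ℕ} {A : Type} [CommRing A] [Algebra ℂ A]

/-- Étale coordinates adapted to a smooth subscheme. -/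
theorem exists_adapted_coordinates [Algebra.IsStandardSmoothOfRelativeDimension n ℂ A]
    (I p : Ideal A) [p.IsPrime]
    [Algebra.FormallySmooth ℂ
      (Localization.AtPrime p ⧸ I.map (algebraMap A (Localization.AtPrime p)))] (hI : I ≤ p) :
    ∃ g ∉ p, ∃ (t : Fin n → A) (S : Finset (Fin n)),
      ((algebraMap A (Localization.Away g)).comp (aeval t : Poly n →ₐ[ℂ] A).toRingHom).Etale ∧
      I.map (algebraMap A (Localization.Away g)) =
        Ideal.span ((fun i ↦ algebraMap A (Localization.Away g) (t i)) '' S) := by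
  classical
  have : Algebra.IsStandardSmooth ℂ A :=
    Algebra.IsStandardSmoothOfRelativeDimension.isStandardSmooth n
  have : Algebra.Smooth ℂ A := inferInstance
  have : IsNoetherianRing A := Algebra.FiniteType.isNoetherianRing ℂ A
  have : Nontrivial A := ⟨0, 1, fun h ↦ (Ideal.ne_top_iff_one p).mp (Ideal.IsPrime.ne_top ‹_›)
    (h ▸ zero_mem p)⟩
  let O := Localization.AtPrime p
  have : Algebra.FormallyEtale A O := .of_isLocalization p.primeCompl
  have : Algebra.FormallySmooth ℂ O := .comp ℂ A O
  have : Module.Finite O Ω[O⁄ℂ] := .of_isLocalizedModule p.primeCompl (map ℂ ℂ A O)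
  have : Module.FinitePresentation O Ω[O⁄ℂ] := Module.finitePresentation_of_projective _ _
  have hrank : Module.finrank O Ω[O⁄ℂ] = n := by
    rw [← (tensorKaehlerEquivOfFormallyEtale ℂ A O).finrank_eq, Module.finrank_baseChange]
    exact Module.finrank_eq_of_rank_eq
      (Algebra.IsStandardSmoothOfRelativeDimension.rank_kaehlerDifferential n)
  let κ := ResidueField O
  let V := κ ⊗[O] Ω[O⁄ℂ]
  let v : A → Ω[O⁄ℂ] := fun a ↦ D ℂ O (algebraMap A O a)
  let mk : Ω[O⁄ℂ] →ₗ[O] V := TensorProduct.mk O κ Ω[O⁄ℂ] 1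
  let w : A → V := fun a ↦ mk (v a)
  have hspan (X : Set A) : (Submodule.span κ (w '' X)).restrictScalars O =
      (Submodule.span O (v '' X)).map mk := by
    rw [Submodule.restrictScalars_span O κ Ideal.Quotient.mk_surjective, Submodule.map_span,
      Set.image_image]
  have htop : Submodule.span O (v '' Set.univ) = ⊤ := by
    rw [Set.image_univ, ← span_range_map_derivation_of_isLocalization ℂ A O p.primeCompl]
    congr 2
    ext a
    simp [v]
  -- b₁ is a maximal subset of I with independent differentials at p; it is then enlarged by
  -- arbitrary functions to b₂, whose differentials form a basis at p.
  obtain ⟨b₁, hb₁, -, hb₁s, hb₁i⟩ := exists_linearIndepOn_extension (K := κ) (v := w)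
    (linearIndepOn_empty κ w) (Set.empty_subset (I : Set A))
  obtain ⟨b₂, -, hb₁₂, hb₂s, hb₂i⟩ := exists_linearIndepOn_extension hb₁i (Set.subset_univ _)
  have hb₂top : Submodule.span κ (Set.range fun i : b₂ ↦ w i) = ⊤ := by
    rw [eq_top_iff]
    have h1 : (Submodule.span κ (w '' Set.univ)) = ⊤ := by
      rw [← Submodule.restrictScalars_eq_top_iff O, hspan, htop, Submodule.map_top,
        LinearMap.range_eq_top]
      exact TensorProduct.mk_surjective _ _ _ Ideal.Quotient.mk_surjective
    rw [← h1, Submodule.span_le]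
    refine hb₂s.trans (Submodule.span_mono ?_)
    rintro _ ⟨a, ha, rfl⟩
    exact ⟨⟨a, ha⟩, rfl⟩
  -- Nakayama lifts a basis over the residue field to a basis of the differentials of the local
  -- ring.
  obtain ⟨b, hb⟩ := Module.exists_basis_of_basis_baseChange (R := O) (fun i : b₂ ↦ v i) hb₂i
    hb₂top (Module.Flat.rTensor_preserves_injective_linearMap (maximalIdeal O).subtype
      Subtype.val_injective)
  have : Finite b₂ := Module.Finite.finite_basis b
  have := Fintype.ofFinite b₂
  have hcard : Fintype.card b₂ = n := by rw [← hrank, Module.finrank_eq_card_basis b]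
  let e : b₂ ≃ Fin n := Fintype.equivFinOfCardEq hcard
  let t : Fin n → A := fun i ↦ (e.symm i : A)
  let S : Finset (Fin n) := {i | t i ∈ b₁}
  have hSb : t '' S = b₁ := by
    ext a
    constructor
    · rintro ⟨i, hi, rfl⟩
      simpa [S] using hi
    · intro ha
      exact ⟨e ⟨a, hb₁₂ ha⟩, by simp [S, t, ha], by simp [t]⟩
  let : Algebra (Poly n) A := (aeval t : Poly n →ₐ[ℂ] A).toAlgebra
  have : IsScalarTower ℂ (Poly n) A := .of_algebraMap_eq fun z ↦ ((aeval t).commutes z).symm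
  have halg (i : Fin n) : algebraMap (Poly n) A (X i) = t i := aeval_X t i
  have : Algebra.FinitePresentation (Poly n) A :=
    .of_restrict_scalars_finitePresentation ℂ (Poly n) A
  have : IsScalarTower ℂ (Poly n) O := .of_algebraMap_eq' (by
    rw [IsScalarTower.algebraMap_eq (Poly n) A O, RingHom.comp_assoc,
      ← IsScalarTower.algebraMap_eq ℂ (Poly n) A, ← IsScalarTower.algebraMap_eq ℂ A O])
  have : Algebra.IsEtaleAt (Poly n) p := by
    refine formallyEtale_of_basis (O := O) (b.reindex e) fun i ↦ ?_
    rw [IsScalarTower.algebraMap_apply (Poly n) A O, halg]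
    simp [hb, t, v]
  obtain ⟨g₁, hg₁, hg₁e⟩ := Algebra.exists_etale_of_isEtaleAt (R := Poly n) p
  -- the chosen functions generate the ideal
  set J := I.map (algebraMap A O) with hJ
  obtain ⟨l, hl, hl'⟩ := exists_conormal_retraction ℂ J
  have hJm : J ≤ maximalIdeal O := by
    rw [← Localization.AtPrime.map_eq_maximalIdeal]
    exact Ideal.map_mono hI
  -- For a in I, the differential of a is a combination of those of b₁ modulo mΩ. The conormal
  -- retraction turns this into a ∈ (t_i)_{i∈S} + mJ + J², and Nakayama removes the last terms.
  have hle : J ≤ Ideal.span (algebraMap A O '' (t '' S)) := by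
    refine Submodule.le_of_le_smul_of_le_jacobson_bot (I := maximalIdeal O)
      (N := Ideal.span (algebraMap A O '' (t '' S))) (IsNoetherian.noetherian _)
      (IsLocalRing.jacobson_eq_maximalIdeal _ bot_ne_top).ge ?_
    rw [hJ, Ideal.map_le_iff_le_comap]
    intro a ha
    have hwa : mk (v a) ∈ (Submodule.span O (v '' b₁)).map mk := by
      rw [← hspan]
      exact hb₁s ⟨a, ha, rfl⟩
    obtain ⟨ω, hω, hωa⟩ := hwa
    have hker : v a - ω ∈ maximalIdeal O • (⊤ : Submodule O Ω[O⁄ℂ]) := by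
      refine ker_mk_residueField ?_
      change mk (v a - ω) = 0
      rw [map_sub, hωa, sub_self]
    have h1 : l (v a - ω) ∈ (maximalIdeal O * J).map (Ideal.Quotient.mk (J ^ 2)) := by
      have := Submodule.mem_map_of_mem (f := l) hker
      rw [Submodule.map_smul''] at this
      refine Submodule.smul_induction_on this (fun a ha y hy ↦ ?_) fun _ _ ↦ add_mem
      obtain ⟨ω, -, rfl⟩ := hy
      obtain ⟨y, hy, e⟩ := (Ideal.mem_map_iff_of_surjective _ Ideal.Quotient.mk_surjective).mp (hl' ω)
      rw [← e]
      exact Ideal.mem_map_of_mem (Ideal.Quotient.mk _) (Ideal.mul_mem_mul ha hy)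
    have h2 : l ω ∈ (Ideal.span (algebraMap A O '' (t '' S))).map (Ideal.Quotient.mk (J ^ 2)) := by
      have := Submodule.mem_map_of_mem (f := l) hω
      rw [Submodule.map_span] at this
      refine Submodule.span_induction ?_ (zero_mem _) (fun _ _ _ _ ↦ add_mem)
        (fun c y _ hy ↦ ?_) this
      · rintro _ ⟨_, ⟨a, ha, rfl⟩, rfl⟩
        rw [hl _ (Ideal.mem_map_of_mem _ (hb₁ ha))]
        refine Ideal.mem_map_of_mem _ (Ideal.subset_span ⟨a, ?_, rfl⟩)
        rw [hSb]; exact ha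
      · exact Ideal.mul_mem_left _ (Ideal.Quotient.mk _ c) hy
    have h3 : l (v a) ∈ (Ideal.span (algebraMap A O '' (t '' S)) ⊔ maximalIdeal O * J).map
        (Ideal.Quotient.mk (J ^ 2)) := by
      have : l (v a) = l ω + l (v a - ω) := by rw [map_sub]; abel
      rw [this, Ideal.map_sup]
      exact Submodule.add_mem_sup h2 h1
    rw [hl _ (Ideal.mem_map_of_mem _ ha)] at h3
    obtain ⟨y, hy, e⟩ := (Ideal.mem_map_iff_of_surjective _ Ideal.Quotient.mk_surjective).mp h3
    rw [Ideal.Quotient.eq, pow_two] at e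
    have h4 := sub_mem hy (Ideal.mem_sup_right (S := Ideal.span (algebraMap A O '' (t '' S)))
      (Ideal.mul_mono_left hJm e))
    rw [sub_sub_cancel] at h4
    exact h4
  have hloc (a : A) (ha : a ∈ I) : ∃ h ∉ p, h * a ∈ Ideal.span (t '' S) := by
    have h1 := hle (Ideal.mem_map_of_mem _ ha)
    rw [← Ideal.map_span] at h1
    obtain ⟨⟨x, s⟩, hx⟩ := (IsLocalization.mem_map_algebraMap_iff p.primeCompl O).mp h1
    rw [← map_mul] at hx
    obtain ⟨c, hc⟩ := (IsLocalization.eq_iff_exists p.primeCompl O).mp hx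
    refine ⟨c * s, p.primeCompl.mul_mem c.2 s.2, ?_⟩
    have : c * s * a = c * (a * s) := by ring
    rw [this, hc]
    exact Ideal.mul_mem_left _ _ x.2
  -- The product of the denominators for finitely many generators of I works for all of I.
  obtain ⟨g₂, hg₂, hg₂I⟩ : ∃ h ∉ p, ∀ a ∈ I, h * a ∈ Ideal.span (t '' S) := by
    obtain ⟨G, hG⟩ := IsNoetherian.noetherian I
    choose! h hh hh' using hloc
    have hGI : ∀ a ∈ G, a ∈ I := fun a ha ↦ hG ▸ Ideal.subset_span ha
    refine ⟨∏ a ∈ G, h a, ?_, fun a ha ↦ ?_⟩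
    · exact p.primeCompl.prod_mem fun a ha ↦ hh a (hGI a ha)
    · rw [← hG] at ha
      refine Submodule.span_induction (fun a ha ↦ ?_) (by simp) (fun x y _ _ hx hy ↦ ?_)
        (fun c x _ hx ↦ ?_) ha
      · rw [← Finset.prod_erase_mul _ _ ha, mul_assoc]
        exact Ideal.mul_mem_left _ _ (hh' a (hGI a ha))
      · rw [mul_add]; exact add_mem hx hy
      · rw [smul_eq_mul, mul_left_comm]; exact Ideal.mul_mem_left _ _ hx
  refine ⟨g₁ * g₂, p.primeCompl.mul_mem hg₁ hg₂, t, S, ?_, ?_⟩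
  · have : Algebra.Etale (Poly n) (Localization.Away (g₁ * g₂)) := by
      rw [← Algebra.basicOpen_subset_etaleLocus_iff_etale] at hg₁e ⊢
      refine Set.Subset.trans ?_ hg₁e
      rw [PrimeSpectrum.basicOpen_mul]
      exact Set.inter_subset_left
    exact RingHom.etale_algebraMap.mpr this
  · rw [← Set.image_image (algebraMap A (Localization.Away (g₁ * g₂))) t, ← Ideal.map_span]
    apply le_antisymm
    · rw [Ideal.map_le_iff_le_comap]
      intro a ha
      have hu : IsUnit (algebraMap A (Localization.Away (g₁ * g₂)) g₂) :=
        isUnit_of_mul_isUnit_right (x := algebraMap A (Localization.Away (g₁ * g₂)) g₁) (by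
          rw [← map_mul]; exact IsLocalization.Away.algebraMap_isUnit (g₁ * g₂))
      rw [Ideal.mem_comap, ← Ideal.unit_mul_mem_iff_mem _ hu, ← map_mul]
      exact Ideal.mem_map_of_mem _ (hg₂I a ha)
    · refine Ideal.map_mono ?_
      rw [Ideal.span_le, hSb]
      exact hb₁

end Adapted

/-! ### Germs of holomorphic functions -/

/-- A function that is homogeneous of degree `k` and vanishes to higher order is zero. -/
lemma eq_zero_of_homogeneous_of_isBigO {E : Type*} [NormedAddCommGroup E] [NormedSpace ℂ E]
    {h : E → ℂ} {k : ℕ} (hh : ∀ (ε : ℂ) w, h (ε • w) = ε ^ k * h w)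
    (hO : h =O[𝓝 0] fun z ↦ ‖z‖ ^ (k + 1)) (w : E) : h w = 0 := by
  have ht : Filter.Tendsto (fun ε : ℂ ↦ ε • w) (𝓝[≠] 0) (𝓝 0) := by
    have : Filter.Tendsto (fun ε : ℂ ↦ ε • w) (𝓝 0) (𝓝 ((0 : ℂ) • w)) :=
      (continuous_id.smul continuous_const).tendsto 0
    rw [zero_smul] at this
    exact this.mono_left nhdsWithin_le_nhds
  have h1 := hO.comp_tendsto ht
  -- The estimate is restricted to the line through w, where a factor ε^k can be cancelled.
  have h2 : (fun ε : ℂ ↦ ε ^ k * h w) =O[𝓝[≠] 0] fun ε ↦ ε ^ (k + 1) := by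
    refine IsBigO.trans (h1.congr_left fun ε ↦ hh ε w) ?_
    refine IsBigO.of_bound (‖w‖ ^ (k + 1)) (Filter.Eventually.of_forall fun ε ↦ ?_)
    simp [norm_smul, mul_pow, mul_comm]
  have h3 : (fun _ : ℂ ↦ h w) =O[𝓝[≠] 0] fun ε : ℂ ↦ ε := by
    refine ((isBigO_refl (fun ε : ℂ ↦ (ε ^ k)⁻¹) (𝓝[≠] 0)).mul h2).congr' ?_ ?_
    · filter_upwards [self_mem_nhdsWithin] with ε hε
      have : ε ≠ 0 := hε
      field_simp
    · filter_upwards [self_mem_nhdsWithin] with ε hε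
      have : ε ≠ 0 := hε
      field_simp
      ring
  have h4 : Filter.Tendsto (fun ε : ℂ ↦ ε) (𝓝[≠] 0) (𝓝 0) :=
    Filter.tendsto_id.mono_left nhdsWithin_le_nhds
  exact tendsto_nhds_unique tendsto_const_nhds (h3.trans_tendsto h4)

/-- The difference is homogeneous of degree two and vanishes to third order, so the form is zero;
polarization recovers the symmetric matrix. -/
lemma matrix_eq_of_isBigO {n : ℕ} {A B : Matrix (Fin n) (Fin n) ℂ} (hA : A.IsSymm) (hB : B.IsSymm)
    (h : (fun z ↦ z ⬝ᵥ A.mulVec z - z ⬝ᵥ B.mulVec z) =O[𝓝 0] fun z : Fin n → ℂ ↦ ‖z‖ ^ 3) :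
    A = B := by
  have h1 (w : Fin n → ℂ) : w ⬝ᵥ (A - B).mulVec w = 0 := by
    refine eq_zero_of_homogeneous_of_isBigO (k := 2) (h := fun w ↦ w ⬝ᵥ (A - B).mulVec w)
      (fun ε w ↦ ?_) (h.congr_left fun w ↦ ?_) w
    · simp only [Matrix.mulVec_smul, dotProduct_smul, smul_dotProduct, smul_eq_mul]; ring
    · simp only [Matrix.sub_mulVec, dotProduct_sub]
  have hC : (A - B).IsSymm := hA.sub hB
  have h2 (i j : Fin n) : Pi.single i 1 ⬝ᵥ (A - B).mulVec (Pi.single j 1) = (A - B) i j := by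
    simp
  rw [← sub_eq_zero]
  ext i j
  have h3 := h1 (Pi.single i 1 + Pi.single j 1)
  simp only [Matrix.mulVec_add, dotProduct_add, add_dotProduct, h2] at h3
  have hi := h2 i i
  have hj := h2 j j
  rw [h1] at hi hj
  have hs : (A - B) j i = (A - B) i j := hC.apply i j
  rw [← hi, ← hj, hs] at h3
  simpa [← two_mul] using h3

namespace HolGerm

variable {n m : ℕ}

/-- A function representing a germ. -/
def rep (φ : HolGerm n) : (Fin n → ℂ) → ℂ := φ.2.choose

lemma analyticAt_rep (φ : HolGerm n) : AnalyticAt ℂ (rep φ) 0 := φ.2.choose_spec.1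

lemma mk_rep (φ : HolGerm n) : mk (rep φ) (analyticAt_rep φ) = φ :=
  Subtype.ext φ.2.choose_spec.2.symm

lemma mk_eq_mk {f g : (Fin n → ℂ) → ℂ} {hf : AnalyticAt ℂ f 0} {hg : AnalyticAt ℂ g 0} :
    mk f hf = mk g hg ↔ f =ᶠ[𝓝 0] g :=
  Subtype.ext_iff.trans Filter.Germ.coe_eq

lemma rep_mk {f : (Fin n → ℂ) → ℂ} (hf : AnalyticAt ℂ f 0) : (rep (mk f hf)) =ᶠ[𝓝 0] f :=
  mk_eq_mk.mp (mk_rep (mk f hf))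

lemma eq_iff {φ ψ : HolGerm n} : φ = ψ ↔ rep φ =ᶠ[𝓝 0] rep ψ := by
  rw [← mk_eq_mk (hf := (analyticAt_rep φ)) (hg := (analyticAt_rep ψ)), mk_rep, mk_rep]

lemma rep_add (φ ψ : HolGerm n) : (rep (φ + ψ)) =ᶠ[𝓝 0] rep φ + rep ψ := by
  refine Filter.EventuallyEq.trans ?_ (rep_mk ((analyticAt_rep φ).add (analyticAt_rep ψ)))
  rw [← eq_iff]
  conv_lhs => rw [← mk_rep φ, ← mk_rep ψ]
  rfl

lemma rep_mul (φ ψ : HolGerm n) : (rep (φ * ψ)) =ᶠ[𝓝 0] rep φ * rep ψ := by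
  refine Filter.EventuallyEq.trans ?_ (rep_mk ((analyticAt_rep φ).mul (analyticAt_rep ψ)))
  rw [← eq_iff]
  conv_lhs => rw [← mk_rep φ, ← mk_rep ψ]
  rfl

lemma rep_const (c : ℂ) : (rep (const c : HolGerm n)) =ᶠ[𝓝 0] fun _ ↦ c := rep_mk _

lemma rep_zero : (rep (0 : HolGerm n)) =ᶠ[𝓝 0] 0 := rep_const 0

lemma rep_coord (k : Fin n) : (rep (coord k)) =ᶠ[𝓝 0] fun z ↦ z k := rep_mk _

lemma rep_sum {ι : Type*} (s : Finset ι) (φ : ι → HolGerm n) :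
    (rep (∑ i ∈ s, φ i)) =ᶠ[𝓝 0] fun z ↦ ∑ i ∈ s, (rep (φ i)) z := by
  classical
  induction s using Finset.induction_on with
  | empty => exact rep_zero
  | insert a s ha ih =>
    rw [Finset.sum_insert ha]
    filter_upwards [rep_add (φ a) (∑ i ∈ s, φ i), ih] with z h1 h2
    rw [h1, Pi.add_apply, h2, Finset.sum_insert ha]

lemma rep_sub (φ ψ : HolGerm n) : (rep (φ - ψ)) =ᶠ[𝓝 0] rep φ - rep ψ := by
  filter_upwards [rep_add (φ - ψ) ψ] with z h
  rw [sub_add_cancel] at h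
  simp [h]

/-- The value of a germ at the origin. -/
def eval : HolGerm n →+* ℂ := Filter.Germ.valueRingHom.comp (HolGerm n).subtype

@[simp] lemma eval_mk {f : (Fin n → ℂ) → ℂ} (hf : AnalyticAt ℂ f 0) : eval (mk f hf) = f 0 := rfl

@[simp] lemma eval_const (c : ℂ) : eval (const c : HolGerm n) = c := rfl

@[simp] lemma eval_coord (k : Fin n) : eval (coord k) = 0 := rfl

lemma rep_apply_zero (φ : HolGerm n) : rep φ 0 = eval φ := by
  rw [← eval_mk (analyticAt_rep φ), mk_rep]

/-- The germs of constant functions. -/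
def constHom (n : ℕ) : ℂ →+* HolGerm n where
  toFun := const
  map_one' := rfl
  map_mul' _ _ := rfl
  map_zero' := rfl
  map_add' _ _ := rfl

@[simp] lemma constHom_apply (c : ℂ) : constHom n c = const c := rfl

instance : Algebra ℂ (HolGerm n) := (constHom n).toAlgebra

lemma algebraMap_apply (c : ℂ) : algebraMap ℂ (HolGerm n) c = const c := rfl

lemma isUnit_of_eval_ne_zero {φ : HolGerm n} (h : eval φ ≠ 0) : IsUnit φ := by
  have h0 : rep φ 0 ≠ 0 := by rwa [rep_apply_zero]
  refine IsUnit.of_mul_eq_one (mk (fun z ↦ (rep φ z)⁻¹) ((analyticAt_rep φ).inv h0)) ?_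
  refine (congrArg (· * mk (fun z ↦ (rep φ z)⁻¹) ((analyticAt_rep φ).inv h0))
    (mk_rep φ).symm).trans ?_
  have h1 : ∀ᶠ z in 𝓝 0, rep φ z ≠ 0 :=
    (analyticAt_rep φ).continuousAt.eventually_ne h0
  exact (mk_eq_mk (hf := (analyticAt_rep φ).mul ((analyticAt_rep φ).inv h0))
    (hg := analyticAt_const (v := (1 : ℂ)))).mpr
    (by filter_upwards [h1] with z hz using mul_inv_cancel₀ hz)

/-- The ideal of germs that vanish at the origin. -/
def maxIdeal (n : ℕ) : Ideal (HolGerm n) := Ideal.span (Set.range coord)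

lemma coord_mem (k : Fin n) : coord k ∈ maxIdeal n := Ideal.subset_span ⟨k, rfl⟩

/-- Hadamard's lemma. Splitting one argument off each term of the power series gives f(z) = L(z)(z)
with L a holomorphic family of linear forms, and the g_k are the components of L. -/
lemma exists_eq_sum_of_eval_eq_zero {φ : HolGerm n} (h : eval φ = 0) :
    ∃ g : Fin n → HolGerm n, φ = ∑ k, coord k * g k := by
  obtain ⟨p, r, hp⟩ := (analyticAt_rep φ)
  have hq : HasFPowerSeriesOnBall p.shift.sum p.shift 0 p.shift.radius :=
    p.shift.hasFPowerSeriesOnBall (by rw [p.radius_shift]; exact hp.r_pos.trans_le hp.r_le)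
  have hqa : AnalyticAt ℂ p.shift.sum 0 := hq.analyticAt
  let g (k : Fin n) (z : Fin n → ℂ) : ℂ := p.shift.sum z (Pi.single k 1)
  have hg (k : Fin n) : AnalyticAt ℂ (g k) 0 :=
    ((ContinuousLinearMap.apply ℂ ℂ (Pi.single k 1 : Fin n → ℂ)).analyticAt _).comp hqa
  have key : rep φ =ᶠ[𝓝 0] fun z ↦ ∑ k, z k * g k z := by
    filter_upwards [Metric.eball_mem_nhds (0 : Fin n → ℂ) hp.r_pos] with z hz
    have h1 := hp.hasSum hz
    have h2 := hq.hasSum (Metric.eball_subset_eball (by rw [p.radius_shift]; exact hp.r_le) hz)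
    rw [zero_add] at h1 h2
    have h3 := (ContinuousLinearMap.apply ℂ ℂ z).hasSum h2
    have h4 := (hasSum_nat_add_iff' 1).mpr h1
    have h5 : ∑ i ∈ Finset.range 1, (p i fun _ ↦ z) = 0 := by
      rw [Finset.sum_range_one, hp.coeff_zero, rep_apply_zero, h]
    rw [h5, sub_zero] at h4
    have h6 : rep φ z = p.shift.sum z z := by
      refine h4.unique (h3.congr_fun fun k ↦ ?_)
      simp only [FormalMultilinearSeries.shift, ContinuousLinearMap.apply_apply]
      rw [ContinuousMultilinearMap.curryRight_apply]
      congr 1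
      ext j
      refine Fin.lastCases ?_ (fun j ↦ ?_) j <;> simp
    rw [h6]
    conv_lhs => rw [← Finset.univ_sum_single z, map_sum]
    refine Finset.sum_congr rfl fun k _ ↦ ?_
    have : (Pi.single k (z k) : Fin n → ℂ) = z k • Pi.single k 1 := by
      rw [← Pi.single_smul, smul_eq_mul, mul_one]
    rw [this, map_smul, smul_eq_mul]
    simp only [g, Finset.univ_sum_single]
  refine ⟨fun k ↦ mk (g k) (hg k), ?_⟩
  rw [eq_iff]
  refine key.trans (Filter.EventuallyEq.symm ((rep_sum _ _).trans ?_))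
  have : ∀ k, (rep (coord k * mk (g k) (hg k))) =ᶠ[𝓝 0] fun z ↦ z k * g k z := fun k ↦
    rep_mk (f := fun z ↦ z k * g k z) (((ContinuousLinearMap.proj (R := ℂ)
      (φ := fun _ : Fin n ↦ ℂ) k).analyticAt 0).mul (hg k))
  filter_upwards [Filter.eventually_all.mpr this] with z hz
  exact Finset.sum_congr rfl fun k _ ↦ hz k

lemma mem_maxIdeal_iff {φ : HolGerm n} : φ ∈ maxIdeal n ↔ eval φ = 0 := by
  constructor
  · intro h
    have : maxIdeal n ≤ RingHom.ker (eval (n := n)) := by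
      rw [maxIdeal, Ideal.span_le]
      rintro _ ⟨k, rfl⟩
      exact eval_coord k
    exact this h
  · intro h
    obtain ⟨g, rfl⟩ := exists_eq_sum_of_eval_eq_zero h
    exact sum_mem fun k _ ↦ Ideal.mul_mem_right _ _ (coord_mem k)

lemma sub_const_eval_mem (φ : HolGerm n) : φ - const (eval φ) ∈ maxIdeal n := by
  rw [mem_maxIdeal_iff, map_sub, eval_const, sub_self]

lemma rep_isBigO_one (φ : HolGerm n) : rep φ =O[𝓝 0] fun _ ↦ (1 : ℝ) :=
  (analyticAt_rep φ).continuousAt.norm.isBoundedUnder_le.isBigO_one ℝ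

lemma rep_isBigO_of_mem {φ : HolGerm n} (h : φ ∈ maxIdeal n) : rep φ =O[𝓝 0] fun z : Fin n → ℂ ↦ ‖z‖ := by
  refine Submodule.span_induction (p := fun φ _ ↦ rep φ =O[𝓝 0] fun z : Fin n → ℂ ↦ ‖z‖) ?_ ?_ ?_ ?_ h
  · rintro _ ⟨k, rfl⟩
    refine ((rep_coord k).isBigO).trans (IsBigO.of_bound 1 (.of_forall fun z ↦ ?_))
    simpa using norm_le_pi_norm z k
  · exact rep_zero.isBigO.trans (isBigO_zero _ _)
  · intro φ ψ _ _ h1 h2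
    exact (rep_add φ ψ).isBigO.trans (h1.add h2)
  · intro φ ψ _ h1
    refine (rep_mul φ ψ).isBigO.trans ?_
    exact ((rep_isBigO_one φ).mul h1).congr_right fun _ ↦ one_mul _

lemma rep_isBigO_pow {k : ℕ} {φ : HolGerm n} (h : φ ∈ maxIdeal n ^ k) :
    rep φ =O[𝓝 0] fun z : Fin n → ℂ ↦ ‖z‖ ^ k := by
  induction k generalizing φ with
  | zero => simpa using rep_isBigO_one φ
  | succ k ih =>
    rw [pow_succ] at h
    refine Submodule.mul_induction_on h (fun a ha b hb ↦ ?_) fun a b ha hb ↦ ?_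
    · refine (rep_mul a b).isBigO.trans ?_
      exact ((ih ha).mul (rep_isBigO_of_mem hb)).congr_right fun _ ↦ (pow_succ _ _).symm
    · exact (rep_add a b).isBigO.trans (ha.add hb)

/-! #### Pullback along holomorphic maps -/

section Pullback

variable (G : (Fin n → ℂ) → (Fin m → ℂ)) (hG : AnalyticAt ℂ G 0) (hG0 : G 0 = 0)

lemma tendsto_of_analyticAt {G : (Fin n → ℂ) → (Fin m → ℂ)} (hG : AnalyticAt ℂ G 0)
    (hG0 : G 0 = 0) : Filter.Tendsto G (𝓝 0) (𝓝 0) := by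
  have := hG.continuousAt.tendsto
  rwa [hG0] at this

/-- Pullback of germs along a holomorphic map germ. -/
def pullback : HolGerm m →+* HolGerm n where
  toFun φ := ⟨φ.1.compTendsto G (tendsto_of_analyticAt hG hG0), by
    obtain ⟨_, f, hf, rfl⟩ := φ
    exact ⟨f ∘ G, AnalyticAt.comp (by rwa [hG0]) hG, rfl⟩⟩
  map_one' := rfl
  map_mul' := by
    rintro ⟨_, f, hf, rfl⟩ ⟨_, g, hg, rfl⟩
    rfl
  map_zero' := rfl
  map_add' := by
    rintro ⟨_, f, hf, rfl⟩ ⟨_, g, hg, rfl⟩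
    rfl

lemma pullback_mk {f : (Fin m → ℂ) → ℂ} (hf : AnalyticAt ℂ f 0) :
    pullback G hG hG0 (mk f hf) = mk (f ∘ G) (AnalyticAt.comp (by rwa [hG0]) hG) := rfl

lemma rep_pullback (φ : HolGerm m) : (rep (pullback G hG hG0 φ)) =ᶠ[𝓝 0] rep φ ∘ G := by
  conv_lhs => rw [← mk_rep φ]
  rw [pullback_mk]
  exact rep_mk _

end Pullback

/-- The inverse function theorem for germs: generators `T` of the maximal ideal are coordinates. -/
lemma exists_inverse {T : Fin n → HolGerm n} (hT : Ideal.span (Set.range T) = maxIdeal n) :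
    ∃ (G : (Fin n → ℂ) → (Fin n → ℂ)) (hG : AnalyticAt ℂ G 0) (hG0 : G 0 = 0),
      ∀ i, pullback G hG hG0 (T i) = coord i := by
  let F : (Fin n → ℂ) → (Fin n → ℂ) := fun z i ↦ (rep (T i)) z
  have hF : AnalyticAt ℂ F 0 := analyticAt_pi_iff.mpr fun i ↦ (analyticAt_rep (T i))
  have hF0 : F 0 = 0 := by
    ext i
    change (rep (T i)) 0 = 0
    rw [rep_apply_zero, ← mem_maxIdeal_iff, ← hT]
    exact Ideal.subset_span ⟨i, rfl⟩
  -- Write z_j = ∑ c_i F_i and differentiate at 0. As F(0) = 0, this gives v_j = ∑ c_i(0) dF_i(v),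
  -- so dF(v) = 0 forces v = 0.
  have hinj : Function.Injective (fderiv ℂ F 0) := by
    refine (injective_iff_map_eq_zero _).mpr fun v hv ↦ ?_
    ext j
    have hj : coord j ∈ Ideal.span (Set.range T) := hT ▸ coord_mem j
    obtain ⟨c, hc⟩ := Ideal.mem_span_range_iff_exists_fun.mp hj
    have h1 : (fun z : Fin n → ℂ ↦ z j) =ᶠ[𝓝 0] fun z ↦ ∑ i, (rep (c i)) z * F z i := by
      refine (rep_coord j).symm.trans ?_
      rw [← hc]
      refine (rep_sum _ _).trans ?_
      filter_upwards [Filter.eventually_all.mpr fun i ↦ rep_mul (c i) (T i)] with z hz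
      exact Finset.sum_congr rfl fun i _ ↦ hz i
    have h2 : HasFDerivAt (fun z : Fin n → ℂ ↦ ∑ i, (rep (c i)) z * F z i)
        (∑ i, ((rep (c i)) 0 • (ContinuousLinearMap.proj i).comp (fderiv ℂ F 0) +
          F 0 i • fderiv ℂ (rep (c i)) 0)) 0 := by
      refine HasFDerivAt.fun_sum fun i _ ↦ ?_
      exact (analyticAt_rep (c i)).differentiableAt.hasFDerivAt.mul
        ((hasFDerivAt_pi'.mp hF.differentiableAt.hasFDerivAt) i)
    have h3 := (h2.congr_of_eventuallyEq h1).unique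
      (ContinuousLinearMap.proj (R := ℂ) (φ := fun _ : Fin n ↦ ℂ) j).hasFDerivAt
    have h4 := congr($h3 v)
    simp only [sum_apply, add_apply,
      smul_apply, ContinuousLinearMap.comp_apply, hv, hF0] at h4
    simpa using h4.symm
  let e : (Fin n → ℂ) ≃L[ℂ] (Fin n → ℂ) :=
    (LinearEquiv.ofInjectiveEndo (fderiv ℂ F 0 : (Fin n → ℂ) →ₗ[ℂ] (Fin n → ℂ))
      hinj).toContinuousLinearEquiv
  have he : (e : (Fin n → ℂ) →L[ℂ] (Fin n → ℂ)) = fderiv ℂ F 0 := by ext; rfl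
  have hstrict : HasStrictFDerivAt F (e : (Fin n → ℂ) →L[ℂ] (Fin n → ℂ)) 0 := by
    rw [he]; exact hF.hasStrictFDerivAt
  let Φ := hstrict.toOpenPartialHomeomorph F
  have h0 : (0 : Fin n → ℂ) ∈ Φ.source := hstrict.mem_toOpenPartialHomeomorph_source
  have hΦ : ∀ z, Φ z = F z := fun z ↦ rfl
  have ht : (0 : Fin n → ℂ) ∈ Φ.target := by
    have := Φ.map_source h0
    rwa [hΦ, hF0] at this
  have hG0 : Φ.symm 0 = 0 := by
    have := Φ.left_inv h0
    rwa [hΦ, hF0] at this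
  have hG : AnalyticAt ℂ Φ.symm 0 := by
    have := Φ.analyticAt_symm' (a := 0) h0 (i := e) hF he.symm
    rwa [hΦ, hF0] at this
  refine ⟨Φ.symm, hG, hG0, fun i ↦ ?_⟩
  rw [eq_iff]
  refine (rep_pullback _ _ _ _).trans (Filter.EventuallyEq.trans ?_ (rep_coord i).symm)
  filter_upwards [Φ.open_target.mem_nhds ht] with z hz
  exact congr_fun (Φ.right_inv hz) i

end HolGerm

section

open MvPolynomial

/-! ### Jets of functions at a point -/

/-- The differences of étale coordinates and their values generate the cotangent space. -/
lemma ker_le_span_sup_sq {n : ℕ} {A : Type*} [CommRing A] [Algebra (Poly n) A] [Algebra ℂ A]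
    [IsScalarTower ℂ (Poly n) A] [Algebra.FormallyUnramified (Poly n) A] (ε : A →ₐ[ℂ] ℂ) :
    RingHom.ker ε ≤ Ideal.span (Set.range fun i ↦ algebraMap (Poly n) A (X i) -
      algebraMap ℂ A (ε (algebraMap (Poly n) A (X i)))) ⊔ RingHom.ker ε ^ 2 := by
  let K : Ideal A := Ideal.span (Set.range fun i ↦ algebraMap (Poly n) A (X i) -
      algebraMap ℂ A (ε (algebraMap (Poly n) A (X i)))) ⊔ RingHom.ker ε ^ 2
  -- The quotient map and evaluation at the point agree on the polynomial ring and modulo the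
  -- square-zero image of the kernel of ε, so unramifiedness makes them equal.
  let g₁ : A →+* A ⧸ K := Ideal.Quotient.mk K
  let g₂ : A →+* A ⧸ K := (algebraMap ℂ (A ⧸ K)).comp ε.toRingHom
  have hg : g₁.comp (algebraMap (Poly n) A) = g₂.comp (algebraMap (Poly n) A) := by
    refine MvPolynomial.ringHom_ext (fun z ↦ ?_) fun i ↦ ?_
    · have : algebraMap (Poly n) A (C z) = algebraMap ℂ A z := by
        rw [IsScalarTower.algebraMap_apply ℂ (Poly n) A, MvPolynomial.algebraMap_eq]
      simp only [RingHom.comp_apply, this, g₁, g₂]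
      change _ = algebraMap ℂ (A ⧸ K) (ε (algebraMap ℂ A z))
      rw [AlgHom.commutes]
      rfl
    · change Ideal.Quotient.mk K _ = Ideal.Quotient.mk K (algebraMap ℂ A _)
      rw [Ideal.Quotient.eq]
      exact Ideal.mem_sup_left (Ideal.subset_span ⟨i, rfl⟩)
  let h₁ : A →ₐ[Poly n] A ⧸ K := ⟨g₁, fun _ ↦ rfl⟩
  let h₂ : A →ₐ[Poly n] A ⧸ K := ⟨g₂, fun p ↦ congr($hg p).symm⟩
  have hN : IsNilpotent ((RingHom.ker ε).map (Ideal.Quotient.mk K)) := by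
    refine ⟨2, ?_⟩
    rw [← Ideal.map_pow, Ideal.zero_eq_bot, Ideal.map_eq_bot_iff_le_ker, Ideal.mk_ker]
    exact le_sup_right
  have key : h₁ = h₂ := by
    refine Algebra.FormallyUnramified.ext _ hN fun a ↦ ?_
    rw [Ideal.Quotient.eq]
    change Ideal.Quotient.mk K a - Ideal.Quotient.mk K (algebraMap ℂ A (ε a)) ∈ _
    rw [← map_sub]
    refine Ideal.mem_map_of_mem _ ?_
    rw [RingHom.mem_ker, map_sub, AlgHom.commutes]
    exact sub_self _
  intro a ha
  have h1 : h₁ a = h₂ a := by rw [key]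
  change Ideal.Quotient.mk K a = algebraMap ℂ (A ⧸ K) (ε a) at h1
  rw [(RingHom.mem_ker (f := ε)).mp ha, map_zero, Ideal.Quotient.eq_zero_iff_mem] at h1
  exact h1

namespace HolGerm

variable {n m : ℕ}

/-- The value of a germ at the origin, as a homomorphism of `ℂ`-algebras. -/
def evalₐ : HolGerm n →ₐ[ℂ] ℂ := ⟨eval, fun _ ↦ rfl⟩

lemma ker_evalₐ : RingHom.ker (evalₐ (n := n)) = maxIdeal n := by
  ext φ
  exact mem_maxIdeal_iff.symm

lemma isUnit_iff {φ : HolGerm n} : IsUnit φ ↔ eval φ ≠ 0 :=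
  ⟨fun h ↦ (h.map eval).ne_zero, isUnit_of_eval_ne_zero⟩

lemma maxIdeal_le_jacobson : maxIdeal n ≤ Ideal.jacobson ⊥ := by
  intro φ hφ
  rw [Ideal.mem_jacobson_bot]
  intro ψ
  rw [isUnit_iff, map_add, map_mul, mem_maxIdeal_iff.mp hφ, zero_mul, zero_add, map_one]
  exact one_ne_zero

/-- If the values differed, θ minus the constant value of σ θ would be a unit whose image vanishes
at the origin. -/
lemma eval_algHom (σ : HolGerm m →ₐ[ℂ] HolGerm n) (θ : HolGerm m) : eval (σ θ) = eval θ := by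
  by_contra h
  have h1 : IsUnit (θ - algebraMap ℂ _ (eval (σ θ))) := by
    rw [isUnit_iff, map_sub, algebraMap_apply, eval_const]
    exact sub_ne_zero.mpr (Ne.symm h)
  have h2 := h1.map σ
  rw [isUnit_iff, map_sub, AlgHom.commutes, map_sub, algebraMap_apply, eval_const, sub_self] at h2
  exact h2 rfl

lemma algHom_mem_maxIdeal (σ : HolGerm m →ₐ[ℂ] HolGerm n) {θ : HolGerm m} (h : θ ∈ maxIdeal m) :
    σ θ ∈ maxIdeal n := by
  rw [mem_maxIdeal_iff] at h ⊢
  rw [eval_algHom, h]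

lemma algHom_mem_maxIdeal_pow (σ : HolGerm m →ₐ[ℂ] HolGerm n) {k : ℕ} {θ : HolGerm m}
    (h : θ ∈ maxIdeal m ^ k) : σ θ ∈ maxIdeal n ^ k := by
  have h1 : (maxIdeal m ^ k).map σ ≤ maxIdeal n ^ k := by
    rw [Ideal.map_pow]
    exact Ideal.pow_right_mono (Ideal.map_le_iff_le_comap.mpr fun _ ↦ algHom_mem_maxIdeal σ) k
  exact h1 (Ideal.mem_map_of_mem _ h)

/-- Substitution of germs that vanish at the origin. -/
lemma exists_subst {T : Fin m → HolGerm n} (hT : ∀ i, T i ∈ maxIdeal n) :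
    ∃ σ : HolGerm m →ₐ[ℂ] HolGerm n, ∀ i, σ (coord i) = T i := by
  have hG : AnalyticAt ℂ (fun z i ↦ rep (T i) z) 0 :=
    analyticAt_pi_iff.mpr fun i ↦ analyticAt_rep (T i)
  have hG0 : (fun z i ↦ rep (T i) z : (Fin n → ℂ) → Fin m → ℂ) 0 = 0 := by
    ext i
    exact (rep_apply_zero _).trans (mem_maxIdeal_iff.mp (hT i))
  refine ⟨⟨pullback _ hG hG0, fun _ ↦ rfl⟩, fun i ↦ ?_⟩
  exact mk_rep (T i)

lemma algHom_eq_const_of_coord_eq_zero (σ : HolGerm m →ₐ[ℂ] HolGerm n)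
    (h : ∀ i, σ (coord i) = 0) (θ : HolGerm m) : σ θ = const (eval θ) := by
  have h1 : maxIdeal m ≤ RingHom.ker σ := by
    rw [maxIdeal, Ideal.span_le]
    rintro _ ⟨i, rfl⟩
    exact h i
  have h2 : σ (θ - const (eval θ)) = 0 := h1 (sub_const_eval_mem θ)
  rw [map_sub, sub_eq_zero] at h2
  exact h2.trans (σ.commutes (eval θ))

lemma rep_aeval_coord (p : Poly n) :
    rep (aeval (coord (n := n)) p) =ᶠ[𝓝 0] fun z ↦ MvPolynomial.eval z p := by
  induction p using MvPolynomial.induction_on with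
  | C c =>
    rw [aeval_C, algebraMap_apply]
    filter_upwards [rep_const (n := n) c] with z hz
    rw [hz, eval_C]
  | add p q hp hq =>
    rw [map_add]
    filter_upwards [rep_add (aeval coord p) (aeval coord q), hp, hq] with z h1 h2 h3
    rw [h1, Pi.add_apply, h2, h3, map_add]
  | mul_X p i hp =>
    rw [map_mul, aeval_X]
    filter_upwards [rep_mul (aeval coord p) (coord i), hp, rep_coord i] with z h1 h2 h3
    rw [h1, Pi.mul_apply, h2, h3, map_mul, eval_X]

end HolGerm

section Jets

open HolGerm

variable {n : ℕ} {A : Type*} [CommRing A] [Algebra ℂ A] {ε : A →ₐ[ℂ] ℂ} {s : Fin n → A}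

lemma exists_linear_form (hgen : RingHom.ker ε ≤ Ideal.span (Set.range s) ⊔ RingHom.ker ε ^ 2)
    (hs : ∀ i, ε (s i) = 0) {a : A} (ha : ε a = 0) :
    ∃ c : Fin n → ℂ, a - ∑ i, algebraMap ℂ A (c i) * s i ∈ RingHom.ker ε ^ 2 := by
  obtain ⟨x, hx, w, hw, rfl⟩ := Submodule.mem_sup.mp (hgen ha)
  obtain ⟨b, rfl⟩ := Ideal.mem_span_range_iff_exists_fun.mp hx
  refine ⟨fun i ↦ ε (b i), ?_⟩
  have : ∑ i, b i * s i + w - ∑ i, algebraMap ℂ A (ε (b i)) * s i =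
      ∑ i, (b i - algebraMap ℂ A (ε (b i))) * s i + w := by
    simp only [sub_mul, Finset.sum_sub_distrib]; ring
  rw [this]
  refine add_mem (sum_mem fun i _ ↦ ?_) hw
  rw [pow_two]
  refine Ideal.mul_mem_mul ?_ (hs i)
  rw [RingHom.mem_ker, map_sub, AlgHom.commutes]
  exact sub_self _

/-- Functions vanishing to order `k` agree to first order with homogeneous polynomials. -/
lemma exists_homogeneous (hgen : RingHom.ker ε ≤ Ideal.span (Set.range s) ⊔ RingHom.ker ε ^ 2)
    (hs : ∀ i, ε (s i) = 0) {k : ℕ} {a : A} (ha : a ∈ RingHom.ker ε ^ k) :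
    ∃ p : Poly n, p.IsHomogeneous k ∧ a - aeval s p ∈ RingHom.ker ε ^ (k + 1) := by
  induction k generalizing a with
  | zero =>
    refine ⟨C (ε a), isHomogeneous_C _ _, ?_⟩
    rw [zero_add, pow_one, RingHom.mem_ker, map_sub, aeval_C, AlgHom.commutes]
    exact sub_self _
  | succ k ih =>
    have hsp {p : Poly n} {k} (hp : p.IsHomogeneous k) : aeval s p ∈ RingHom.ker ε ^ k := by
      rw [p.as_sum, map_sum]
      refine sum_mem fun d hd ↦ ?_
      rw [aeval_monomial]
      refine Ideal.mul_mem_left _ _ ?_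
      have hdeg : d.degree = k := by
        rw [Finsupp.degree_eq_weight_one]
        exact hp (mem_support_iff.mp hd)
      rw [← hdeg, Finsupp.degree_apply, Finsupp.prod, ← Finset.prod_pow_eq_pow_sum]
      exact Ideal.prod_mem_prod fun i _ ↦ Ideal.pow_mem_pow (hs i) _
    rw [pow_succ] at ha
    refine Submodule.mul_induction_on ha (fun x hx y hy ↦ ?_) ?_
    · obtain ⟨p, hp, hpx⟩ := ih hx
      obtain ⟨c, hc⟩ := exists_linear_form hgen hs hy
      have hl : (∑ i, C (c i) * X i : Poly n).IsHomogeneous 1 :=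
        IsHomogeneous.sum _ _ _ fun i _ ↦ isHomogeneous_C_mul_X _ _
      have hly : y - aeval s (∑ i, C (c i) * X i : Poly n) ∈ RingHom.ker ε ^ 2 := by
        simpa using hc
      refine ⟨_, hp.mul hl, ?_⟩
      rw [map_mul, show x * y - aeval s p * aeval s (∑ i, C (c i) * X i : Poly n) =
        (x - aeval s p) * y + aeval s p * (y - aeval s (∑ i, C (c i) * X i : Poly n)) by ring]
      refine add_mem ?_ ?_
      · rw [pow_succ]
        exact Ideal.mul_mem_mul hpx hy
      · rw [add_assoc, pow_add]
        exact Ideal.mul_mem_mul (hsp hp) hly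
    · rintro x y ⟨p, hp, hpx⟩ ⟨q, hq, hqy⟩
      refine ⟨p + q, hp.add hq, ?_⟩
      rw [map_add, add_sub_add_comm]
      exact add_mem hpx hqy

/-- If `s` are the coordinates for `ψ`, the order of vanishing can be read off from `ψ`. -/
lemma mem_pow_of_isBigO (hgen : RingHom.ker ε ≤ Ideal.span (Set.range s) ⊔ RingHom.ker ε ^ 2)
    (hs : ∀ i, ε (s i) = 0) (ψ : A →ₐ[ℂ] HolGerm n) (hψ : ∀ i, ψ (s i) = coord i)
    (hε : ∀ a, HolGerm.eval (ψ a) = ε a) {k : ℕ} {a : A}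
    (ha : rep (ψ a) =O[𝓝 0] fun z : Fin n → ℂ ↦ ‖z‖ ^ k) : a ∈ RingHom.ker ε ^ k := by
  suffices ∀ j ≤ k, a ∈ RingHom.ker ε ^ j from this k le_rfl
  -- The order is raised one step at a time: the homogeneous leading part p of degree j has germ of
  -- order at least j + 1, hence p = 0.
  intro j
  induction j with
  | zero => simp
  | succ j ih =>
    intro hj
    obtain ⟨p, hp, hpa⟩ := exists_homogeneous hgen hs (ih (by lia))
    have hmem {b : A} {l : ℕ} (hb : b ∈ RingHom.ker ε ^ l) : ψ b ∈ maxIdeal n ^ l := by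
      have h1 : (RingHom.ker ε ^ l).map ψ ≤ maxIdeal n ^ l := by
        rw [Ideal.map_pow]
        refine Ideal.pow_right_mono (Ideal.map_le_iff_le_comap.mpr fun c hc ↦ ?_) l
        rw [Ideal.mem_comap, mem_maxIdeal_iff, hε]
        exact hc
      exact h1 (Ideal.mem_map_of_mem _ hb)
    have h1 := rep_isBigO_pow (hmem hpa)
    have h2 : ψ (aeval s p) = aeval coord p := by
      rw [← AlgHom.comp_apply, comp_aeval]
      congr 2
      ext1 i
      exact hψ i
    rw [map_sub, h2] at h1
    have h3 : (fun z ↦ MvPolynomial.eval z p) =O[𝓝 0] fun z : Fin n → ℂ ↦ ‖z‖ ^ (j + 1) := by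
      have h4 : rep (ψ a) =O[𝓝 0] fun z : Fin n → ℂ ↦ ‖z‖ ^ (j + 1) := by
        refine ha.trans (IsBigO.of_bound 1 ?_)
        filter_upwards [Metric.ball_mem_nhds (0 : Fin n → ℂ) one_pos] with z hz
        rw [mem_ball_zero_iff] at hz
        rw [one_mul, norm_pow, norm_pow, norm_norm]
        exact pow_le_pow_of_le_one (norm_nonneg z) hz.le hj
      refine (h4.sub h1).congr' ?_ .rfl
      filter_upwards [rep_sub (ψ a) (aeval coord p), rep_aeval_coord p] with z h5 h6
      rw [h5, Pi.sub_apply, h6]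
      ring
    have h4 : p = 0 := by
      refine MvPolynomial.funext fun z ↦ ?_
      rw [map_zero]
      refine eq_zero_of_homogeneous_of_isBigO (fun c w ↦ ?_) h3 z
      rw [eval_eq', eval_eq', Finset.mul_sum]
      refine Finset.sum_congr rfl fun d hd ↦ ?_
      have hdeg : d.degree = j := by
        rw [Finsupp.degree_eq_weight_one]
        exact hp (mem_support_iff.mp hd)
      rw [Finsupp.degree_eq_sum] at hdeg
      simp only [Pi.smul_apply, smul_eq_mul, mul_pow, Finset.prod_mul_distrib]
      rw [Finset.prod_pow_eq_pow_sum, hdeg]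
      ring
    rw [h4, map_zero, sub_zero] at hpa
    exact hpa

namespace HolGerm

lemma mem_maxIdeal_pow_iff {k : ℕ} {θ : HolGerm n} :
    θ ∈ maxIdeal n ^ k ↔ rep θ =O[𝓝 0] fun z : Fin n → ℂ ↦ ‖z‖ ^ k := by
  refine ⟨rep_isBigO_pow, fun h ↦ ?_⟩
  rw [← ker_evalₐ]
  refine mem_pow_of_isBigO (s := coord) ?_ (fun _ ↦ rfl) (AlgHom.id ℂ _) (fun _ ↦ rfl)
    (fun _ ↦ rfl) h
  rw [ker_evalₐ]
  exact le_sup_left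

lemma exists_linear_form {θ : HolGerm n} (h : θ ∈ maxIdeal n) :
    ∃ c : Fin n → ℂ, θ - ∑ i, algebraMap ℂ _ (c i) * coord i ∈ maxIdeal n ^ 2 := by
  rw [← ker_evalₐ]
  refine QuadraticPoints.exists_linear_form (ε := evalₐ) ?_ (fun _ ↦ rfl) (mem_maxIdeal_iff.mp h)
  rw [ker_evalₐ]
  exact le_sup_left

end HolGerm

lemma eval_eq_of_map_ker_le {φ : A →ₐ[ℂ] HolGerm n} (h : (RingHom.ker ε).map φ ≤ maxIdeal n) (a : A) :
    HolGerm.eval (φ a) = ε a := by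
  have h1 : a - algebraMap ℂ A (ε a) ∈ RingHom.ker ε := by
    rw [RingHom.mem_ker, map_sub, AlgHom.commutes]
    exact sub_self _
  have h2 := mem_maxIdeal_iff.mp (h (Ideal.mem_map_of_mem φ h1))
  rw [map_sub, AlgHom.commutes, map_sub, sub_eq_zero] at h2
  exact h2

lemma span_range_eq_maxIdeal (hgen : RingHom.ker ε ≤ Ideal.span (Set.range s) ⊔ RingHom.ker ε ^ 2)
    (hs : ∀ i, ε (s i) = 0) {φ : A →ₐ[ℂ] HolGerm n} (h : (RingHom.ker ε).map φ = maxIdeal n) :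
    Ideal.span (Set.range fun i ↦ φ (s i)) = maxIdeal n := by
  have h0 : (Ideal.span (Set.range s)).map φ = Ideal.span (Set.range fun i ↦ φ (s i)) := by
    rw [Ideal.map_span, ← Set.range_comp]; rfl
  apply le_antisymm
  · rw [← h0, ← h]
    refine Ideal.map_mono (Ideal.span_le.mpr ?_)
    rintro _ ⟨i, rfl⟩
    exact hs i
  · refine Submodule.le_of_le_smul_of_le_jacobson_bot (I := maxIdeal n) ?_ maxIdeal_le_jacobson ?_
    · exact Submodule.fg_span (Set.finite_range _)
    · have := Ideal.map_mono (f := φ) hgen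
      rw [h, Ideal.map_sup, Ideal.map_pow, h, h0, pow_two] at this
      exact this

/-- Analytic coordinates can be chosen to restrict to given regular parameters. -/
lemma exists_normalization (hgen : RingHom.ker ε ≤ Ideal.span (Set.range s) ⊔ RingHom.ker ε ^ 2)
    (hs : ∀ i, ε (s i) = 0) {φ : A →ₐ[ℂ] HolGerm n} (h : (RingHom.ker ε).map φ = maxIdeal n) :
    ∃ σ : HolGerm n →ₐ[ℂ] HolGerm n, ∀ i, σ (φ (s i)) = coord i := by
  obtain ⟨G, hG, hG0, h1⟩ := exists_inverse (span_range_eq_maxIdeal hgen hs h)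
  exact ⟨⟨pullback G hG hG0, fun _ ↦ rfl⟩, h1⟩

/-- Passing to holomorphic germs loses no jets; after normalizing the coordinates to s, the order of
vanishing is read off from growth. -/
lemma comap_maxIdeal_pow_le (hgen : RingHom.ker ε ≤ Ideal.span (Set.range s) ⊔ RingHom.ker ε ^ 2)
    (hs : ∀ i, ε (s i) = 0) {φ : A →ₐ[ℂ] HolGerm n} (h : (RingHom.ker ε).map φ = maxIdeal n)
    {k : ℕ} {a : A} (ha : φ a ∈ maxIdeal n ^ k) : a ∈ RingHom.ker ε ^ k := by
  obtain ⟨σ, hσ⟩ := exists_normalization hgen hs h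
  refine mem_pow_of_isBigO hgen hs (σ.comp φ) hσ (fun b ↦ ?_)
    (rep_isBigO_pow (algHom_mem_maxIdeal_pow σ ha))
  rw [AlgHom.comp_apply, eval_algHom, eval_eq_of_map_ker_le h.le]

/-- Holomorphic germs are approximated by regular functions. -/
lemma exists_sub_mem_maxIdeal_pow {φ : A →ₐ[ℂ] HolGerm n}
    (h : (RingHom.ker ε).map φ = maxIdeal n) (k : ℕ) (θ : HolGerm n) :
    ∃ a : A, θ - φ a ∈ maxIdeal n ^ k := by
  induction k generalizing θ with
  | zero => exact ⟨0, by simp⟩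
  | succ k ih =>
    obtain ⟨a, ha⟩ := ih θ
    suffices ∀ η ∈ maxIdeal n ^ k, ∃ b ∈ RingHom.ker ε ^ k, η - φ b ∈ maxIdeal n ^ (k + 1) by
      obtain ⟨b, -, hb⟩ := this _ ha
      exact ⟨a + b, by rwa [map_add, ← sub_sub]⟩
    intro η hη
    have h' : Ideal.map φ (RingHom.ker ε ^ k) = maxIdeal n ^ k := by rw [Ideal.map_pow, h]
    rw [← h'] at hη
    refine Submodule.span_induction
      (p := fun η _ ↦ ∃ b ∈ RingHom.ker ε ^ k, η - φ b ∈ maxIdeal n ^ (k + 1)) ?_ ?_ ?_ ?_ hη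
    · rintro _ ⟨b, hb, rfl⟩
      exact ⟨b, hb, by simp⟩
    · exact ⟨0, zero_mem _, by simp⟩
    · rintro x y - - ⟨b, hb, hbx⟩ ⟨c, hc, hcy⟩
      refine ⟨b + c, add_mem hb hc, ?_⟩
      rw [map_add, add_sub_add_comm]
      exact add_mem hbx hcy
    · rintro η x hx ⟨b, hb, hbx⟩
      refine ⟨algebraMap ℂ A (HolGerm.eval η) * b, Ideal.mul_mem_left _ _ hb, ?_⟩
      rw [map_mul, AlgHom.commutes, smul_eq_mul, algebraMap_apply,
        show η * x - const (HolGerm.eval η) * φ b = (η - const (HolGerm.eval η)) * x +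
          const (HolGerm.eval η) * (x - φ b) by ring]
      refine add_mem ?_ (Ideal.mul_mem_left _ _ hbx)
      rw [pow_succ']
      exact Ideal.mul_mem_mul (sub_const_eval_mem η) (h' ▸ hx)

/-- An ideal that generates a principal ideal of holomorphic germs is locally principal. -/
lemma exists_dvd_of_map_eq_span [IsNoetherianRing A]
    (hgen : RingHom.ker ε ≤ Ideal.span (Set.range s) ⊔ RingHom.ker ε ^ 2)
    (hs : ∀ i, ε (s i) = 0) {φ : A →ₐ[ℂ] HolGerm n} (h : (RingHom.ker ε).map φ = maxIdeal n)
    {J : Ideal A} {θ : HolGerm n} (hJ : J.map φ = Ideal.span {θ}) :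
    ∃ f ∈ J, ∀ b ∈ J, ∃ u, ε u ≠ 0 ∧ f ∣ u * b := by
  -- If every element of J were a non-unit multiple of θ, Nakayama would give θ = 0, and then 0 in J
  -- would already generate.
  have h1 : ∃ f ∈ J, θ ∈ Ideal.span {φ f} := by
    by_contra! hf
    have h2 : Ideal.span {θ} ≤ Ideal.span (∅ : Set (HolGerm n)) ⊔ maxIdeal n • Ideal.span {θ} := by
      refine le_trans ?_ le_sup_right
      rw [← hJ, Ideal.map_le_iff_le_comap]
      intro f hfJ
      have h3 : φ f ∈ Ideal.span {θ} := hJ ▸ Ideal.mem_map_of_mem φ hfJ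
      obtain ⟨c, hc⟩ := Ideal.mem_span_singleton'.mp h3
      have hc0 : c ∈ maxIdeal n := by
        rw [mem_maxIdeal_iff]
        by_contra hc0
        refine hf f hfJ ?_
        rw [← hc, Ideal.span_singleton_mul_left_unit (isUnit_of_eval_ne_zero hc0)]
        exact Ideal.mem_span_singleton_self θ
      rw [Ideal.mem_comap, hJ, ← hc]
      exact Ideal.mul_mem_mul hc0 (Ideal.mem_span_singleton_self θ)
    have h3 := Submodule.le_of_le_smul_of_le_jacobson_bot (Submodule.fg_span_singleton θ)
      maxIdeal_le_jacobson h2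
    refine hf 0 (zero_mem _) ?_
    have h4 := h3 (Ideal.mem_span_singleton_self θ)
    rw [Ideal.span_empty, Ideal.mem_bot] at h4
    rw [h4]
    exact zero_mem _
  obtain ⟨f, hf, hθ⟩ := h1
  refine ⟨f, hf, fun b hb ↦ ?_⟩
  have h2 : φ b ∈ Ideal.span {φ f} := by
    have : φ b ∈ Ideal.span {θ} := hJ ▸ Ideal.mem_map_of_mem φ hb
    exact (Ideal.span_singleton_le_iff_mem _).mpr hθ this
  obtain ⟨η, hη⟩ := Ideal.mem_span_singleton'.mp h2
  -- The holomorphic quotient η is replaced by a regular function a up to order k. So b lies in (f)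
  -- + m^k for all k, and Krull's intersection theorem gives (1 - r) b ∈ (f) for some r in m.
  have h3 (k : ℕ) : ∃ a, b - a * f ∈ RingHom.ker ε ^ k := by
    obtain ⟨a, ha⟩ := exists_sub_mem_maxIdeal_pow h k η
    refine ⟨a, comap_maxIdeal_pow_le hgen hs h ?_⟩
    rw [map_sub, map_mul, ← hη, ← sub_mul]
    exact Ideal.mul_mem_right _ _ ha
  let Q := A ⧸ Ideal.span {f}
  have h4 : (Ideal.Quotient.mk _ b : Q) ∈ (⨅ i : ℕ, (RingHom.ker ε) ^ i • ⊤ : Submodule A Q) := by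
    rw [Submodule.mem_iInf]
    intro k
    obtain ⟨a, ha⟩ := h3 k
    have h5 : (Ideal.Quotient.mk _ b : Q) = (b - a * f) • (1 : Q) := by
      rw [Algebra.smul_def, mul_one]
      change _ = Ideal.Quotient.mk _ (b - a * f)
      rw [Ideal.Quotient.eq, sub_sub_cancel]
      exact Ideal.mul_mem_left _ _ (Ideal.mem_span_singleton_self f)
    rw [h5]
    exact Submodule.smul_mem_smul ha trivial
  obtain ⟨r, hr⟩ := (Ideal.mem_iInf_smul_pow_eq_bot_iff _ _).mp h4
  refine ⟨1 - r, ?_, ?_⟩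
  · rw [map_sub, map_one, (RingHom.mem_ker (f := ε)).mp r.2, sub_zero]
    exact one_ne_zero
  · rw [← Ideal.mem_span_singleton, ← Ideal.Quotient.eq_zero_iff_mem, sub_mul, one_mul, map_sub,
      sub_eq_zero]
    exact hr.symm

end Jets

end

section

open MvPolynomial Matrix

/-! ### Quadratic singularities in terms of germs -/

namespace HolGerm

variable {n m : ℕ}

/-- The germ of a quadratic form. -/
def quad (M : Matrix (Fin n) (Fin n) ℂ) : HolGerm n :=
  coord ⬝ᵥ (M.map (algebraMap ℂ (HolGerm n))).mulVec coord

lemma quad_eq (M : Matrix (Fin n) (Fin n) ℂ) :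
    quad M = ∑ i, ∑ j, algebraMap ℂ (HolGerm n) (M i j) * coord i * coord j := by
  simp only [quad, dotProduct, mulVec, Finset.mul_sum, map_apply]
  exact Finset.sum_congr rfl fun i _ ↦ Finset.sum_congr rfl fun j _ ↦ by ring

lemma rep_quad (M : Matrix (Fin n) (Fin n) ℂ) :
    rep (quad M) =ᶠ[𝓝 0] fun z ↦ z ⬝ᵥ M.mulVec z := by
  have h : quad M = aeval coord (∑ i, ∑ j, C (M i j) * X i * X j : Poly n) := by
    rw [quad_eq]
    simp only [map_sum, map_mul, aeval_X, algHom_C]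
  rw [h]
  filter_upwards [rep_aeval_coord (∑ i, ∑ j, C (M i j) * X i * X j : Poly n)] with z hz
  rw [hz]
  simp only [map_sum, map_mul, eval_X, eval_C, dotProduct, mulVec, Finset.mul_sum]
  exact Finset.sum_congr rfl fun i _ ↦ Finset.sum_congr rfl fun j _ ↦ by ring

lemma quad_injective {M N : Matrix (Fin n) (Fin n) ℂ} (hM : M.IsSymm) (hN : N.IsSymm)
    (h : quad M - quad N ∈ maxIdeal n ^ 3) : M = N := by
  refine matrix_eq_of_isBigO hM hN ((rep_isBigO_pow h).congr' ?_ .rfl)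
  filter_upwards [rep_sub (quad M) (quad N), rep_quad M, rep_quad N] with z h1 h2 h3
  rw [h1, Pi.sub_apply, h2, h3]

lemma exists_quad {θ : HolGerm n} (h : θ ∈ maxIdeal n ^ 2) :
    ∃ M : Matrix (Fin n) (Fin n) ℂ, M.IsSymm ∧ θ - quad M ∈ maxIdeal n ^ 3 := by
  have key : ∃ M : Matrix (Fin n) (Fin n) ℂ, θ - quad M ∈ maxIdeal n ^ 3 := by
    rw [pow_two] at h
    refine Submodule.mul_induction_on h (fun a ha b hb ↦ ?_) ?_
    · obtain ⟨c, hc⟩ := exists_linear_form ha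
      obtain ⟨d, hd⟩ := exists_linear_form hb
      refine ⟨vecMulVec c d, ?_⟩
      have h1 : quad (vecMulVec c d) = (∑ i, algebraMap ℂ _ (c i) * coord i) *
          ∑ i, algebraMap ℂ _ (d i) * coord i := by
        rw [quad_eq, Finset.sum_mul_sum]
        refine Finset.sum_congr rfl fun i _ ↦ Finset.sum_congr rfl fun j _ ↦ ?_
        rw [vecMulVec_apply, map_mul]
        ring
      set x := ∑ i, algebraMap ℂ (HolGerm n) (c i) * coord i
      set y := ∑ i, algebraMap ℂ (HolGerm n) (d i) * coord i
      have hx : x ∈ maxIdeal n := sum_mem fun i _ ↦ Ideal.mul_mem_left _ _ (coord_mem i)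
      rw [h1, show a * b - x * y = (a - x) * b + x * (b - y) by ring]
      refine add_mem ?_ ?_
      · rw [pow_succ]
        exact Ideal.mul_mem_mul hc hb
      · rw [pow_succ']
        exact Ideal.mul_mem_mul hx hd
    · rintro a b ⟨M, hM⟩ ⟨N, hN⟩
      refine ⟨M + N, ?_⟩
      have : quad (M + N) = quad M + quad N := by
        simp only [quad_eq, ← Finset.sum_add_distrib]
        refine Finset.sum_congr rfl fun i _ ↦ Finset.sum_congr rfl fun j _ ↦ ?_
        rw [Matrix.add_apply, map_add]
        ring
      rw [this, add_sub_add_comm]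
      exact add_mem hM hN
  obtain ⟨M, hM⟩ := key
  -- Symmetrizing the matrix does not change the quadratic form.
  refine ⟨(2 : ℂ)⁻¹ • (M + Mᵀ), ?_, ?_⟩
  · rw [IsSymm, transpose_smul, transpose_add, transpose_transpose, add_comm]
  · have : quad ((2 : ℂ)⁻¹ • (M + Mᵀ)) = quad M := by
      rw [eq_iff]
      filter_upwards [rep_quad ((2 : ℂ)⁻¹ • (M + Mᵀ)), rep_quad M] with z h1 h2
      rw [h1, h2, smul_mulVec, dotProduct_smul, add_mulVec, dotProduct_add, mulVec_transpose,
        dotProduct_comm z (z ᵥ* M), ← dotProduct_mulVec, smul_eq_mul]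
      ring
    rwa [this]

/-- The rank of the quadratic part of a singularity is at most the rank of the coefficients in an
expression of second order. -/
lemma rank_le_rank_of_eq {M α : Matrix (Fin n) (Fin n) ℂ} (hM : M.IsSymm) (hα : α.IsSymm)
    {θ e : HolGerm n} (hθ : θ - quad M ∈ maxIdeal n ^ 3) (he : HolGerm.eval e ≠ 0)
    {T : Fin n → HolGerm n} (hT : ∀ i, T i ∈ maxIdeal n) {a : Fin n → Fin n → HolGerm n}
    (ha : ∀ i j, HolGerm.eval (a i j) = α i j) (h : e * θ = ∑ i, ∑ j, a i j * T i * T j) :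
    M.rank ≤ α.rank := by
  -- With L the matrix of linear parts of T, e θ has quadratic part LᵀαL. It also has quadratic part
  -- e(0)M, and e(0) ≠ 0.
  choose L hL using fun i ↦ exists_linear_form (hT i)
  let Lm : Matrix (Fin n) (Fin n) ℂ := Matrix.of L
  set l : Fin n → HolGerm n := fun i ↦ ∑ k, algebraMap ℂ _ (L i k) * coord k with hl
  have hlm (i) : l i ∈ maxIdeal n := sum_mem fun i _ ↦ Ideal.mul_mem_left _ _ (coord_mem i)
  have h1 : quad (Lmᵀ * α * Lm) = ∑ i, ∑ j, algebraMap ℂ _ (α i j) * l i * l j := by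
    have h2 : l = (Lm.map (algebraMap ℂ (HolGerm n))).mulVec coord := by
      ext1 i; rfl
    rw [quad, Matrix.map_mul, Matrix.map_mul, transpose_map, ← mulVec_mulVec, ← mulVec_mulVec,
      dotProduct_mulVec, vecMul_transpose, ← h2]
    simp only [dotProduct, mulVec, Finset.mul_sum, map_apply]
    exact Finset.sum_congr rfl fun i _ ↦ Finset.sum_congr rfl fun j _ ↦ by ring
  have h2 : e * θ - quad (Lmᵀ * α * Lm) ∈ maxIdeal n ^ 3 := by
    rw [h, h1, ← Finset.sum_sub_distrib]
    refine sum_mem fun i _ ↦ ?_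
    rw [← Finset.sum_sub_distrib]
    refine sum_mem fun j _ ↦ ?_
    rw [show a i j * T i * T j - algebraMap ℂ (HolGerm n) (α i j) * l i * l j =
      (a i j - const (α i j)) * (T i * T j) +
        const (α i j) * ((T i - l i) * T j + l i * (T j - l j)) by
      rw [algebraMap_apply]; ring]
    refine add_mem ?_ (Ideal.mul_mem_left _ _ (add_mem ?_ ?_))
    · rw [pow_succ', pow_two]
      refine Ideal.mul_mem_mul ?_ (Ideal.mul_mem_mul (hT i) (hT j))
      rw [← ha]
      exact sub_const_eval_mem _
    · rw [pow_succ]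
      exact Ideal.mul_mem_mul (hL i) (hT j)
    · rw [pow_succ']
      exact Ideal.mul_mem_mul (hlm i) (hL j)
  have hq : quad M ∈ maxIdeal n ^ 2 := by
    rw [quad_eq, pow_two]
    refine sum_mem fun i _ ↦ sum_mem fun j _ ↦ ?_
    rw [mul_assoc]
    exact Ideal.mul_mem_left _ _ (Ideal.mul_mem_mul (coord_mem i) (coord_mem j))
  have h3 : quad (HolGerm.eval e • M) - quad (Lmᵀ * α * Lm) ∈ maxIdeal n ^ 3 := by
    have h4 : quad (HolGerm.eval e • M) = const (HolGerm.eval e) * quad M := by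
      simp only [quad_eq, Finset.mul_sum]
      refine Finset.sum_congr rfl fun i _ ↦ Finset.sum_congr rfl fun j _ ↦ ?_
      rw [Matrix.smul_apply, smul_eq_mul, map_mul, ← algebraMap_apply]
      ring
    rw [h4, show const (HolGerm.eval e) * quad M - quad (Lmᵀ * α * Lm) =
      (e * θ - quad (Lmᵀ * α * Lm)) - e * (θ - quad M) - (e - const (HolGerm.eval e)) * quad M by
        ring]
    refine sub_mem (sub_mem h2 (Ideal.mul_mem_left _ _ hθ)) ?_
    rw [pow_succ']
    exact Ideal.mul_mem_mul (sub_const_eval_mem e) hq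
  have h4 := quad_injective (hM.smul _) (by
    rw [IsSymm, transpose_mul, transpose_mul, transpose_transpose, hα.eq, Matrix.mul_assoc]) h3
  calc M.rank = (HolGerm.eval e • M).rank :=
        (rank_smul_of_mem_nonZeroDivisors M (mem_nonZeroDivisors_of_ne_zero he)).symm
    _ = (Lmᵀ * α * Lm).rank := by rw [h4]
    _ ≤ (Lmᵀ * α).rank := rank_mul_le_left _ _
    _ ≤ α.rank := rank_mul_le_right _ _

end HolGerm

/-- The effect of blowing up on the rank of a quadratic form. -/
lemma rank_le_rank_of_isBigO {n : ℕ} {α H : Matrix (Fin n) (Fin n) ℂ} (hα : α.IsSymm)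
    (hH : H.IsSymm) {S : Finset (Fin n)} {k : Fin n} {c : Fin n → ℂ} (hck : c k = 1)
    (hαS : ∀ i j, j ∉ S → α i j = 0) {D : Matrix (Fin n) (Fin n) ℂ}
    (hD : D = diagonal fun i ↦ if i ∈ S ∧ i ≠ k then 1 else 0)
    (h : (fun z ↦ (c + D.mulVec z) ⬝ᵥ α.mulVec (c + D.mulVec z) -
      D.mulVec z ⬝ᵥ H.mulVec (D.mulVec z)) =O[𝓝 0] fun z : Fin n → ℂ ↦ ‖z‖ ^ 3) :
    α.rank ≤ H.rank := by
  have hDz (z : Fin n → ℂ) (i : Fin n) :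
      D.mulVec z i = if i ∈ S ∧ i ≠ k then z i else 0 := by
    rw [hD, mulVec_diagonal, ite_mul, one_mul, zero_mul]
  have hDT : Dᵀ = D := by rw [hD, diagonal_transpose]
  have hsymm (x y : Fin n → ℂ) : x ⬝ᵥ α.mulVec y = y ⬝ᵥ α.mulVec x := by
    rw [dotProduct_mulVec, ← mulVec_transpose, hα.eq, dotProduct_comm]
  have hsplit (z : Fin n → ℂ) : (c + D.mulVec z) ⬝ᵥ α.mulVec (c + D.mulVec z) -
      D.mulVec z ⬝ᵥ H.mulVec (D.mulVec z) = c ⬝ᵥ α.mulVec c + 2 * (D.mulVec z ⬝ᵥ α.mulVec c) +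
        (z ⬝ᵥ (D * α * D).mulVec z - z ⬝ᵥ (D * H * D).mulVec z) := by
    have hD2 (M : Matrix (Fin n) (Fin n) ℂ) : z ⬝ᵥ (D * M * D).mulVec z =
        D.mulVec z ⬝ᵥ M.mulVec (D.mulVec z) := by
      rw [← mulVec_mulVec, ← mulVec_mulVec, dotProduct_mulVec, ← mulVec_transpose, hDT]
    rw [hD2, hD2, mulVec_add, dotProduct_add, add_dotProduct, add_dotProduct,
      hsymm c (D.mulVec z)]
    ring
  -- On the line x ↦ x z the expression is p + 2xq + x²w = O(x³), which forces the constant and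
  -- linear terms to vanish.
  have hline (z : Fin n → ℂ) : c ⬝ᵥ α.mulVec c = 0 ∧ D.mulVec z ⬝ᵥ α.mulVec c = 0 := by
    have ht : Filter.Tendsto (fun x : ℂ ↦ x • z) (𝓝 0) (𝓝 0) := by
      have : Filter.Tendsto (fun x : ℂ ↦ x • z) (𝓝 0) (𝓝 ((0 : ℂ) • z)) :=
        (continuous_id.smul continuous_const).tendsto 0
      rwa [zero_smul] at this
    set p := c ⬝ᵥ α.mulVec c
    set q := D.mulVec z ⬝ᵥ α.mulVec c
    set w := z ⬝ᵥ (D * α * D).mulVec z - z ⬝ᵥ (D * H * D).mulVec z with hw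
    have h1 : (fun x : ℂ ↦ p + 2 * (x * q) + x ^ 2 * w) =O[𝓝 0] fun x : ℂ ↦ ‖x‖ ^ 3 := by
      refine ((h.comp_tendsto ht).congr_left fun x ↦ ?_).trans
        (IsBigO.of_bound (‖z‖ ^ 3) (.of_forall fun x ↦ ?_))
      · simp only [Function.comp_apply]
        rw [hsplit, mulVec_smul, smul_dotProduct, mulVec_smul, dotProduct_smul, smul_dotProduct,
          mulVec_smul, dotProduct_smul, smul_dotProduct, hw]
        simp only [smul_eq_mul]
        ring
      · simp [norm_smul, mul_pow, mul_comm]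
    have hpow {a b : ℕ} (hab : a ≤ b) : (fun x : ℂ ↦ ‖x‖ ^ b) =O[𝓝 0] fun x : ℂ ↦ ‖x‖ ^ a := by
      refine IsBigO.of_bound 1 ?_
      filter_upwards [Metric.ball_mem_nhds (0 : ℂ) one_pos] with x hx
      rw [mem_ball_zero_iff] at hx
      rw [one_mul, norm_pow, norm_pow, norm_norm]
      exact pow_le_pow_of_le_one (norm_nonneg x) hx.le hab
    have hmul (a : ℕ) (y : ℂ) : (fun x : ℂ ↦ x ^ a * y) =O[𝓝 0] fun x : ℂ ↦ ‖x‖ ^ a :=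
      IsBigO.of_bound ‖y‖ (.of_forall fun x ↦ by simp [mul_comm])
    have hp : p = 0 := by
      refine eq_zero_of_homogeneous_of_isBigO (E := ℂ) (h := fun _ ↦ p) (k := 0) (by simp) ?_ 0
      have h2 := ((h1.trans (hpow (a := 1) (by norm_num))).sub (hmul 1 (2 * q))).sub
        ((hmul 2 w).trans (hpow one_le_two))
      refine h2.congr_left fun x ↦ ?_
      ring
    refine ⟨hp, ?_⟩
    have hq : (fun x : ℂ ↦ x * q) 1 = 0 := by
      refine eq_zero_of_homogeneous_of_isBigO (E := ℂ) (h := fun x ↦ x * q) (k := 1)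
        (fun a b ↦ by simp only [smul_eq_mul]; ring) ?_ 1
      have h2 := (h1.trans (hpow (a := 2) (by norm_num))).sub (hmul 2 w)
      refine (h2.const_mul_left (2⁻¹ : ℂ)).congr_left fun x ↦ ?_
      rw [hp]
      ring
    simpa using hq
  have hα0 (j : Fin n) (hj : j ∉ S) (y : Fin n → ℂ) : α.mulVec y j = 0 := by
    simp only [mulVec, dotProduct]
    refine Finset.sum_eq_zero fun i _ ↦ ?_
    rw [← hα.apply, hαS i j hj, zero_mul]
  -- Components in the fibre directions vanish by the linear term and those outside S by support.
  -- The k-th one is left alone in cᵀαc = 0, where c_k = 1.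
  have hαc : α.mulVec c = 0 := by
    have h1 (i : Fin n) (hik : i ≠ k) : α.mulVec c i = 0 := by
      by_cases hi : i ∈ S
      · have h2 := (hline (Pi.single i 1)).2
        have h3 : D.mulVec (Pi.single i 1) = Pi.single i 1 := by
          ext j
          rw [hDz]
          by_cases hij : j = i
          · subst hij; rw [if_pos ⟨hi, hik⟩]
          · simp [hij]
        rwa [h3, single_dotProduct, one_mul] at h2
      · exact hα0 i hi c
    ext i
    by_cases hik : i = k
    · have h2 := (hline 0).1
      rw [dotProduct, Finset.sum_eq_single k (fun j _ hj ↦ by rw [h1 j hj, mul_zero])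
        (by simp), hck, one_mul] at h2
      rw [hik, h2]
      rfl
    · exact h1 i hik
  have hDD : D * α * D = D * H * D := by
    refine matrix_eq_of_isBigO ?_ ?_ (h.congr_left fun z ↦ ?_)
    · rw [IsSymm, transpose_mul, transpose_mul, hDT, hα.eq, Matrix.mul_assoc]
    · rw [IsSymm, transpose_mul, transpose_mul, hDT, hH.eq, Matrix.mul_assoc]
    · rw [hsplit, hαc, dotProduct_zero, dotProduct_zero]
      ring
  -- Q projects along c onto z_k = 0. Since α kills c and all directions outside S, inserting DQ
  -- after α changes nothing, and α = Qᵀ(DHD)Q.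
  let Q : Matrix (Fin n) (Fin n) ℂ := 1 - vecMulVec c (Pi.single k 1)
  have hαQ : α * D * Q = α := by
    have key (y : Fin n → ℂ) : α.mulVec (D.mulVec (Q.mulVec y)) = α.mulVec y := by
      have h1 : Q.mulVec y = y - y k • c := by
        rw [sub_mulVec, one_mulVec, vecMulVec_mulVec, single_dotProduct, one_mul]
        simp
      have h2 : α.mulVec (D.mulVec (Q.mulVec y)) = α.mulVec (Q.mulVec y) := by
        ext i
        rw [mulVec, mulVec, dotProduct, dotProduct]
        refine Finset.sum_congr rfl fun j _ ↦ ?_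
        by_cases hj : j ∈ S
        · rw [hDz]
          by_cases hjk : j = k
          · rw [if_neg (by simp [hjk]), h1, hjk]
            simp [hck]
          · rw [if_pos ⟨hj, hjk⟩]
        · rw [hαS i j hj, zero_mul, zero_mul]
      rw [h2, h1, mulVec_sub, mulVec_smul, hαc, smul_zero, sub_zero]
    ext i j
    have := congr_fun (key (Pi.single j 1)) i
    rw [mulVec_mulVec, mulVec_mulVec] at this
    simpa using this
  have hfin : α = Qᵀ * (D * H * D) * Q := by
    have h1 : Qᵀ * (D * α) = α := by
      have := congr(($hαQ)ᵀ)
      rwa [transpose_mul, transpose_mul, hDT, hα.eq] at this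
    rw [← hDD]
    conv_lhs => rw [← h1, ← hαQ]
    simp only [Matrix.mul_assoc]
  rw [hfin]
  refine (rank_mul_le_left _ _).trans ((rank_mul_le_right _ _).trans
    ((rank_mul_le_left _ _).trans (rank_mul_le_right _ _)))

end

/-! ### Quadratic points at ℂ-points of affine charts. -/

section

open MvPolynomial Matrix HolGerm

/-- The subscheme defined by `J` has a quadratic point of rank `r` at the point `ε`. -/
def IsQuadraticAt {A : Type*} [CommRing A] [Algebra ℂ A] (J : Ideal A) (ε : A →ₐ[ℂ] ℂ)
    (n r : ℕ) : Prop :=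
  ∃ φ : A →ₐ[ℂ] HolGerm n, (RingHom.ker ε).map φ = maxIdeal n ∧
    ∃ M : Matrix (Fin n) (Fin n) ℂ, M.IsSymm ∧ M.rank = r ∧
      ∃ θ : HolGerm n, θ - quad M ∈ maxIdeal n ^ 3 ∧ J.map φ = Ideal.span {θ}

/-- The hypersurface `f = 0` is smooth or has a quadratic point of rank at least `r` at each of its
points. -/
def HasQuadraticPoints {A : Type*} [CommRing A] [Algebra ℂ A] (f : A) (n r : ℕ) : Prop :=
  ∀ ε : A →ₐ[ℂ] ℂ, ε f = 0 → f ∉ RingHom.ker ε ^ 2 ∨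
    ∃ r', r ≤ r' ∧ IsQuadraticAt (Ideal.span {f}) ε n r'

/-- If the multiplier e vanishes at 0, then 1 - d e is a unit killing θ, both germs are zero, and
the multiplier may be taken to be 1. -/
lemma HolGerm.exists_mul_eq_of_span_eq {n : ℕ} {x θ : HolGerm n}
    (h : Ideal.span {x} = Ideal.span {θ}) : ∃ e, HolGerm.eval e ≠ 0 ∧ e * θ = x := by
  obtain ⟨e, he⟩ := Ideal.mem_span_singleton'.mp (h ▸ Ideal.mem_span_singleton_self x)
  obtain ⟨d, hd⟩ := Ideal.mem_span_singleton'.mp (h.symm ▸ Ideal.mem_span_singleton_self θ)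
  by_cases h0 : HolGerm.eval e = 0
  · have h1 : IsUnit (1 - d * e) := by
      rw [isUnit_iff, map_sub, map_mul, h0, mul_zero, map_one, sub_zero]
      exact one_ne_zero
    have h2 : (1 - d * e) * θ = 0 := by
      rw [sub_mul, one_mul, mul_assoc, he, hd, sub_self]
    have h3 : θ = 0 := (h1.mul_right_eq_zero).mp h2
    refine ⟨1, by rw [map_one]; exact one_ne_zero, ?_⟩
    rw [← he, h3, mul_zero, mul_zero]
  · exact ⟨e, h0, he⟩

lemma HolGerm.rep_bilin {n : ℕ} (M : Matrix (Fin n) (Fin n) ℂ) (w : Fin n → HolGerm n) :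
    rep (∑ i, ∑ j, algebraMap ℂ (HolGerm n) (M i j) * w i * w j) =ᶠ[𝓝 0]
      fun z ↦ (fun i ↦ rep (w i) z) ⬝ᵥ M.mulVec (fun i ↦ rep (w i) z) := by
  have h1 (i j) : rep (algebraMap ℂ (HolGerm n) (M i j) * w i * w j) =ᶠ[𝓝 0]
      fun z ↦ M i j * rep (w i) z * rep (w j) z := by
    filter_upwards [rep_mul (algebraMap ℂ (HolGerm n) (M i j) * w i) (w j),
      rep_mul (algebraMap ℂ (HolGerm n) (M i j)) (w i), rep_const (n := n) (M i j)] with z h1 h2 h3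
    rw [h1, Pi.mul_apply, h2, Pi.mul_apply, algebraMap_apply, h3]
  filter_upwards [rep_sum Finset.univ
    fun i ↦ ∑ j, algebraMap ℂ (HolGerm n) (M i j) * w i * w j,
    Filter.eventually_all.mpr fun i ↦ rep_sum Finset.univ
      fun j ↦ algebraMap ℂ (HolGerm n) (M i j) * w i * w j,
    Filter.eventually_all.mpr fun i ↦ Filter.eventually_all.mpr fun j ↦ h1 i j] with z h2 h3 h4
  rw [h2]
  simp only [dotProduct, mulVec, Finset.mul_sum]
  refine Finset.sum_congr rfl fun i _ ↦ ?_
  rw [h3]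
  refine Finset.sum_congr rfl fun j _ ↦ ?_
  rw [h4]
  ring

/-! ### The strict transform away from the exceptional divisor. -/

section Away

variable {n : ℕ} {A R : Type*} [CommRing A] [Algebra ℂ A] [CommRing R] [Algebra A R] [Algebra ℂ R]
  [IsScalarTower ℂ A R]

lemma mem_sq_of_mul_mem {A : Type*} [CommRing A] [Algebra ℂ A] {ε : A →ₐ[ℂ] ℂ} {u a : A}
    (hu : ε u ≠ 0) (h : u * a ∈ RingHom.ker ε ^ 2) : a ∈ RingHom.ker ε ^ 2 := by
  set w := 1 - algebraMap ℂ A (ε u)⁻¹ * u with hw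
  have hwm : w ∈ RingHom.ker ε := by
    rw [RingHom.mem_ker, map_sub, map_mul, AlgHom.commutes, map_one]
    change 1 - (ε u)⁻¹ * ε u = 0
    rw [inv_mul_cancel₀ hu, sub_self]
  -- This is 1 = w² + (1 + w)(1 - w) applied to a, where 1 - w is u divided by its value.
  rw [show a = w * w * a + algebraMap ℂ A (ε u)⁻¹ * (1 + w) * (u * a) by rw [hw]; ring]
  refine add_mem (Ideal.mul_mem_right _ _ ?_) (Ideal.mul_mem_left _ _ h)
  rw [pow_two]
  exact Ideal.mul_mem_mul hwm hwm

/-- Away from the exceptional divisor, the strict transform is isomorphic to the original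
hypersurface. -/
lemma IsBlowupChart.quadratic_of_ne_zero {I : Ideal A} {x : A} (h : IsBlowupChart I x R) {f : A}
    {F : R} {m r : ℕ} (hF : algebraMap A R f = algebraMap A R x ^ m * F)
    (hf : HasQuadraticPoints f n r) (ε : R →ₐ[ℂ] ℂ) (hx : ε (algebraMap A R x) ≠ 0)
    (hεF : ε F = 0) : F ∉ RingHom.ker ε ^ 2 ∨
      ∃ r', r ≤ r' ∧ IsQuadraticAt (Ideal.span {F}) ε n r' := by
  let y : A →ₐ[ℂ] ℂ := ε.comp (IsScalarTower.toAlgHom ℂ A R)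
  have hy (a : A) : y a = ε (algebraMap A R a) := rfl
  have hpow (N : ℕ) : y (x ^ N) ≠ 0 := by
    rw [map_pow]; exact pow_ne_zero N hx
  have hfrac {b : R} (hb : b ∈ RingHom.ker ε) :
      ∃ N, ∃ a ∈ RingHom.ker y, algebraMap A R x ^ N * b = algebraMap A R a := by
    obtain ⟨N, a, -, ha⟩ := h.exists_frac b
    refine ⟨N, a, ?_, ha⟩
    rw [RingHom.mem_ker, hy, ← ha, map_mul, (RingHom.mem_ker (f := ε)).mp hb, mul_zero]
  have hyf : y f = 0 := by rw [hy, hF, map_mul, hεF, mul_zero]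
  rcases hf y hyf with h1 | ⟨r', hr', φ, hφ, M, hM, hMr, θ, hθ, hJ⟩
  · refine Or.inl fun h2 ↦ h1 ?_
    -- A relation in the square of the maximal ideal descends to A after multiplication by a power
    -- of x, which does not vanish at the point.
    have h3 : ∀ b ∈ RingHom.ker ε ^ 2,
        ∃ N, ∃ a ∈ RingHom.ker y ^ 2, algebraMap A R x ^ N * b = algebraMap A R a := by
      intro b hb
      rw [pow_two] at hb
      refine Submodule.mul_induction_on hb (fun b hb c hc ↦ ?_) ?_
      · obtain ⟨N, a, ha, hab⟩ := hfrac hb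
        obtain ⟨N', a', ha', hab'⟩ := hfrac hc
        refine ⟨N + N', a * a', ?_, ?_⟩
        · rw [pow_two]; exact Ideal.mul_mem_mul ha ha'
        · rw [map_mul, ← hab, ← hab']; ring
      · rintro b c ⟨N, a, ha, hab⟩ ⟨N', a', ha', hab'⟩
        refine ⟨N + N', x ^ N' * a + x ^ N * a',
          add_mem (Ideal.mul_mem_left _ _ ha) (Ideal.mul_mem_left _ _ ha'), ?_⟩
        rw [map_add, map_mul, map_mul, ← hab, ← hab', map_pow, map_pow]
        ring
    obtain ⟨N, a, ha, hab⟩ := h3 F h2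
    have h4 : algebraMap A R (x ^ N * f - x ^ m * a) = 0 := by
      rw [map_sub, map_mul, map_mul, hF, ← hab, map_pow, map_pow]
      ring
    obtain ⟨N', hN'⟩ := h.eq_zero _ h4
    refine mem_sq_of_mul_mem (hpow (N' + N)) ?_
    rw [show x ^ (N' + N) * f = x ^ (N' + m) * a by
      rw [mul_sub, sub_eq_zero, ← mul_assoc, ← mul_assoc, ← pow_add, ← pow_add] at hN'
      exact hN']
    exact Ideal.mul_mem_left _ _ ha
  · refine Or.inr ⟨r', hr', ?_⟩
    have hφx : IsUnit (φ x) := by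
      rw [HolGerm.isUnit_iff, eval_eq_of_map_ker_le hφ.le]
      exact hx
    let := φ.toRingHom.toAlgebra
    -- As x becomes a unit among germs at y, the coordinates at y extend to the chart and serve at
    -- the point above.
    obtain ⟨g⟩ := h.exists_lift (C := HolGerm n) (IsUnit.mem_nonZeroDivisors hφx)
      (le_top.trans (Ideal.span_singleton_eq_top.mpr hφx).ge)
    have hg (a : A) : g (algebraMap A R a) = φ a := g.commutes a
    let φ' : R →ₐ[ℂ] HolGerm n := ⟨g.toRingHom, fun z ↦ by
      rw [IsScalarTower.algebraMap_apply ℂ A R]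
      exact (hg _).trans (φ.commutes z)⟩
    have hφ' (a : A) : φ' (algebraMap A R a) = φ a := hg a
    refine ⟨φ', le_antisymm ?_ ?_, M, hM, hMr, θ, hθ, ?_⟩
    · rw [Ideal.map_le_iff_le_comap]
      intro b hb
      obtain ⟨N, a, ha, hab⟩ := hfrac hb
      have h2 : φ x ^ N * φ' b ∈ maxIdeal n := by
        rw [← hφ', ← map_pow, ← map_mul, hab, hφ', ← hφ]
        exact Ideal.mem_map_of_mem _ ha
      rwa [Ideal.unit_mul_mem_iff_mem _ (hφx.pow N)] at h2
    · rw [← hφ, Ideal.map_le_iff_le_comap]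
      intro a ha
      rw [Ideal.mem_comap, ← hφ']
      exact Ideal.mem_map_of_mem _ ha
    · rw [← hJ, Ideal.map_span, Ideal.map_span, Set.image_singleton, Set.image_singleton, ← hφ', hF,
        map_mul, map_pow, hφ', Ideal.span_singleton_mul_left_unit (hφx.pow m)]

end Away

/-! ### Points of the exceptional divisor when f vanishes to first order. -/

section Exceptional

variable {n : ℕ} {A R : Type} [CommRing A] [Algebra (Poly n) A] [CommRing R] [Algebra A R]
  {S : Finset (Fin n)} {k : Fin n}

/-- A factorization into a power of the exceptional parameter and a factor prime to it is unique. -/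
lemma eq_of_pow_mul_eq {R : Type*} [CommRing R] {t F G : R} (ht : t ∈ nonZeroDivisors R) {m l : ℕ} (hF : ¬ t ∣ F)
    (hG : ¬ t ∣ G) (h : t ^ m * F = t ^ l * G) : F = G := by
  have key {F G : R} {m l : ℕ} (hF : ¬ t ∣ F) (h : t ^ m * F = t ^ l * G) (hml : m ≤ l) :
      F = G := by
    obtain ⟨d, rfl⟩ := Nat.exists_eq_add_of_le hml
    rw [pow_add, mul_assoc] at h
    have h1 := IsBlowupChart.mul_left_cancel_of_nzd ht h
    rcases d with _ | d
    · simpa using h1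
    · exact absurd ⟨t ^ d * G, by rw [h1, pow_succ']; ring⟩ hF
  rcases le_total m l with hml | hml
  · exact key hF h hml
  · exact (key hG h.symm hml).symm

variable (c : BlowupCoordinates S k A R)

/-- The values of the coordinates of the exceptional divisor. -/
def BlowupCoordinates.frac (i : Fin n) : R := if i = k then 1 else c.ψ (X i)

lemma BlowupCoordinates.mul_frac {i : Fin n} (hi : i ∈ S) :
    algebraMap A R (algebraMap (Poly n) A (X k)) * c.frac i =
      algebraMap A R (algebraMap (Poly n) A (X i)) := by
  by_cases hik : i = k
  · rw [frac, if_pos hik, mul_one, hik]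
  · rw [frac, if_neg hik, c.algebraMap_mul_ψ hi hik]

variable [Algebra ℂ A] [IsScalarTower ℂ (Poly n) A]

lemma algebraMap_C (z : ℂ) : algebraMap (Poly n) A (C z) = algebraMap ℂ A z := by
  rw [IsScalarTower.algebraMap_apply ℂ (Poly n) A, MvPolynomial.algebraMap_eq]

/-- The fibre of the exceptional divisor over a point of the centre is an affine space. -/
lemma BlowupCoordinates.exists_fiber_hom {D : Type} [CommRing D] [Algebra ℂ D] (y : A →ₐ[ℂ] ℂ)
    (hk : k ∈ S) (hy : ∀ i ∈ S, y (algebraMap (Poly n) A (X i)) = 0) (x : Fin n → D) :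
    ∃ η : R →+* D, (∀ a, η (algebraMap A R a) = algebraMap ℂ D (y a)) ∧
      ∀ i ∈ S, i ≠ k → η (c.ψ (X i)) = x i := by
  let g : A →+* D := (algebraMap ℂ D).comp y.toRingHom
  have hg (a) : g a = algebraMap ℂ D (y a) := rfl
  let h : Poly n →+* D := eval₂Hom (algebraMap ℂ D) fun i ↦
    if i ∈ S ∧ i ≠ k then x i else g (algebraMap (Poly n) A (X i))
  have hX (i) : h (X i) = if i ∈ S ∧ i ≠ k then x i else g (algebraMap (Poly n) A (X i)) := by
    simp only [h, eval₂Hom_X']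
  -- Over y both t_i and t_k u_i become zero for i in S, so the fibre coordinates u_i may take any
  -- values.
  have comm : g.comp (algebraMap (Poly n) A) = h.comp (blowupSubst S k).toRingHom := by
    refine MvPolynomial.ringHom_ext (fun z ↦ ?_) fun i ↦ ?_
    · have : g (algebraMap (Poly n) A (C z)) = algebraMap ℂ D z := by
        rw [algebraMap_C, hg, AlgHom.commutes]; rfl
      refine this.trans ?_
      simp [blowupSubst, h]
    · change g _ = h (blowupSubst S k (X i))
      by_cases hi : i ∈ S ∧ i ≠ k
      · rw [blowupSubst_X_of_mem S k hi, map_mul, hX k, if_neg (by simp), hg, hg, hy i hi.1,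
          hy k hk, map_zero, zero_mul]
      · rw [blowupSubst_X_of_not S k hi, hX, if_neg hi]
  obtain ⟨η, h1, h2⟩ := c.exists_lift g h fun p ↦ congr($comm p)
  refine ⟨η, fun a ↦ congr($h1 a), fun i hi hik ↦ ?_⟩
  have := congr($h2 (X i))
  rw [hX, if_pos ⟨hi, hik⟩] at this
  exact this

variable [Algebra ℂ R] [IsScalarTower ℂ A R]

include c in
/-- If `f` vanishes to first order along the centre, its strict transform is smooth along the
exceptional divisor. -/
lemma BlowupCoordinates.not_mem_sq_of_eq_sum (hk : k ∈ S)
    (ht : algebraMap A R (algebraMap (Poly n) A (X k)) ∈ nonZeroDivisors R) {f : A} {F : R} {m : ℕ}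
    (hF : algebraMap A R f = algebraMap A R (algebraMap (Poly n) A (X k)) ^ m * F)
    (hFt : ¬ algebraMap A R (algebraMap (Poly n) A (X k)) ∣ F) {b : Fin n → A}
    (hb : ∀ i ∉ S, b i = 0) (hb' : ∃ i ∈ S, IsUnit (b i))
    (hf : f = ∑ i, b i * algebraMap (Poly n) A (X i)) (ε : R →ₐ[ℂ] ℂ)
    (hε : ε (algebraMap A R (algebraMap (Poly n) A (X k))) = 0) : F ∉ RingHom.ker ε ^ 2 := by
  let y : A →ₐ[ℂ] ℂ := ε.comp (IsScalarTower.toAlgHom ℂ A R)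
  have hy (a : A) : ε (algebraMap A R a) = y a := rfl
  have hyS : ∀ i ∈ S, y (algebraMap (Poly n) A (X i)) = 0 := by
    intro i hi
    rw [← hy, ← c.mul_frac hi, map_mul, hε, zero_mul]
  -- G is f divided by t_k once.
  set G : R := ∑ i, algebraMap A R (b i) * c.frac i with hG
  have hfG : algebraMap A R f = algebraMap A R (algebraMap (Poly n) A (X k)) ^ 1 * G := by
    rw [hf, map_sum, hG, Finset.mul_sum]
    refine Finset.sum_congr rfl fun i _ ↦ ?_
    by_cases hi : i ∈ S
    · rw [map_mul, ← c.mul_frac hi, pow_one]; ring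
    · rw [hb i hi, zero_mul, map_zero, zero_mul, mul_zero]
  have hmain {D : Type} [CommRing D] [Algebra ℂ D] {η : R →+* D}
      (h1 : ∀ a, η (algebraMap A R a) = algebraMap ℂ D (y a)) :
      η G = ∑ i, algebraMap ℂ D (y (b i)) * η (c.frac i) := by
    simp only [hG, map_sum, map_mul, h1]
  have hcon (h1 : ∀ i ∈ S, i ≠ k → y (b i) = 0) (h2 : y (b k) = 0) : False := by
    obtain ⟨i, hi, hu⟩ := hb'
    refine (hu.map y).ne_zero ?_
    by_cases hik : i = k
    · rw [hik, h2]
    · exact h1 i hi hik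
  have hsum {D : Type} [CommRing D] [Algebra ℂ D] (x : Fin n → D) {η : R →+* D}
      (h1 : ∀ a, η (algebraMap A R a) = algebraMap ℂ D (y a))
      (h2 : ∀ i ∈ S, i ≠ k → η (c.ψ (X i)) = x i) :
      η G = algebraMap ℂ D (y (b k)) + ∑ i ∈ S.erase k, algebraMap ℂ D (y (b i)) * x i := by
    rw [hmain h1, ← Finset.sum_subset (Finset.subset_univ S), ← Finset.add_sum_erase S _ hk]
    · congr 1
      · rw [BlowupCoordinates.frac, if_pos rfl, map_one, mul_one]
      · refine Finset.sum_congr rfl fun i hi ↦ ?_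
        rw [Finset.mem_erase] at hi
        rw [BlowupCoordinates.frac, if_neg hi.1, h2 i hi.2 hi.1]
    · intro i _ hi
      rw [hb i hi, map_zero, map_zero, zero_mul]
  have hsingle {i : Fin n} (hi : i ∈ S) (hik : i ≠ k) {D : Type} [CommRing D] [Algebra ℂ D] (d : D) :
      ∑ j ∈ S.erase k, algebraMap ℂ D (y (b j)) * (Pi.single i d : Fin n → D) j =
        algebraMap ℂ D (y (b i)) * d := by
    rw [Finset.sum_eq_single i, Pi.single_eq_same]
    · intro j _ hj
      rw [Pi.single_eq_of_ne hj, mul_zero]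
    · intro h
      exact absurd (Finset.mem_erase.mpr ⟨hik, hi⟩) h
  -- On the fibre over y, G is affine linear with coefficients y(b_i). Divisibility by t_k would
  -- make all of them vanish, against the invertible one. Hence G is the strict transform F.
  have hGt : ¬ algebraMap A R (algebraMap (Poly n) A (X k)) ∣ G := by
    rintro ⟨w, hw⟩
    have hz {x : Fin n → ℂ} : y (b k) + ∑ i ∈ S.erase k, y (b i) * x i = 0 := by
      obtain ⟨η, h1, h2⟩ := c.exists_fiber_hom (D := ℂ) y hk hyS x
      have := hsum x h1 h2
      rw [hw, map_mul, h1, hyS k hk, map_zero, zero_mul] at this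
      exact this.symm
    have hbk : y (b k) = 0 := by simpa using hz (x := 0)
    refine hcon (fun i hi hik ↦ ?_) hbk
    have := hz (x := Pi.single i 1)
    rw [hbk, zero_add] at this
    simpa using (hsingle hi hik (D := ℂ) 1).symm.trans this
  rw [eq_of_pow_mul_eq ht hFt hGt (hF.symm.trans hfG)]
  intro hGsq
  -- A homomorphism to the dual numbers lifting ε is a tangent vector along the fibre and kills the
  -- square of the maximal ideal. Membership of F in that square would annihilate its derivatives
  -- y(b_i), and then its value y(b_k).
  have h0 (x : Fin n → ℂ) {η : R →+* DualNumber ℂ}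
      (h1 : ∀ a, η (algebraMap A R a) = algebraMap ℂ (DualNumber ℂ) (y a))
      (h2 : ∀ i ∈ S, i ≠ k → η (c.ψ (X i)) =
        algebraMap ℂ _ (ε (c.ψ (X i))) + (TrivSqZeroExt.inr (x i) : DualNumber ℂ)) : η G = 0 := by
    have h3 : (TrivSqZeroExt.fstHom ℂ ℂ ℂ).toRingHom.comp η = ε.toRingHom := by
      refine c.ringHom_ext (fun a ↦ ?_) fun i hi hik ↦ ?_
      · change TrivSqZeroExt.fst (η _) = ε _
        rw [h1, hy]
        rfl
      · change TrivSqZeroExt.fst (η _) = ε _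
        rw [h2 i hi hik, TrivSqZeroExt.fst_add, TrivSqZeroExt.fst_inr, add_zero]
        rfl
    rw [pow_two] at hGsq
    refine Submodule.mul_induction_on hGsq (fun p hp q hq ↦ ?_) fun p q hp hq ↦ ?_
    · have h4 {p : R} (hp : p ∈ RingHom.ker ε) : η p = TrivSqZeroExt.inr (η p).snd := by
        refine TrivSqZeroExt.ext ?_ rfl
        exact (congr($h3 p)).trans hp
      rw [map_mul, h4 hp, h4 hq, TrivSqZeroExt.inr_mul_inr]
    · rw [map_add, hp, hq, add_zero]
  have hfib (x : Fin n → ℂ) : algebraMap ℂ (DualNumber ℂ) (y (b k)) +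
      ∑ i ∈ S.erase k, algebraMap ℂ (DualNumber ℂ) (y (b i)) *
        (algebraMap ℂ _ (ε (c.ψ (X i))) + (TrivSqZeroExt.inr (x i) : DualNumber ℂ)) = 0 := by
    obtain ⟨η, h1, h2⟩ := c.exists_fiber_hom (D := DualNumber ℂ) y hk hyS
      fun i ↦ algebraMap ℂ _ (ε (c.ψ (X i))) + (TrivSqZeroExt.inr (x i) : DualNumber ℂ)
    exact (hsum _ h1 h2).symm.trans (h0 x h1 h2)
  have hb0 : ∀ i ∈ S, i ≠ k → y (b i) = 0 := by
    intro i hi hik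
    have h1 := hfib (Pi.single i 1)
    have h2 := hfib 0
    rw [← h2, add_right_inj] at h1
    simp only [mul_add, Finset.sum_add_distrib, Pi.zero_apply, TrivSqZeroExt.inr_zero,
      add_zero, add_eq_left] at h1
    rw [Finset.sum_eq_single i, Pi.single_eq_same] at h1
    · have h3 := congr(TrivSqZeroExt.snd $h1)
      rw [TrivSqZeroExt.snd_mul] at h3
      simpa [TrivSqZeroExt.algebraMap_eq_inl] using h3
    · intro j _ hj
      rw [Pi.single_eq_of_ne hj, TrivSqZeroExt.inr_zero, mul_zero]
    · intro h
      exact absurd (Finset.mem_erase.mpr ⟨hik, hi⟩) h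
  refine hcon hb0 ?_
  have h1 := congr(TrivSqZeroExt.fst $(hfib 0))
  rw [Finset.sum_eq_zero] at h1
  · simpa [TrivSqZeroExt.algebraMap_eq_inl] using h1
  · intro i hi
    rw [Finset.mem_erase] at hi
    rw [hb0 i hi.2 hi.1, map_zero, zero_mul]

end Exceptional

end

section

open MvPolynomial Matrix HolGerm

/-! ### Points of the exceptional divisor when f vanishes to second order. -/

section Exceptional

variable {n : ℕ} {A R : Type} [CommRing A] [Algebra (Poly n) A] [CommRing R] [Algebra A R]
  {S : Finset (Fin n)} {k : Fin n} (c : BlowupCoordinates S k A R)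
  [Algebra ℂ A] [IsScalarTower ℂ (Poly n) A] [Algebra ℂ R] [IsScalarTower ℂ A R]

include c in
/-- Analytic coordinates of the base give analytic coordinates at the points of the exceptional
divisor. -/
lemma BlowupCoordinates.exists_coordinates [Algebra.FormallyUnramified (Poly n) A] (hk : k ∈ S)
    (ε : R →ₐ[ℂ] ℂ) {y : A →ₐ[ℂ] ℂ} (hy : ∀ a, y a = ε (algebraMap A R a))
    (hyS : ∀ i ∈ S, y (algebraMap (Poly n) A (X i)) = 0)
    {φ : A →ₐ[ℂ] HolGerm n} (hφ : (RingHom.ker y).map φ = maxIdeal n) :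
    ∃ φ' : R →ₐ[ℂ] HolGerm n, (RingHom.ker ε).map φ' = maxIdeal n ∧
      (∀ i, φ' (c.ψ (X i)) = coord i + const (ε (c.ψ (X i)))) ∧
      ∃ ρ : HolGerm n →ₐ[ℂ] HolGerm n,
        (∀ i, ρ (coord i) = if i ∈ S ∧ i ≠ k then coord i else 0) ∧
        ∀ a, ρ (φ' (algebraMap A R a)) = const (y a) := by
  let t (i : Fin n) : A := algebraMap (Poly n) A (X i)
  have hgen := ker_le_span_sup_sq (n := n) y
  have hs (i : Fin n) : y (t i - algebraMap ℂ A (y (t i))) = 0 := by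
    rw [map_sub, AlgHom.commutes]
    exact sub_self _
  obtain ⟨σ, hσ⟩ := exists_normalization hgen hs hφ
  let κ (i : Fin n) : ℂ := ε (c.ψ (X i))
  have hκ {i : Fin n} (hi : ¬ (i ∈ S ∧ i ≠ k)) : κ i = y (t i) := by
    rw [hy, ← c.ψ_X_of_not hi]
  have hκk : κ k = 0 := by rw [hκ (by simp), hyS k hk]
  -- T is the blow-down in local coordinates: t_i = t_k u_i with u_i = z_i + κ_i centred at the
  -- given point, and the remaining t_i unchanged up to their values.
  let T (i : Fin n) : HolGerm n :=
    if i ∈ S ∧ i ≠ k then coord k * (coord i + const (κ i)) else coord i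
  have hT (i) : T i ∈ maxIdeal n := by
    by_cases hi : i ∈ S ∧ i ≠ k
    · simp only [T, if_pos hi]
      exact Ideal.mul_mem_right _ _ (coord_mem k)
    · simp only [T, if_neg hi]
      exact coord_mem i
  obtain ⟨τ, hτ⟩ := exists_subst hT
  have hρ (i : Fin n) : (if i ∈ S ∧ i ≠ k then coord i else 0 : HolGerm n) ∈ maxIdeal n := by
    split_ifs
    · exact coord_mem i
    · exact zero_mem _
  -- ρ restricts germs to the fibre over y by setting all coordinates except the fibre ones to zero.
  obtain ⟨ρ, hρ⟩ := exists_subst hρ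
  let φA : A →ₐ[ℂ] HolGerm n := (τ.comp σ).comp φ
  have hφAt (i) : φA (t i) = T i + const (y (t i)) := by
    have h1 : φA (t i - algebraMap ℂ A (y (t i))) = T i := by
      change τ (σ (φ _)) = _
      rw [hσ, hτ]
    rw [map_sub, AlgHom.commutes, sub_eq_iff_eq_add] at h1
    exact h1
  let h : Poly n →+* HolGerm n := eval₂Hom (algebraMap ℂ (HolGerm n)) fun i ↦ coord i + const (κ i)
  have hX (i) : h (X i) = coord i + const (κ i) := eval₂Hom_X' _ _ _
  have comm : φA.toRingHom.comp (algebraMap (Poly n) A) =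
      h.comp (blowupSubst S k).toRingHom := by
    refine MvPolynomial.ringHom_ext (fun z ↦ ?_) fun i ↦ ?_
    · have : φA (algebraMap (Poly n) A (C z)) = algebraMap ℂ _ z := by
        rw [algebraMap_C, AlgHom.commutes]
      refine Eq.trans this ?_
      simp [blowupSubst, h]
    · change φA (t i) = h (blowupSubst S k (X i))
      rw [hφAt]
      by_cases hi : i ∈ S ∧ i ≠ k
      · rw [blowupSubst_X_of_mem S k hi, map_mul, hX, hX, hκk, hyS i hi.1]
        simp only [T, if_pos hi, ← constHom_apply, map_zero, add_zero]
      · rw [blowupSubst_X_of_not S k hi, hX, hκ hi]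
        simp only [T, if_neg hi]
  obtain ⟨χ, h1, h2⟩ := c.exists_lift φA.toRingHom h fun p ↦ congr($comm p)
  let φ' : R →ₐ[ℂ] HolGerm n := ⟨χ, fun z ↦ by
    rw [IsScalarTower.algebraMap_apply ℂ A R]
    exact congr($h1 (algebraMap ℂ A z)).trans (φA.commutes z)⟩
  have hφ'A (a : A) : φ' (algebraMap A R a) = φA a := congr($h1 a)
  have hφ'X (i) : φ' (c.ψ (X i)) = coord i + const (κ i) := congr($h2 (X i)).trans (hX i)
  have hφAe (a : A) : HolGerm.eval (φA a) = y a := by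
    change HolGerm.eval (τ (σ (φ a))) = _
    rw [eval_algHom, eval_algHom, eval_eq_of_map_ker_le hφ.le]
  have hev : (HolGerm.eval (n := n)).comp φ'.toRingHom = ε.toRingHom := by
    refine c.ringHom_ext (fun a ↦ ?_) fun i _ _ ↦ ?_
    · change HolGerm.eval (φ' _) = ε _
      rw [hφ'A, hφAe, hy]
    · change HolGerm.eval (φ' _) = ε _
      rw [hφ'X, map_add, eval_coord, eval_const, zero_add]
  refine ⟨φ', le_antisymm ?_ ?_, hφ'X, ρ, hρ, fun a ↦ ?_⟩
  · rw [Ideal.map_le_iff_le_comap]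
    intro b hb
    rw [Ideal.mem_comap, mem_maxIdeal_iff]
    exact (congr($hev b)).trans hb
  · rw [maxIdeal, Ideal.span_le]
    rintro _ ⟨i, rfl⟩
    have h3 : φ' (c.ψ (X i) - algebraMap ℂ R (κ i)) = coord i := by
      rw [map_sub, hφ'X, AlgHom.commutes, algebraMap_apply, add_sub_cancel_right]
    rw [← h3]
    refine Ideal.mem_map_of_mem _ ?_
    rw [RingHom.mem_ker, map_sub, AlgHom.commutes]
    exact sub_self _
  · rw [hφ'A]
    change (ρ.comp τ) (σ (φ a)) = _
    -- Every base coordinate restricts to zero on the fibre, so functions from A become constant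
    -- there.
    rw [algHom_eq_const_of_coord_eq_zero, eval_algHom, eval_eq_of_map_ker_le hφ.le]
    intro i
    rw [AlgHom.comp_apply, hτ]
    simp only [T]
    split_ifs with hi
    · rw [map_mul, hρ, if_neg (by simp), zero_mul]
    · rw [hρ, if_neg hi]

include c in
/-- If `f` vanishes to second order along the centre, its strict transform has at most quadratic
points along the exceptional divisor. -/
lemma BlowupCoordinates.quadratic_of_eq_sum [Algebra.FormallyUnramified (Poly n) A] (hk : k ∈ S)
    (ht : algebraMap A R (algebraMap (Poly n) A (X k)) ∈ nonZeroDivisors R) {f : A} {F : R}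
    {m r : ℕ} (hf : HasQuadraticPoints f n r)
    (hF : algebraMap A R f = algebraMap A R (algebraMap (Poly n) A (X k)) ^ m * F)
    (hFt : ¬ algebraMap A R (algebraMap (Poly n) A (X k)) ∣ F) {a : Fin n → Fin n → A}
    (ha : ∀ i j, a i j = a j i) (haS : ∀ i j, j ∉ S → a i j = 0)
    (hfa : f = ∑ i, ∑ j, a i j * algebraMap (Poly n) A (X i) * algebraMap (Poly n) A (X j))
    (ε : R →ₐ[ℂ] ℂ) (hε : ε (algebraMap A R (algebraMap (Poly n) A (X k))) = 0)
    (hFsq : F ∈ RingHom.ker ε ^ 2) : ∃ r', r ≤ r' ∧ IsQuadraticAt (Ideal.span {F}) ε n r' := by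
  let t (i : Fin n) : A := algebraMap (Poly n) A (X i)
  let y : A →ₐ[ℂ] ℂ := ε.comp (IsScalarTower.toAlgHom ℂ A R)
  have hy (a : A) : y a = ε (algebraMap A R a) := rfl
  have hyS : ∀ i ∈ S, y (t i) = 0 := by
    intro i hi
    rw [hy, ← c.mul_frac hi, map_mul, hε, zero_mul]
  have haS' : ∀ i j, i ∉ S → a i j = 0 := fun i j hi ↦ by rw [ha, haS j i hi]
  -- This excludes the smooth alternative at y, so the rank hypothesis on f becomes available.
  have hfsq : f ∈ RingHom.ker y ^ 2 := by
    rw [hfa, pow_two]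
    refine sum_mem fun i _ ↦ sum_mem fun j _ ↦ ?_
    by_cases hi : i ∈ S
    · by_cases hj : j ∈ S
      · rw [mul_assoc]
        exact Ideal.mul_mem_left _ _ (Ideal.mul_mem_mul (hyS i hi) (hyS j hj))
      · rw [haS i j hj, zero_mul, zero_mul]; exact zero_mem _
    · rw [haS' i j hi, zero_mul, zero_mul]; exact zero_mem _
  have hfy : y f = 0 := (Ideal.pow_le_self two_ne_zero hfsq : f ∈ RingHom.ker y)
  obtain ⟨r', hr', φ, hφ, M, hM, hMr, θ, hθ, hJ⟩ := (hf y hfy).resolve_left (not_not_intro hfsq)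
  let α : Matrix (Fin n) (Fin n) ℂ := Matrix.of fun i j ↦ y (a i j)
  have hα (i j) : α i j = y (a i j) := rfl
  have hαsymm : α.IsSymm := Matrix.IsSymm.ext fun i j ↦ by rw [hα, hα, ha]
  have hαS : ∀ i j, j ∉ S → α i j = 0 := fun i j hj ↦ by rw [hα, haS i j hj, map_zero]
  have hrank : r' ≤ α.rank := by
    rw [Ideal.map_span, Set.image_singleton] at hJ
    obtain ⟨e, he, heθ⟩ := exists_mul_eq_of_span_eq hJ
    rw [← hMr]
    refine rank_le_rank_of_eq hM hαsymm hθ he (T := fun i ↦ φ (t i - algebraMap ℂ A (y (t i))))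
      (fun i ↦ ?_) (a := fun i j ↦ φ (a i j)) (fun i j ↦ ?_) ?_
    · rw [mem_maxIdeal_iff, eval_eq_of_map_ker_le hφ.le, map_sub, AlgHom.commutes]
      exact sub_self _
    · rw [eval_eq_of_map_ker_le hφ.le, hα]
    · rw [heθ, hfa]
      simp only [map_sum]
      refine Finset.sum_congr rfl fun i _ ↦ Finset.sum_congr rfl fun j _ ↦ ?_
      by_cases hi : i ∈ S
      · by_cases hj : j ∈ S
        · rw [hyS i hi, hyS j hj, map_zero, sub_zero, sub_zero, map_mul, map_mul]
        · rw [haS i j hj]; simp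
      · rw [haS' i j hi]; simp
  obtain ⟨φ', hφ', hφ'X, ρ, hρ, hρA⟩ := c.exists_coordinates hk ε hy hyS hφ
  have hsq : φ' F ∈ maxIdeal n ^ 2 := by
    rw [← hφ', ← Ideal.map_pow]
    exact Ideal.mem_map_of_mem _ hFsq
  obtain ⟨H, hH, hFH⟩ := exists_quad hsq
  suffices hrH : α.rank ≤ H.rank from ⟨H.rank, (hr'.trans hrank).trans hrH, φ', hφ', H, hH, rfl,
    φ' F, hFH, by rw [Ideal.map_span, Set.image_singleton]⟩
  set q : R := ∑ i, ∑ j, algebraMap A R (a i j) * c.frac i * c.frac j with hq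
  have hfq : algebraMap A R f = algebraMap A R (t k) ^ 2 * q := by
    rw [hfa, map_sum, hq, Finset.mul_sum]
    refine Finset.sum_congr rfl fun i _ ↦ ?_
    rw [map_sum, Finset.mul_sum]
    refine Finset.sum_congr rfl fun j _ ↦ ?_
    by_cases hi : i ∈ S
    · by_cases hj : j ∈ S
      · rw [map_mul, map_mul, ← c.mul_frac hi, ← c.mul_frac hj]; ring
      · rw [haS i j hj]; simp
    · rw [haS' i j hi]; simp
  let D : Matrix (Fin n) (Fin n) ℂ := diagonal fun i ↦ if i ∈ S ∧ i ≠ k then 1 else 0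
  have hDz (z : Fin n → ℂ) (i : Fin n) :
      D.mulVec z i = if i ∈ S ∧ i ≠ k then z i else 0 := by
    simp only [D, mulVec_diagonal, ite_mul, one_mul, zero_mul]
  -- q is f/t_k². If t_k divides it, uᵀαu vanishes on the whole fibre, and the rank comparison with
  -- H = 0 at u = e_k gives rank α = 0. The bound is then trivial, whatever F is.
  by_cases hqt : algebraMap A R (t k) ∣ q
  · obtain ⟨w, hw⟩ := hqt
    refine le_trans ?_ ((rank_zero (R := ℂ) (m := Fin n) (n := Fin n)).le.trans (Nat.zero_le _))
    refine rank_le_rank_of_isBigO hαsymm (by simp [IsSymm]) (c := Pi.single k 1) (k := k)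
      (Pi.single_eq_same _ _) hαS (D := D) rfl ?_
    refine (isBigO_zero _ _).congr_left fun z ↦ ?_
    obtain ⟨η, h1, h2⟩ := c.exists_fiber_hom (D := ℂ) y hk hyS z
    have h3 : η q = 0 := by
      rw [hw, map_mul, h1, hyS k hk, map_zero, zero_mul]
    have h4 {i} (hi : i ∈ S) : η (c.frac i) = (Pi.single k 1 + D.mulVec z : Fin n → ℂ) i := by
      rw [Pi.add_apply, hDz]
      by_cases hik : i = k
      · rw [BlowupCoordinates.frac, if_pos hik, map_one, if_neg (by simp [hik]), hik,
          Pi.single_eq_same, add_zero]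
      · rw [BlowupCoordinates.frac, if_neg hik, h2 i hi hik, if_pos ⟨hi, hik⟩,
          Pi.single_eq_of_ne hik, zero_add]
    rw [zero_mulVec, dotProduct_zero, sub_zero, ← h3, hq]
    simp only [map_sum, map_mul, h1, dotProduct, mulVec, Finset.mul_sum]
    refine Finset.sum_congr rfl fun i _ ↦ Finset.sum_congr rfl fun j _ ↦ ?_
    by_cases hi : i ∈ S
    · by_cases hj : j ∈ S
      · rw [h4 hi, h4 hj, hα]
        change y (a i j) * _ * _ = _
        ring
      · rw [haS i j hj, hαS i j hj]; simp
    · rw [haS' i j hi, hα, haS' i j hi]; simp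
  -- Now F = q, and restriction to the fibre turns q into the quadratic polynomial of α and the form
  -- of H into its fibre part, which agree to third order.
  · obtain rfl := eq_of_pow_mul_eq ht hFt hqt (hF.symm.trans hfq)
    let κ (i : Fin n) : ℂ := if i = k then 1 else if i ∈ S then ε (c.ψ (X i)) else 0
    let w (i : Fin n) : HolGerm n := const (κ i) + if i ∈ S ∧ i ≠ k then coord i else 0
    have hw {i} (hi : i ∈ S) : ρ (φ' (c.frac i)) = w i := by
      simp only [w, κ]
      by_cases hik : i = k
      · rw [BlowupCoordinates.frac, if_pos hik, map_one, map_one, if_pos hik,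
          if_neg (by simp [hik]), add_zero]
        rfl
      · rw [BlowupCoordinates.frac, if_neg hik, hφ'X, map_add, hρ, if_pos ⟨hi, hik⟩, if_neg hik,
          if_pos hi, add_comm, ← HolGerm.algebraMap_apply, AlgHom.commutes]
    have hρq : ρ (φ' q) = ∑ i, ∑ j, algebraMap ℂ (HolGerm n) (α i j) * w i * w j := by
      rw [hq]
      simp only [map_sum, map_mul, hρA]
      refine Finset.sum_congr rfl fun i _ ↦ Finset.sum_congr rfl fun j _ ↦ ?_
      by_cases hi : i ∈ S
      · by_cases hj : j ∈ S
        · rw [hw hi, hw hj, hα, HolGerm.algebraMap_apply]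
        · rw [haS i j hj, hαS i j hj, map_zero, map_zero, ← constHom_apply, map_zero]; simp
      · rw [haS' i j hi, hα, haS' i j hi, map_zero, map_zero, ← constHom_apply, map_zero]; simp
    let d (i : Fin n) : HolGerm n := if i ∈ S ∧ i ≠ k then coord i else 0
    have hρH : ρ (quad H) = ∑ i, ∑ j, algebraMap ℂ (HolGerm n) (H i j) * d i * d j := by
      rw [quad_eq]
      simp only [map_sum, map_mul, hρ, AlgHom.commutes, d]
    have hd (i) : rep (d i) =ᶠ[𝓝 0] fun z ↦ D.mulVec z i := by
      simp only [d, hDz]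
      split_ifs
      · exact rep_coord i
      · exact rep_zero
    have hwz (i) : rep (w i) =ᶠ[𝓝 0] fun z ↦ (κ + D.mulVec z) i := by
      filter_upwards [rep_add (const (κ i)) (d i), rep_const (n := n) (κ i), hd i] with z h1 h2 h3
      refine h1.trans ?_
      rw [Pi.add_apply, h2, h3]
      rfl
    refine rank_le_rank_of_isBigO hαsymm hH (c := κ) (k := k) (by simp [κ]) hαS (D := D) rfl ?_
    have hO := rep_isBigO_pow (algHom_mem_maxIdeal_pow ρ hFH)
    rw [map_sub, hρq, hρH] at hO
    refine hO.congr' ?_ .rfl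
    filter_upwards [rep_sub (∑ i, ∑ j, algebraMap ℂ (HolGerm n) (α i j) * w i * w j)
      (∑ i, ∑ j, algebraMap ℂ (HolGerm n) (H i j) * d i * d j), rep_bilin α w, rep_bilin H d,
      Filter.eventually_all.mpr hwz, Filter.eventually_all.mpr hd] with z h1 h2 h3 h4 h5
    have h4' : (fun i ↦ rep (w i) z) = κ + D.mulVec z := funext h4
    have h5' : (fun i ↦ rep (d i) z) = D.mulVec z := funext h5
    rw [h1, Pi.sub_apply, h2, h3, h4', h5']

end Exceptional

end

section

open MvPolynomial HolGerm

/-! ### Hypersurfaces in étale coordinates -/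

/-- By flatness A embeds into its base change to the fraction field, which is unramified over a
field, hence reduced. -/
lemma isReduced_of_etale {n : ℕ} (A : Type*) [CommRing A] [Algebra (Poly n) A]
    [Algebra.Etale (Poly n) A] : IsReduced A := by
  let K := FractionRing (Poly n)
  have : IsReduced (TensorProduct (Poly n) K A) :=
    Algebra.FormallyUnramified.isReduced_of_field K _
  refine isReduced_of_injective (Algebra.TensorProduct.includeRight : A →ₐ[Poly n] TensorProduct (Poly n) K A) ?_
  exact Algebra.TensorProduct.includeRight_injective (IsFractionRing.injective (Poly n) K)

lemma mem_nonZeroDivisors_of_isReduced {A : Type*} [CommRing A] [IsReduced A] {f : A}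
    (hf : ∀ q ∈ minimalPrimes A, f ∉ q) : f ∈ nonZeroDivisors A := by
  rw [mem_nonZeroDivisors_iff_right]
  intro x hx
  have h1 : x ∈ sInf (minimalPrimes A) := by
    rw [Ideal.mem_sInf]
    intro q hq
    have := hq.isPrime
    exact (this.mem_or_mem (hx ▸ zero_mem q)).resolve_right (hf q hq)
  rw [minimalPrimes, Ideal.sInf_minimalPrimes] at h1
  obtain ⟨k, hk⟩ := h1
  exact IsReduced.eq_zero x ⟨k, hk⟩

lemma not_mem_minimalPrimes_of_height_eq_one {A : Type*} [CommRing A] {f : A}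
    (hf : ∀ q ∈ (Ideal.span {f}).minimalPrimes, q.height = 1) : ∀ q ∈ minimalPrimes A, f ∉ q := by
  intro q hq hfq
  have := hq.isPrime
  have h1 : q ∈ (Ideal.span {f}).minimalPrimes :=
    ⟨⟨this, (Ideal.span_singleton_le_iff_mem _).mpr hfq⟩, fun p hp hpq ↦
      hq.2 ⟨hp.1, bot_le⟩ hpq⟩
  have h2 := Ideal.height_eq_zero_iff.mpr hq
  rw [hf q h1] at h2
  exact one_ne_zero h2

lemma height_eq_one_of_mem_nonZeroDivisors {A : Type*} [CommRing A] [IsNoetherianRing A] {f : A}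
    (hf : f ∈ nonZeroDivisors A) {q : Ideal A} (hq : q ∈ (Ideal.span {f}).minimalPrimes) :
    q.height = 1 := by
  have := hq.isPrime
  refine le_antisymm (Ideal.height_le_one_of_isPrincipal_of_mem_minimalPrimes _ q hq) ?_
  rw [Order.one_le_iff_ne_zero]
  intro h
  exact Set.disjoint_left.mp (Ideal.disjoint_nonZeroDivisors_of_mem_minimalPrimes
    (Ideal.height_eq_zero_iff.mp h)) ((Ideal.span_singleton_le_iff_mem _).mp hq.1.2) hf

instance isPrime_ker {A : Type*} [CommRing A] [Algebra ℂ A] (ε : A →ₐ[ℂ] ℂ) :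
    (RingHom.ker ε).IsPrime :=
  RingHom.ker_isPrime ε

/-- The subscheme defined by `J` is smooth or has a quadratic point of rank at least `r` at each of
its points. -/
def HasQuadraticSingularities {A : Type*} [CommRing A] [Algebra ℂ A] (J : Ideal A) (n r : ℕ) :
    Prop :=
  ∀ ε : A →ₐ[ℂ] ℂ, J ≤ RingHom.ker ε →
    Algebra.FormallySmooth ℂ (Localization.AtPrime (RingHom.ker ε) ⧸
      J.map (algebraMap A (Localization.AtPrime (RingHom.ker ε)))) ∨
    ∃ r', r ≤ r' ∧ IsQuadraticAt J ε n r'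

lemma two_le_height_of_X_mem {n : ℕ} {i j : Fin n} (hij : i ≠ j) {P : Ideal (Poly n)} [P.IsPrime]
    (hi : X i ∈ P) (hj : X j ∈ P) : 2 ≤ P.height := by
  have h1 : (Ideal.span {(X i : Poly n)}).IsPrime :=
    (Ideal.span_singleton_prime (X_ne_zero i)).mpr (X_prime)
  have h2 : Ideal.span {(X i : Poly n)} < P := by
    refine lt_of_le_of_ne ((Ideal.span_singleton_le_iff_mem _).mpr hi) fun h ↦ ?_
    rw [← h, Ideal.mem_span_singleton, X_dvd_X] at hj
    exact hij hj
  have h3 : (⊥ : Ideal (Poly n)) < Ideal.span {(X i : Poly n)} := by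
    rw [bot_lt_iff_ne_bot, Ne, Ideal.span_singleton_eq_bot]
    exact X_ne_zero i
  have := Ideal.isPrime_bot (α := Poly n)
  calc (2 : ℕ∞) = 0 + 1 + 1 := by norm_num
    _ ≤ (⊥ : Ideal (Poly n)).height + 1 + 1 := by gcongr; exact zero_le
    _ ≤ (Ideal.span {(X i : Poly n)}).height + 1 := by
      gcongr; exact Ideal.height_add_one_le_of_lt_of_isPrime h3
    _ ≤ P.height := Ideal.height_add_one_le_of_lt_of_isPrime h2

/-- The Jacobian criterion for hypersurfaces. -/
lemma formallySmooth_quotient_iff (n : ℕ) {A : Type} [CommRing A] [Algebra (Poly n) A]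
    [Algebra ℂ A] [IsScalarTower ℂ (Poly n) A] [Algebra.Etale (Poly n) A] {f : A}
    (hf : f ∈ nonZeroDivisors A) {ε : A →ₐ[ℂ] ℂ}
    (hε : ε f = 0) : Algebra.FormallySmooth ℂ (Localization.AtPrime (RingHom.ker ε) ⧸
      (Ideal.span {f}).map (algebraMap A (Localization.AtPrime (RingHom.ker ε)))) ↔
      f ∉ RingHom.ker ε ^ 2 := by
  let p : Ideal A := RingHom.ker ε
  let O := Localization.AtPrime p
  have : Algebra.FormallyEtale A O := Algebra.FormallyEtale.of_isLocalization p.primeCompl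
  have : Algebra.FormallyEtale (Poly n) O := Algebra.FormallyEtale.comp (Poly n) A O
  have : Algebra.FormallySmooth ℂ O := Algebra.FormallySmooth.comp ℂ (Poly n) O
  have hm : IsLocalRing.maximalIdeal O = p.map (algebraMap A O) :=
    (IsLocalization.AtPrime.map_eq_maximalIdeal p O).symm
  have hspan : (Ideal.span {f}).map (algebraMap A O) = Ideal.span {algebraMap A O f} := by
    rw [Ideal.map_span, Set.image_singleton]
  have hcomap {a : A} (ha : algebraMap A O a ∈ IsLocalRing.maximalIdeal O ^ 2) : a ∈ p ^ 2 := by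
    rw [hm, ← Ideal.map_pow, IsLocalization.algebraMap_mem_map_algebraMap_iff p.primeCompl] at ha
    obtain ⟨u, hu, hua⟩ := ha
    exact mem_sq_of_mul_mem hu hua
  change Algebra.FormallySmooth ℂ (O ⧸ (Ideal.span {f}).map (algebraMap A O)) ↔ f ∉ p ^ 2
  rw [hspan]
  constructor
  · intro h hfp
    have h1 : algebraMap A O f ∈ IsLocalRing.maximalIdeal O ^ 2 := by
      rw [hm, ← Ideal.map_pow]; exact Ideal.mem_map_of_mem _ hfp
    have h2 := eq_zero_of_formallySmooth_quotient (k := ℂ) h1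
    -- A singular formally smooth quotient would make f zero in the local ring, which a
    -- nonzerodivisor is not.
    obtain ⟨u, hu⟩ := (IsLocalization.map_eq_zero_iff p.primeCompl O f).mp h2
    have h3 : (u : A) = 0 := (mem_nonZeroDivisors_iff_right.mp hf) _ hu
    exact u.2 (h3 ▸ zero_mem p)
  · intro hfp
    have hs (i : Fin n) : ε (algebraMap (Poly n) A (X i) -
        algebraMap ℂ A (ε (algebraMap (Poly n) A (X i)))) = 0 := by
      rw [map_sub, AlgHom.commutes]; exact sub_self _
    obtain ⟨c, hc⟩ := exists_linear_form (ker_le_span_sup_sq (n := n) ε) hs hε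
    -- Some linear coefficient c_i is nonzero; the i-th partial derivative of f is c_i modulo the
    -- maximal ideal, hence a unit.
    have h1 : ∃ i, c i ≠ 0 := by
      by_contra! h0
      refine hfp ?_
      simpa [h0] using hc
    obtain ⟨i, hi⟩ := h1
    obtain ⟨d, hd⟩ := exists_partialDerivative (n := n) (O := O) i
    refine formallySmooth_quotient_of_derivation d ?_
    have h2 : ∀ a ∈ p ^ 2, d (algebraMap A O a) ∈ IsLocalRing.maximalIdeal O := by
      intro a ha
      rw [pow_two] at ha
      have hp {a : A} (ha : a ∈ p) : algebraMap A O a ∈ IsLocalRing.maximalIdeal O := by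
        rw [hm]; exact Ideal.mem_map_of_mem _ ha
      refine Submodule.mul_induction_on ha (fun x hx y hy ↦ ?_) fun x y hx hy ↦ ?_
      · rw [map_mul, Derivation.leibniz]
        exact add_mem (Ideal.mul_mem_right _ _ (hp hx)) (Ideal.mul_mem_right _ _ (hp hy))
      · rw [map_add, map_add]; exact add_mem hx hy
    have h3 := h2 _ hc
    have h4 : d (algebraMap A O (f - ∑ j, algebraMap ℂ A (c j) * (algebraMap (Poly n) A (X j) -
        algebraMap ℂ A (ε (algebraMap (Poly n) A (X j)))))) =
        d (algebraMap A O f) - algebraMap ℂ O (c i) := by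
      have h5 (z : ℂ) : algebraMap A O (algebraMap ℂ A z) = algebraMap ℂ O z :=
        (IsScalarTower.algebraMap_apply ℂ A O z).symm
      have h6 (j) : algebraMap A O (algebraMap (Poly n) A (X j)) = algebraMap (Poly n) O (X j) :=
        (IsScalarTower.algebraMap_apply (Poly n) A O _).symm
      simp only [map_sub, map_sum, map_mul, h5, h6, Derivation.leibniz, Derivation.map_algebraMap,
        hd, smul_zero, sub_zero, add_zero]
      simp
    rw [h4] at h3
    by_contra hu
    have h5 : algebraMap ℂ O (c i) ∈ IsLocalRing.maximalIdeal O := by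
      have := sub_mem ((IsLocalRing.mem_maximalIdeal _).mpr hu) h3
      rwa [sub_sub_cancel] at this
    exact (IsLocalRing.mem_maximalIdeal _).mp h5 ((isUnit_iff_ne_zero.mpr hi).map (algebraMap ℂ O))

section Etale

variable {n : ℕ} {A : Type} [CommRing A] [Algebra (Poly n) A] [Algebra ℂ A]
  [IsScalarTower ℂ (Poly n) A] [Algebra.Etale (Poly n) A]

lemma hasQuadraticSingularities_iff {f : A} (hf : f ∈ nonZeroDivisors A) {r : ℕ} :
    HasQuadraticSingularities (Ideal.span {f}) n r ↔ HasQuadraticPoints f n r := by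
  refine forall_congr' fun ε ↦ ?_
  rw [Ideal.span_singleton_le_iff_mem, RingHom.mem_ker]
  exact forall_congr' fun hε ↦ or_congr (formallySmooth_quotient_iff n hf hε) .rfl

/-- A reduced hypersurface with at most quadratic points is locally principal. -/
lemma exists_locally_principal [Algebra.IsStandardSmoothOfRelativeDimension n ℂ A] {J : Ideal A}
    {r : ℕ} (hJ : HasQuadraticSingularities J n r) (hheight : ∀ q ∈ J.minimalPrimes, q.height = 1)
    {ε : A →ₐ[ℂ] ℂ} (hε : J ≤ RingHom.ker ε) :
    ∃ u, ε u ≠ 0 ∧ ∃ f ∈ J, ∀ x ∈ J, f ∣ u * x := by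
  classical
  have : Algebra.FiniteType ℂ A := Algebra.FiniteType.trans (S := Poly n) inferInstance inferInstance
  have : IsNoetherianRing A := Algebra.FiniteType.isNoetherianRing ℂ A
  suffices ∃ f ∈ J, ∀ x ∈ J, ∃ u, ε u ≠ 0 ∧ f ∣ u * x by
    obtain ⟨f, hf, h⟩ := this
    obtain ⟨T, hT⟩ := (isNoetherianRing_iff_ideal_fg A).mp inferInstance J
    choose! u hu hfu using h
    have hTJ {x : A} (hx : x ∈ T) : x ∈ J := hT ▸ Submodule.subset_span hx
    refine ⟨∏ x ∈ T, u x, ?_, f, hf, fun x hx ↦ ?_⟩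
    · rw [map_prod]
      exact Finset.prod_ne_zero_iff.mpr fun x hx ↦ hu x (hTJ hx)
    · rw [← hT] at hx
      refine Submodule.span_induction (p := fun x _ ↦ f ∣ (∏ y ∈ T, u y) * x) ?_ ?_ ?_ ?_ hx
      · intro x hx
        rw [← Finset.prod_erase_mul _ _ hx, mul_assoc]
        exact (hfu x (hTJ hx)).mul_left _
      · simp
      · intro x y _ _ h1 h2
        rw [mul_add]; exact dvd_add h1 h2
      · intro a x _ h1
        rw [smul_eq_mul, mul_left_comm]; exact h1.mul_left _
  rcases hJ ε hε with hs | ⟨r', -, φ, hφ, M, -, -, θ, -, hθ⟩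
  · obtain ⟨g, hg, t, S, het, hS⟩ := exists_adapted_coordinates (n := n) J (RingHom.ker ε) hε
    let L := Localization.Away g
    have hcard : S.card ≤ 1 := by
      by_contra! hS1
      obtain ⟨i, hi, j, hj, hij⟩ := Finset.one_lt_card.mp hS1
      obtain ⟨q, hq, hqε⟩ := Ideal.exists_minimalPrimes_le hε
      have := hq.isPrime
      have hdisj : Disjoint (Submonoid.powers g : Set A) q := by
        rw [Set.disjoint_left]
        rintro _ ⟨N, rfl⟩ hN
        exact hg (hqε (this.mem_of_pow_mem N hN))
      let Q : Ideal L := q.map (algebraMap A L)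
      have hQ : Q.IsPrime := IsLocalization.isPrime_of_isPrime_disjoint (.powers g) L q this hdisj
      have hQh : Q.height = 1 := by
        rw [← hheight q hq]
        exact IsLocalization.height_map_of_disjoint (.powers g) q hdisj
      let := ((algebraMap A L).comp (aeval t : Poly n →ₐ[ℂ] A).toRingHom).toAlgebra
      have : Algebra.Etale (Poly n) L := het
      -- By going down along the flat map, contraction to the polynomial ring does not raise the
      -- height, while two vanishing coordinates would force height at least two.
      have hle := Ideal.height_eq_height_add_of_liesOver_of_hasGoingDown (Q.under (Poly n)) (P := Q)
      have hmem {i : Fin n} (hi : i ∈ S) : X i ∈ Q.under (Poly n) := by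
        have h1 : algebraMap A L (t i) ∈ J.map (algebraMap A L) :=
          hS ▸ Ideal.subset_span ⟨i, hi, rfl⟩
        have h2 : algebraMap (Poly n) L (X i) = algebraMap A L (t i) := by
          change algebraMap A L (aeval t (X i)) = _
          rw [aeval_X]
        rw [Ideal.under_def, Ideal.mem_comap, h2]
        exact Ideal.map_mono hq.1.2 h1
      have h2 := two_le_height_of_X_mem hij (hmem hi) (hmem hj)
      rw [hQh] at hle
      have : (2 : ℕ∞) ≤ 1 := h2.trans (le_self_add.trans hle.ge)
      norm_num at this
    have hpow (N : ℕ) : ε (g ^ N) ≠ 0 := by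
      rw [map_pow]; exact pow_ne_zero N hg
    have hdiv {a b : A} (h : algebraMap A L a ∣ algebraMap A L b) : ∃ N, a ∣ g ^ N * b := by
      obtain ⟨c, hc⟩ := h
      obtain ⟨N, c', hc'⟩ := IsLocalization.Away.surj g c
      have : algebraMap A L (g ^ N * b) = algebraMap A L (a * c') := by
        rw [map_mul, map_mul, hc, ← hc', map_pow]; ring
      obtain ⟨⟨_, M, rfl⟩, hM⟩ := (IsLocalization.eq_iff_exists (.powers g) L).mp this
      refine ⟨M + N, g ^ M * c', ?_⟩
      simp only at hM
      rw [pow_add, mul_assoc, hM]; ring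
    have hmem {a : A} (h : algebraMap A L a ∈ J.map (algebraMap A L)) : ∃ N, g ^ N * a ∈ J := by
      obtain ⟨_, ⟨N, rfl⟩, hN⟩ :=
        (IsLocalization.algebraMap_mem_map_algebraMap_iff (.powers g) L J a).mp h
      exact ⟨N, hN⟩
    -- If S is empty, J vanishes near the point and 0 generates it; otherwise the single coordinate
    -- t_i does, up to a power of g.
    rcases S.eq_empty_or_nonempty with rfl | ⟨i, hi⟩
    · refine ⟨0, zero_mem _, fun x hx ↦ ?_⟩
      have h1 : algebraMap A L x ∈ J.map (algebraMap A L) := Ideal.mem_map_of_mem _ hx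
      rw [hS] at h1
      simp only [Finset.coe_empty, Set.image_empty, Ideal.span_empty, Ideal.mem_bot] at h1
      obtain ⟨N, hN⟩ := hdiv (a := 0) (b := x) (by rw [h1]; exact dvd_zero _)
      exact ⟨g ^ N, hpow N, hN⟩
    · obtain rfl : S = {i} := by
        refine Finset.eq_singleton_iff_unique_mem.mpr ⟨hi, fun j hj ↦ ?_⟩
        exact Finset.card_le_one.mp hcard j hj i hi
      simp only [Finset.coe_singleton, Set.image_singleton] at hS
      obtain ⟨N, hN⟩ := hmem (a := t i) (hS ▸ Ideal.mem_span_singleton_self _)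
      refine ⟨_, hN, fun x hx ↦ ?_⟩
      have h1 : algebraMap A L x ∈ J.map (algebraMap A L) := Ideal.mem_map_of_mem _ hx
      rw [hS, Ideal.mem_span_singleton] at h1
      obtain ⟨M, hM⟩ := hdiv h1
      refine ⟨g ^ (N + M), hpow _, ?_⟩
      rw [pow_add, mul_assoc]
      exact mul_dvd_mul_left _ hM
  · have hs (i : Fin n) : ε (algebraMap (Poly n) A (X i) -
        algebraMap ℂ A (ε (algebraMap (Poly n) A (X i)))) = 0 := by
      rw [map_sub, AlgHom.commutes]; exact sub_self _
    exact exists_dvd_of_map_eq_span (ker_le_span_sup_sq ε) hs hφ hθ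

end Etale

end

section

open MvPolynomial HolGerm

/-! ### Strict transforms in a chart -/

/-- If all powers of t divided f, Krull's intersection theorem would give (1 - r) f = 0 with r in
(t), hence r = 1 since f is a nonzerodivisor. -/
lemma exists_eq_pow_mul_of_isPrime {R : Type*} [CommRing R] [IsNoetherianRing R] {t f : R}
    (ht : (Ideal.span {t}).IsPrime) (hf : f ∈ nonZeroDivisors R) :
    ∃ (m : ℕ) (F : R), f = t ^ m * F ∧ ¬ t ∣ F := by
  have hfin : FiniteMultiplicity t f := by
    by_contra h
    rw [FiniteMultiplicity.not_iff_forall] at h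
    have h1 : f ∈ (⨅ i : ℕ, Ideal.span {t} ^ i • ⊤ : Submodule R R) := by
      rw [Submodule.mem_iInf]
      intro k
      rw [Ideal.span_singleton_pow, smul_eq_mul, Ideal.mul_top]
      exact Ideal.mem_span_singleton.mpr (h k)
    obtain ⟨r, hr⟩ := (Ideal.mem_iInf_smul_pow_eq_bot_iff _ _).mp h1
    have h2 : (1 - r : R) = 0 := by
      refine (mem_nonZeroDivisors_iff_right.mp hf) _ ?_
      rw [sub_mul, one_mul, sub_eq_zero]
      exact hr.symm
    refine ht.ne_top ((Ideal.eq_top_iff_one _).mpr ?_)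
    rw [sub_eq_zero.mp h2]
    exact r.2
  obtain ⟨F, h1, h2⟩ := hfin.exists_eq_pow_mul_and_not_dvd
  exact ⟨_, F, h1, h2⟩

lemma dvd_of_dvd_pow_mul {R : Type*} [CommRing R] {t F x : R} (ht : t ∈ nonZeroDivisors R)
    (htp : (Ideal.span {t}).IsPrime) (hF : ¬ t ∣ F) {N : ℕ} (h : F ∣ t ^ N * x) : F ∣ x := by
  induction N with
  | zero => simpa using h
  | succ N ih =>
    obtain ⟨w, hw⟩ := h
    have h1 : t ∣ w := by
      have : F * w ∈ Ideal.span {t} := by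
        rw [← hw, Ideal.mem_span_singleton, pow_succ', mul_assoc]
        exact dvd_mul_right _ _
      rcases htp.mem_or_mem this with h | h
      · exact absurd (Ideal.mem_span_singleton.mp h) hF
      · exact Ideal.mem_span_singleton.mp h
    obtain ⟨w', rfl⟩ := h1
    refine ih ⟨w', (mul_cancel_left_mem_nonZeroDivisors ht).mp ?_⟩
    rw [← mul_assoc, ← pow_succ', hw]
    ring

section Chart

variable {A R : Type*} [CommRing A] [CommRing R] [Algebra A R] {I : Ideal A} {x : A}

lemma IsBlowupChart.mem_nonZeroDivisors (h : IsBlowupChart I x R) {f : A}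
    (hf : f ∈ nonZeroDivisors A) : algebraMap A R f ∈ nonZeroDivisors R := by
  rw [mem_nonZeroDivisors_iff_right]
  intro r hr
  obtain ⟨m, a, -, ha⟩ := h.exists_frac r
  have h1 : algebraMap A R (a * f) = 0 := by
    rw [map_mul, ← ha, mul_assoc, hr, mul_zero]
  obtain ⟨N, hN⟩ := h.eq_zero _ h1
  have h2 : x ^ N * a = 0 := by
    refine (mem_nonZeroDivisors_iff_right.mp hf) _ ?_
    rw [mul_assoc, hN]
  refine mul_left_cancel_of_nzd h.nzd (m := N + m) ?_
  rw [mul_zero, pow_add, mul_assoc, ha, ← map_pow, ← map_mul, h2, map_zero]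

lemma IsBlowupChart.isReduced [IsReduced A] (h : IsBlowupChart I x R) : IsReduced R := by
  refine ⟨fun r hr ↦ ?_⟩
  obtain ⟨k, hk⟩ := hr
  obtain ⟨m, a, -, ha⟩ := h.exists_frac r
  have h1 : algebraMap A R (a ^ k) = 0 := by
    rw [map_pow, ← ha, mul_pow, hk, mul_zero]
  obtain ⟨N, hN⟩ := h.eq_zero _ h1
  have h2 : x ^ N * a = 0 := by
    refine IsReduced.eq_zero _ ⟨k + 1, ?_⟩
    rw [mul_pow, pow_succ a, pow_succ (x ^ N), show (x ^ N) ^ k * x ^ N * (a ^ k * a) =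
      (x ^ N) ^ k * (x ^ N * a ^ k) * a by ring, hN, mul_zero, zero_mul]
  refine mul_left_cancel_of_nzd h.nzd (m := N + m) ?_
  rw [mul_zero, pow_add, mul_assoc, ha, ← map_pow, ← map_mul, h2, map_zero]

/-- The strict transform of `f = 0` in a chart of a blow-up. -/
lemma IsBlowupChart.ker_eq_span {f : A} {R' : Type*} [CommRing R'] [Algebra (A ⧸ Ideal.span {f}) R']
    (h : IsBlowupChart I x R)
    (h' : IsBlowupChart (I.map (Ideal.Quotient.mk (Ideal.span {f}))) (Ideal.Quotient.mk _ x) R')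
    (hx : (Ideal.span {algebraMap A R x}).IsPrime) {m : ℕ} {F : R}
    (hF : algebraMap A R f = algebraMap A R x ^ m * F) (hFx : ¬ algebraMap A R x ∣ F)
    {χ : R →+* R'} (hχ : ∀ a, χ (algebraMap A R a) =
      algebraMap (A ⧸ Ideal.span {f}) R' (Ideal.Quotient.mk _ a)) :
    RingHom.ker χ = Ideal.span {F} := by
  have hnzd : χ (algebraMap A R x) ∈ nonZeroDivisors R' := by
    rw [hχ]; exact h'.nzd
  ext r
  rw [RingHom.mem_ker, Ideal.mem_span_singleton]
  constructor
  · intro hr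
    -- After clearing denominators, r times a power of x is a multiple of f, hence of F; as x is
    -- prime and does not divide F, that power cancels.
    obtain ⟨N, a, -, ha⟩ := h.exists_frac r
    have h1 : algebraMap (A ⧸ Ideal.span {f}) R' (Ideal.Quotient.mk _ a) = 0 := by
      rw [← hχ, ← ha, map_mul, hr, mul_zero]
    obtain ⟨M, hM⟩ := h'.eq_zero _ h1
    rw [← map_pow, ← map_mul, Ideal.Quotient.eq_zero_iff_mem, Ideal.mem_span_singleton] at hM
    obtain ⟨w, hw⟩ := hM
    refine dvd_of_dvd_pow_mul h.nzd hx hFx (N := M + N)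
      ⟨algebraMap A R x ^ m * algebraMap A R w, ?_⟩
    rw [pow_add, mul_assoc, ha, ← map_pow, ← map_mul, hw, map_mul, hF]
    ring
  · rintro ⟨w, rfl⟩
    have h1 : χ F = 0 := by
      refine mul_left_cancel_of_nzd hnzd (m := m) ?_
      rw [mul_zero, ← map_pow, ← map_mul, ← hF, hχ,
        Ideal.Quotient.eq_zero_iff_mem.mpr (Ideal.mem_span_singleton_self f), map_zero]
    rw [map_mul, h1, zero_mul]

lemma IsBlowupChart.surjective {J : Ideal A} {R' : Type*} [CommRing R'] [Algebra (A ⧸ J) R']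
    (h : IsBlowupChart I x R)
    (h' : IsBlowupChart (I.map (Ideal.Quotient.mk J)) (Ideal.Quotient.mk _ x) R')
    {χ : R →+* R'} (hχ : ∀ a, χ (algebraMap A R a) =
      algebraMap (A ⧸ J) R' (Ideal.Quotient.mk _ a)) : Function.Surjective χ := by
  intro r'
  obtain ⟨m, b, hb, hbr⟩ := h'.exists_frac r'
  rw [← Ideal.map_pow] at hb
  obtain ⟨a, ha, rfl⟩ := (Ideal.mem_map_iff_of_surjective _ Ideal.Quotient.mk_surjective).mp hb
  have h1 : algebraMap A R a ∈ Ideal.span {algebraMap A R x ^ m} := by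
    rw [← Ideal.span_singleton_pow, ← h.map_eq, ← Ideal.map_pow]
    exact Ideal.mem_map_of_mem _ ha
  obtain ⟨r, hr⟩ := Ideal.mem_span_singleton.mp h1
  refine ⟨r, mul_left_cancel_of_nzd h'.nzd (m := m) ?_⟩
  rw [hbr, ← hχ, ← hχ, hr, map_mul, map_pow]

end Chart

/-! ### Normal forms along the centre -/

section NormalForm

variable {n : ℕ} {A : Type*} [CommRing A] {I : Ideal A} {t : Fin n → A}
  {S : Finset (Fin n)}

lemma exists_eq_sum_of_mem (hI : I = Ideal.span (t '' S)) {f : A} (hf : f ∈ I) :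
    ∃ b : Fin n → A, (∀ i ∉ S, b i = 0) ∧ f = ∑ i, b i * t i := by
  rw [hI] at hf
  refine Submodule.span_induction (p := fun f _ ↦ ∃ b : Fin n → A, (∀ i ∉ S, b i = 0) ∧
    f = ∑ i, b i * t i) ?_ ?_ ?_ ?_ hf
  · rintro _ ⟨i, hi, rfl⟩
    refine ⟨Pi.single i 1, fun j hj ↦ ?_, ?_⟩
    · rw [Pi.single_eq_of_ne]
      rintro rfl
      exact hj hi
    · rw [Finset.sum_eq_single i (fun j _ hj ↦ by rw [Pi.single_eq_of_ne hj, zero_mul]) (by simp),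
        Pi.single_eq_same, one_mul]
  · exact ⟨0, fun _ _ ↦ rfl, by simp⟩
  · rintro x y - - ⟨b, hb, rfl⟩ ⟨c, hc, rfl⟩
    refine ⟨b + c, fun i hi ↦ by rw [Pi.add_apply, hb i hi, hc i hi, add_zero], ?_⟩
    simp only [Pi.add_apply, add_mul, Finset.sum_add_distrib]
  · rintro a x - ⟨b, hb, rfl⟩
    refine ⟨a • b, fun i hi ↦ by rw [Pi.smul_apply, hb i hi, smul_zero], ?_⟩
    simp only [Pi.smul_apply, smul_eq_mul, Finset.mul_sum, mul_assoc]

lemma exists_eq_sum_of_mem_sq [Algebra ℂ A] (hI : I = Ideal.span (t '' S)) {f : A} (hf : f ∈ I ^ 2) :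
    ∃ a : Fin n → Fin n → A, (∀ i j, a i j = a j i) ∧ (∀ i j, j ∉ S → a i j = 0) ∧
      f = ∑ i, ∑ j, a i j * t i * t j := by
  have key : ∃ a : Fin n → Fin n → A, (∀ i j, i ∉ S ∨ j ∉ S → a i j = 0) ∧
      f = ∑ i, ∑ j, a i j * t i * t j := by
    rw [pow_two] at hf
    refine Submodule.mul_induction_on hf (fun x hx y hy ↦ ?_) ?_
    · obtain ⟨b, hb, rfl⟩ := exists_eq_sum_of_mem hI hx
      obtain ⟨c, hc, rfl⟩ := exists_eq_sum_of_mem hI hy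
      refine ⟨fun i j ↦ b i * c j, fun i j h ↦ ?_, ?_⟩
      · beta_reduce
        rcases h with h | h
        · rw [hb i h, zero_mul]
        · rw [hc j h, mul_zero]
      · rw [Finset.sum_mul_sum]
        exact Finset.sum_congr rfl fun i _ ↦ Finset.sum_congr rfl fun j _ ↦ by ring
    · rintro x y ⟨a, ha, rfl⟩ ⟨b, hb, rfl⟩
      refine ⟨fun i j ↦ a i j + b i j, fun i j h ↦ by beta_reduce; rw [ha i j h, hb i j h, add_zero], ?_⟩
      simp only [add_mul, Finset.sum_add_distrib]
  obtain ⟨a, ha, hfa⟩ := key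
  refine ⟨fun i j ↦ algebraMap ℂ A 2⁻¹ * (a i j + a j i), fun i j ↦ by beta_reduce; rw [add_comm],
    fun i j hj ↦ by beta_reduce; rw [ha i j (.inr hj), ha j i (.inl hj), add_zero, mul_zero], ?_⟩
  have h1 : ∑ i, ∑ j, algebraMap ℂ A 2⁻¹ * (a i j + a j i) * t i * t j =
      algebraMap ℂ A 2⁻¹ * (∑ i, ∑ j, a i j * t i * t j + ∑ i, ∑ j, a j i * t i * t j) := by
    simp only [Finset.mul_sum, ← Finset.sum_add_distrib]
    exact Finset.sum_congr rfl fun i _ ↦ Finset.sum_congr rfl fun j _ ↦ by ring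
  have h2 : ∑ i, ∑ j, a j i * t i * t j = f := by
    rw [Finset.sum_comm, hfa]
    exact Finset.sum_congr rfl fun i _ ↦ Finset.sum_congr rfl fun j _ ↦ by ring
  have h3 : algebraMap ℂ A 2⁻¹ * 2 = 1 := by
    rw [← map_ofNat (algebraMap ℂ A) 2, ← map_mul, inv_mul_cancel₀ two_ne_zero, map_one]
  rw [h1, h2, ← hfa, ← two_mul, ← mul_assoc, h3, one_mul]

end NormalForm

/-- `f` vanishes to first order everywhere on the centre `t_i = 0`, `i ∈ S`, or it vanishes to
second order along the centre. -/
def HasNormalForm {n : ℕ} {A : Type*} [CommRing A] (t : Fin n → A) (S : Finset (Fin n)) (f : A) :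
    Prop :=
  (∃ b : Fin n → A, (∀ i ∉ S, b i = 0) ∧ (∃ i ∈ S, IsUnit (b i)) ∧ f = ∑ i, b i * t i) ∨
  ∃ a : Fin n → Fin n → A, (∀ i j, a i j = a j i) ∧ (∀ i j, j ∉ S → a i j = 0) ∧
    f = ∑ i, ∑ j, a i j * t i * t j

/-- If f is not in I², some coefficient b_i lies outside I and is invertible near the generic point
of the centre. The conclusion holds for every ring inverting u, so that u can be inverted together
with other denominators. -/
lemma exists_hasNormalForm {n : ℕ} {A : Type*} [CommRing A] [Algebra ℂ A] {I : Ideal A} [I.IsPrime]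
    {t : Fin n → A} {S : Finset (Fin n)} (hI : I = Ideal.span (t '' S)) {f : A} (hf : f ∈ I) :
    ∃ u ∉ I, ∀ {A' : Type} [CommRing A'] (ρ : A →+* A'), IsUnit (ρ u) →
      HasNormalForm (fun i ↦ ρ (t i)) S (ρ f) := by
  by_cases hf2 : f ∈ I ^ 2
  · obtain ⟨a, ha, haS, hfa⟩ := exists_eq_sum_of_mem_sq hI hf2
    refine ⟨1, (Ideal.ne_top_iff_one I).mp (Ideal.IsPrime.ne_top ‹_›), fun ρ _ ↦
      .inr ⟨fun i j ↦ ρ (a i j), fun i j ↦ by beta_reduce; rw [ha], fun i j hj ↦ by beta_reduce; rw [haS i j hj, map_zero],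
        ?_⟩⟩
    rw [hfa]
    simp only [map_sum, map_mul]
  · obtain ⟨b, hb, hfb⟩ := exists_eq_sum_of_mem hI hf
    have : ∃ i ∈ S, b i ∉ I := by
      by_contra! h
      refine hf2 ?_
      rw [hfb, pow_two]
      refine sum_mem fun i _ ↦ ?_
      by_cases hi : i ∈ S
      · exact Ideal.mul_mem_mul (h i hi) (hI ▸ Ideal.subset_span ⟨i, hi, rfl⟩)
      · rw [hb i hi, zero_mul]; exact zero_mem _
    obtain ⟨i, hi, hbi⟩ := this
    refine ⟨b i, hbi, fun ρ hu ↦ .inl ⟨fun i ↦ ρ (b i), fun i hi ↦ by beta_reduce; rw [hb i hi, map_zero],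
      ⟨i, hi, hu⟩, ?_⟩⟩
    rw [hfb]
    simp only [map_sum, map_mul]

section Main

variable {n : ℕ} {A R : Type} [CommRing A] [Algebra (Poly n) A] [CommRing R] [Algebra A R]
  {S : Finset (Fin n)} {k : Fin n} [Algebra ℂ A] [IsScalarTower ℂ (Poly n) A] [Algebra ℂ R]
  [IsScalarTower ℂ A R]

/-- The strict transform in a chart has at most quadratic points. -/
theorem BlowupCoordinates.hasQuadraticPoints [Algebra.Etale (Poly n) A]
    (c : BlowupCoordinates S k A R) (hk : k ∈ S) {I : Ideal A}
    (h : IsBlowupChart I (algebraMap (Poly n) A (X k)) R) {f : A} {F : R} {m r : ℕ}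
    (hF : algebraMap A R f = algebraMap A R (algebraMap (Poly n) A (X k)) ^ m * F)
    (hFt : ¬ algebraMap A R (algebraMap (Poly n) A (X k)) ∣ F)
    (hf : HasQuadraticPoints f n r)
    (hnf : HasNormalForm (fun i ↦ algebraMap (Poly n) A (X i)) S f) : HasQuadraticPoints F n r := by
  intro ε hε
  by_cases hεk : ε (algebraMap A R (algebraMap (Poly n) A (X k))) = 0
  · rcases hnf with ⟨b, hb, hb', hfb⟩ | ⟨a, ha, haS, hfa⟩
    · exact .inl (c.not_mem_sq_of_eq_sum hk h.nzd hF hFt hb hb' hfb ε hεk)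
    · by_cases hsq : F ∈ RingHom.ker ε ^ 2
      · exact .inr (c.quadratic_of_eq_sum hk h.nzd hf hF hFt ha haS hfa ε hεk hsq)
      · exact .inl hsq
  · exact h.quadratic_of_ne_zero hF hf ε hεk hε

end Main

end

/-! ### Local rings of affine charts -/

lemma SpecMap_inv_stalkMap_comp {A : Type} [CommRing A] {Y : Scheme.{0}} (e : Spec (.of A) ⟶ Y)
    [IsOpenImmersion e] (P : Spec (.of A)) :
    Spec.map (((Scheme.ΓSpecIso (.of A)).inv ≫ (Spec (.of A)).presheaf.germ ⊤ P trivial) ≫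
      inv (e.stalkMap P)) ≫ e = Y.fromSpecStalk (e P) := by
  rw [Spec.map_comp, Category.assoc, ← Spec.fromSpecStalk_eq,
    ← Scheme.SpecMap_stalkMap_fromSpecStalk, ← Spec.map_comp_assoc, IsIso.hom_inv_id, Spec.map_id,
    Category.id_comp]

/-- The local ring of a scheme at a point of an affine chart. -/
lemma exists_stalk_equiv {A : Type} [CommRing A] {Y : Scheme.{0}} (e : Spec (.of A) ⟶ Y)
    [IsOpenImmersion e] (P : PrimeSpectrum A) {y : Y} (hy : e P = y) :
    ∃ η : Localization.AtPrime P.asIdeal ≃+* Y.presheaf.stalk y,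
      Spec.map (CommRingCat.ofHom (η.toRingHom.comp (algebraMap A _))) ≫ e =
        Y.fromSpecStalk y := by
  subst hy
  have hiso : ∀ P : Spec (.of A), IsIso (e.stalkMap P) := fun _ ↦ inferInstance
  have := hiso P
  let η : CommRingCat.of (Localization.AtPrime P.asIdeal) ≅ Y.presheaf.stalk (e P) :=
    (Spec.stalkIso (.of A) P).symm ≪≫ (asIso (e.stalkMap P)).symm
  refine ⟨η.commRingCatIsoToRingEquiv, ?_⟩
  have h1 : CommRingCat.ofHom (η.commRingCatIsoToRingEquiv.toRingHom.comp
      (algebraMap A (Localization.AtPrime P.asIdeal))) =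
      CommRingCat.ofHom (algebraMap A (Localization.AtPrime P.asIdeal)) ≫ η.hom := rfl
  have h2 : CommRingCat.ofHom (algebraMap A (Localization.AtPrime P.asIdeal)) ≫ η.hom =
      ((Scheme.ΓSpecIso (.of A)).inv ≫ (Spec (.of A)).presheaf.germ ⊤ P trivial) ≫
        inv (e.stalkMap P) := by
    rw [← Spec.algebraMap_stalkIso_inv, Category.assoc]; rfl
  rw [h1, h2]
  exact SpecMap_inv_stalkMap_comp e P

lemma SpecMap_constants {Y : Scheme.{0}} (s : Y ⟶ SpecC) (y : Y) :
    Spec.map (CommRingCat.ofHom (constants s y)) = Y.fromSpecStalk y ≫ s := by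
  have h : CommRingCat.ofHom (constants s y) = (Scheme.ΓSpecIso (.of ℂ)).inv ≫ s.appTop ≫
    Y.presheaf.germ ⊤ y trivial := rfl
  rw [h, Spec.map_comp, Spec.map_comp, ← Scheme.fromSpecStalk_toSpecΓ, Category.assoc,
    Category.assoc, ← Scheme.toSpecΓ_naturality_assoc, ← SpecMap_ΓSpecIso_hom, ← Spec.map_comp,
    Iso.inv_hom_id, Spec.map_id, Category.comp_id]

/-! ### Smooth points -/

lemma isSmoothPoint_iff_mem {X : Scheme.{0}} {f : X ⟶ SpecC} [LocallyOfFinitePresentation f]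
    {x : X} : IsSmoothPoint f x ↔ x ∈ f.smoothLocus := by
  constructor
  · rintro ⟨V, hV, h⟩
    have h1 := (V.ι ≫ f).smoothLocus_eq_top
    rw [← Scheme.Hom.preimage_smoothLocus_eq] at h1
    exact h1.ge (Set.mem_univ (⟨x, hV⟩ : V))
  · refine fun h ↦ ⟨f.smoothLocus, h, ?_⟩
    rw [← Scheme.Hom.smoothLocus_eq_top_iff, ← Scheme.Hom.preimage_smoothLocus_eq]
    exact top_le_iff.mp fun y _ ↦ y.2

/-- The smooth locus is tested on stalks over the local ring of the base; localizing ℂ is formally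
étale, so ℂ itself may be used as base. -/
lemma mem_smoothLocus_spec_iff {C : Type} [CommRing C] [Algebra ℂ C]
    [LocallyOfFinitePresentation (Spec.map (CommRingCat.ofHom (algebraMap ℂ C)))]
    (Q : PrimeSpectrum C) :
    Q ∈ (Spec.map (CommRingCat.ofHom (algebraMap ℂ C))).smoothLocus ↔
      Algebra.FormallySmooth ℂ (Localization.AtPrime Q.asIdeal) := by
  let q := Q.asIdeal
  let p : Ideal ℂ := (Q.comap (algebraMap ℂ C)).asIdeal
  have hp : p.IsPrime := (Q.comap (algebraMap ℂ C)).2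
  have : q.LiesOver p := ⟨rfl⟩
  let := Localization.AtPrime.algebraOfLiesOver p q
  have : Algebra.FormallyEtale ℂ (Localization.AtPrime p) :=
    Algebra.FormallyEtale.of_isLocalization p.primeCompl
  refine Scheme.Hom.mem_smoothLocus.trans ?_
  trans Algebra.FormallySmooth (Localization.AtPrime p) (Localization.AtPrime q)
  · rw [← RingHom.formallySmooth_algebraMap]
    exact RingHom.FormallySmooth.respectsIso.arrow_mk_iso_iff
      (Scheme.arrowStalkMapSpecIso (CommRingCat.ofHom (algebraMap ℂ C)) Q)
  · exact Algebra.FormallySmooth.iff_restrictScalars.symm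

/-! ### Generic points -/

lemma closure_mem_irreducibleComponents_iff {X : Scheme.{0}} (x : X) :
    closure {x} ∈ irreducibleComponents X ↔ Order.coheight x = 0 := by
  rw [Order.coheight_eq_zero]
  constructor
  · intro h z hz
    have hz : z ⤳ x := hz
    have h1 : closure {z} ⊆ closure {x} :=
      h.2 isIrreducible_singleton.closure (specializes_iff_closure_subset.mp hz)
    exact specializes_iff_closure_subset.mpr h1
  · refine fun h ↦ ⟨isIrreducible_singleton.closure, fun T hT hxT ↦ ?_⟩
    obtain ⟨z, hz⟩ := QuasiSober.sober hT.closure isClosed_closure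
    have h1 : z ⤳ x := by
      rw [specializes_iff_mem_closure, hz.def]
      exact subset_closure (hxT (subset_closure rfl))
    have h2 : x ⤳ z := h h1
    exact subset_closure.trans (hz.def.ge.trans (specializes_iff_closure_subset.mp h2))

lemma coheight_chart {A : Type} [CommRing A] {Y : Scheme.{0}} (e : Spec (.of A) ⟶ Y)
    [IsOpenImmersion e] (P : PrimeSpectrum A) : Order.coheight (e P) = P.asIdeal.height :=
  (coheight_eq_of_isOpenImmersion e (x := P)).trans (idealHeight_eq_coheight (.of A) P).symm

/-! ### A closed subscheme and its ambient variety in a common affine chart. -/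

section Pair

lemma mem_map_toRingHom_iff {R S : Type*} [CommRing R] [CommRing S] (η : R ≃+* S) (I : Ideal R)
    (v : R) : η v ∈ I.map η.toRingHom ↔ v ∈ I := by
  refine (Ideal.mem_map_of_equiv η _).trans ?_
  exact ⟨fun ⟨x, hx, hxv⟩ ↦ η.injective hxv ▸ hx, fun h ↦ ⟨v, h, rfl⟩⟩

variable {A C : Type} [CommRing A] [CommRing C]

lemma mem_ker_of_isLocalization {O O' : Type*} [CommRing O] [CommRing O']
    {χ : A →+* C} (hχ : Function.Surjective χ) {Q : Ideal C} [Q.IsPrime] {p : Ideal A} [p.IsPrime]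
    (hQ : Q.comap χ = p) [Algebra A O] [IsLocalization.AtPrime O p] [Algebra C O']
    [IsLocalization.AtPrime O' Q] {σ : O →+* O'}
    (hσ : σ.comp (algebraMap A O) = (algebraMap C O').comp χ) :
    RingHom.ker σ = (RingHom.ker χ).map (algebraMap A O) := by
  subst hQ
  have h (a : A) : σ (algebraMap A O a) = algebraMap C O' (χ a) := congr($hσ a)
  refine le_antisymm (fun w hw ↦ ?_) (Ideal.map_le_iff_le_comap.mpr fun a ha ↦ ?_)
  · obtain ⟨⟨a, u⟩, hau⟩ := IsLocalization.surj (Q.comap χ).primeCompl w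
    have h0 : algebraMap C O' (χ a) = 0 := by
      rw [← h, ← hau, map_mul, RingHom.mem_ker.mp hw, zero_mul]
    obtain ⟨v, hv⟩ := (IsLocalization.map_eq_zero_iff Q.primeCompl O' _).mp h0
    obtain ⟨c, hc⟩ := hχ v
    have hc' : c ∈ (Q.comap χ).primeCompl := fun hcQ ↦ v.2 (by rw [← hc]; exact hcQ)
    have h1 : algebraMap A O (c * a) ∈ (RingHom.ker χ).map (algebraMap A O) :=
      Ideal.mem_map_of_mem _ (by rw [RingHom.mem_ker, map_mul, hc, hv])
    rw [map_mul, ← hau] at h1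
    exact (Ideal.mul_unit_mem_iff_mem _ (IsLocalization.map_units O u)).mp
      ((Ideal.unit_mul_mem_iff_mem _ (IsLocalization.map_units O (⟨c, hc'⟩ :
        (Q.comap χ).primeCompl))).mp h1)
  · rw [Ideal.mem_comap, RingHom.mem_ker, h, RingHom.mem_ker.mp ha, map_zero]

variable [Algebra ℂ A] [Algebra ℂ C] {X Y : Scheme.{0}} {s : Y ⟶ SpecC} {i : X ⟶ Y}
  {e : Spec (.of A) ⟶ Y} {e' : Spec (.of C) ⟶ X} [IsOpenImmersion e] [IsOpenImmersion e']
  {χ : A →ₐ[ℂ] C}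

/-- The local rings at a point of a closed subscheme in terms of an affine chart. -/
lemma exists_stalk_equiv_of_comp_eq (hχ : Function.Surjective χ)
    (he : e ≫ s = Spec.map (CommRingCat.ofHom (algebraMap ℂ A)))
    (hc : e' ≫ i = Spec.map (CommRingCat.ofHom χ.toRingHom) ≫ e)
    {ε : A →ₐ[ℂ] ℂ} {Q : PrimeSpectrum C} (hQ : Q.asIdeal.comap χ.toRingHom = RingHom.ker ε) :
    ∃ η : Localization.AtPrime (RingHom.ker ε) ≃+* Y.presheaf.stalk (i (e' Q)),
      (∀ z, η (algebraMap ℂ _ z) = constants s _ z) ∧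
      RingHom.ker (i.stalkMap (e' Q)).hom =
        ((RingHom.ker χ.toRingHom).map (algebraMap A _)).map η.toRingHom := by
  let P : PrimeSpectrum A := ⟨RingHom.ker ε, inferInstance⟩
  have hP : Spec.map (CommRingCat.ofHom χ.toRingHom) Q = P := PrimeSpectrum.ext hQ
  have hy : e P = i (e' Q) := by
    rw [← hP]
    exact (congr($(hc) Q)).symm
  obtain ⟨η, hη⟩ := exists_stalk_equiv e P hy
  obtain ⟨η', hη'⟩ := exists_stalk_equiv e' Q rfl
  have hconst : constants s (i (e' Q)) = (η.toRingHom.comp (algebraMap A _)).comp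
      (algebraMap ℂ A) := by
    have : Spec.map (CommRingCat.ofHom (constants s (i (e' Q)))) = Spec.map (CommRingCat.ofHom
        ((η.toRingHom.comp (algebraMap A _)).comp (algebraMap ℂ A))) := by
      rw [SpecMap_constants, ← hη, Category.assoc, he, ← Spec.map_comp]
      rfl
    exact congr(CommRingCat.Hom.hom $(Spec.map_injective this))
  have hstalk : (i.stalkMap (e' Q)).hom.comp (η.toRingHom.comp (algebraMap A _)) =
      (η'.toRingHom.comp (algebraMap C _)).comp χ.toRingHom := by
    have : Spec.map (CommRingCat.ofHom (η.toRingHom.comp (algebraMap A _)) ≫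
        i.stalkMap (e' Q)) = Spec.map (CommRingCat.ofHom χ.toRingHom ≫
        CommRingCat.ofHom (η'.toRingHom.comp (algebraMap C _))) := by
      rw [Spec.map_comp, Spec.map_comp, ← cancel_mono e, Category.assoc, Category.assoc, hη,
        ← hc, Scheme.SpecMap_stalkMap_fromSpecStalk, reassoc_of% hη']
    exact congr(CommRingCat.Hom.hom $(Spec.map_injective this))
  refine ⟨η, fun z ↦ congr($hconst z).symm, ?_⟩
  let σ : Localization.AtPrime (RingHom.ker ε) →+* Localization.AtPrime Q.asIdeal :=
    η'.symm.toRingHom.comp ((i.stalkMap (e' Q)).hom.comp η.toRingHom)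
  have hσ : σ.comp (algebraMap A _) = (algebraMap C _).comp χ.toRingHom := by
    ext a
    exact η'.symm_apply_eq.mpr congr($hstalk a)
  have hker := mem_ker_of_isLocalization (χ := χ.toRingHom) hχ hQ hσ
  rw [← hker]
  ext w
  obtain ⟨v, rfl⟩ := η.surjective w
  refine Iff.trans ?_ (mem_map_toRingHom_iff η (RingHom.ker σ) v).symm
  rw [RingHom.mem_ker, RingHom.mem_ker]
  exact (map_eq_zero_iff η'.symm η'.symm.injective).symm

/-- Analytic coordinates on A extend to the local ring because functions not vanishing at ε become
germs with nonzero value, which are units. -/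
lemma exists_coordinates_iff {S : Type*} [CommRing S] [IsLocalRing S] {c : ℂ →+* S} {K : Ideal S}
    {J : Ideal A} {ε : A →ₐ[ℂ] ℂ} (η : Localization.AtPrime (RingHom.ker ε) ≃+* S)
    (hc : ∀ z, η (algebraMap ℂ _ z) = c z)
    (hK : K = (J.map (algebraMap A _)).map η.toRingHom) {n r : ℕ} :
    (∃ φ : S →+* HolGerm n, (∀ z, φ (c z) = HolGerm.const z) ∧
      (IsLocalRing.maximalIdeal S).map φ = HolGerm.maxIdeal n ∧
      ∃ M : Matrix (Fin n) (Fin n) ℂ, M.IsSymm ∧ M.rank = r ∧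
        ∃ θ, θ - HolGerm.quad M ∈ HolGerm.maxIdeal n ^ 3 ∧ K.map φ = Ideal.span {θ}) ↔
    IsQuadraticAt J ε n r := by
  let O := Localization.AtPrime (RingHom.ker ε)
  have hm : IsLocalRing.maximalIdeal S =
      ((RingHom.ker ε).map (algebraMap A O)).map η.toRingHom := by
    rw [IsLocalization.AtPrime.map_eq_maximalIdeal (RingHom.ker ε) O]
    exact (IsLocalRing.map_ringEquiv_maximalIdeal η).symm
  constructor
  · rintro ⟨φ, hφ, hφm, M, hM, hr, θ, hθ, hKθ⟩
    let φ' : A →ₐ[ℂ] HolGerm n :=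
      { (φ.comp η.toRingHom).comp (algebraMap A O) with
        commutes' := fun z ↦ by
          have : algebraMap A O (algebraMap ℂ A z) = algebraMap ℂ O z :=
            (IsScalarTower.algebraMap_apply ℂ A O z).symm
          exact (congrArg (fun w ↦ φ (η w)) this).trans ((congrArg φ (hc z)).trans (hφ z)) }
    have hφ' (I : Ideal A) : I.map φ' = ((I.map (algebraMap A O)).map η.toRingHom).map φ := by
      rw [Ideal.map_map, Ideal.map_map]; rfl
    exact ⟨φ', by rw [hφ', ← hm, hφm], M, hM, hr, θ, hθ, by rw [hφ', ← hK, hKθ]⟩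
  · rintro ⟨φ, hφm, M, hM, hr, θ, hθ, hJθ⟩
    have hu (u : (RingHom.ker ε).primeCompl) : IsUnit (φ.toRingHom u) := by
      refine HolGerm.isUnit_iff.mpr ?_
      have := eval_eq_of_map_ker_le hφm.le u.1
      exact fun h ↦ u.2 (this.symm.trans h)
    let φ' : O →+* HolGerm n := IsLocalization.lift (M := (RingHom.ker ε).primeCompl) hu
    have hφa (a : A) : φ' (algebraMap A O a) = φ a := IsLocalization.lift_eq hu a
    have hφ' (I : Ideal A) : I.map φ = ((I.map (algebraMap A O)).map η.toRingHom).map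
        (φ'.comp η.symm.toRingHom) := by
      rw [Ideal.map_map, Ideal.map_map]
      refine congrArg (fun f : A →+* HolGerm n ↦ I.map f) (RingHom.ext fun a ↦ ?_)
      exact (hφa a).symm.trans (congrArg φ' (η.symm_apply_apply _).symm)
    refine ⟨φ'.comp η.symm.toRingHom, fun z ↦ ?_, by rw [hm, ← hφ', hφm], M, hM, hr, θ, hθ,
      by rw [hK, ← hφ', hJθ]⟩
    refine (congrArg φ' (η.symm_apply_eq.mpr (hc z).symm)).trans ?_
    rw [IsScalarTower.algebraMap_apply ℂ A O, hφa]
    exact φ.commutes z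

lemma isBigO_sub_quad_iff {n : ℕ} {g : (Fin n → ℂ) → ℂ} (hg : AnalyticAt ℂ g 0)
    (M : Matrix (Fin n) (Fin n) ℂ) :
    (fun z ↦ g z - z ⬝ᵥ M.mulVec z) =O[𝓝 0] (fun z : Fin n → ℂ ↦ ‖z‖ ^ 3) ↔
      HolGerm.mk g hg - HolGerm.quad M ∈ HolGerm.maxIdeal n ^ 3 := by
  rw [HolGerm.mem_maxIdeal_pow_iff]
  refine isBigO_congr ?_ .rfl
  filter_upwards [HolGerm.rep_sub (HolGerm.mk g hg) (HolGerm.quad M), HolGerm.rep_mk hg,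
    HolGerm.rep_quad M] with z h1 h2 h3
  rw [h1, Pi.sub_apply, h2, h3]

/-- Quadratic points in terms of an affine chart. -/
lemma isQuadraticPoint_iff (hχ : Function.Surjective χ)
    (he : e ≫ s = Spec.map (CommRingCat.ofHom (algebraMap ℂ A)))
    (hc : e' ≫ i = Spec.map (CommRingCat.ofHom χ.toRingHom) ≫ e)
    {ε : A →ₐ[ℂ] ℂ} {Q : PrimeSpectrum C} (hQ : Q.asIdeal.comap χ.toRingHom = RingHom.ker ε)
    {n r : ℕ} :
    IsQuadraticPoint s n i r (e' Q) ↔ IsQuadraticAt (RingHom.ker χ.toRingHom) ε n r := by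
  obtain ⟨η, hη, hK⟩ := exists_stalk_equiv_of_comp_eq hχ he hc hQ
  refine Iff.trans ?_ (exists_coordinates_iff η hη hK)
  refine exists_congr fun φ ↦ ⟨?_, ?_⟩
  · rintro ⟨⟨h1, h2⟩, M, hM, hr, g, hg, hgO, hgK⟩
    exact ⟨h1, h2, M, hM, hr, _, (isBigO_sub_quad_iff hg M).mp hgO, hgK⟩
  · rintro ⟨h1, h2, M, hM, hr, θ, hθ, hθK⟩
    rw [← HolGerm.mk_rep θ] at hθ hθK
    exact ⟨⟨h1, h2⟩, M, hM, hr, _, _, (isBigO_sub_quad_iff _ M).mpr hθ, hθK⟩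

omit [IsOpenImmersion e] in
/-- Smooth points in terms of an affine chart. -/
lemma isSmoothPoint_iff [LocallyOfFinitePresentation (i ≫ s)] (hχ : Function.Surjective χ)
    (he : e ≫ s = Spec.map (CommRingCat.ofHom (algebraMap ℂ A)))
    (hc : e' ≫ i = Spec.map (CommRingCat.ofHom χ.toRingHom) ≫ e)
    {ε : A →ₐ[ℂ] ℂ} {Q : PrimeSpectrum C} (hQ : Q.asIdeal.comap χ.toRingHom = RingHom.ker ε) :
    IsSmoothPoint (i ≫ s) (e' Q) ↔
      Algebra.FormallySmooth ℂ (Localization.AtPrime (RingHom.ker ε) ⧸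
        (RingHom.ker χ.toRingHom).map (algebraMap A (Localization.AtPrime (RingHom.ker ε)))) := by
  have h : e' ≫ i ≫ s = Spec.map (CommRingCat.ofHom (algebraMap ℂ C)) := by
    rw [reassoc_of% hc, he, ← Spec.map_comp]
    exact congrArg (fun t ↦ Spec.map (CommRingCat.ofHom t)) χ.comp_algebraMap
  have hfp : LocallyOfFinitePresentation (Spec.map (CommRingCat.ofHom (algebraMap ℂ C))) :=
    h ▸ inferInstance
  refine isSmoothPoint_iff_mem.trans ?_
  have h1 : e' Q ∈ (i ≫ s).smoothLocus ↔
      Q ∈ (Spec.map (CommRingCat.ofHom (algebraMap ℂ C))).smoothLocus := by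
    have h2 := Scheme.Hom.preimage_smoothLocus_eq e' (i ≫ s)
    simp only [h] at h2
    rw [← h2]
    rfl
  refine h1.trans ((mem_smoothLocus_spec_iff Q).trans ?_)
  let O := Localization.AtPrime (RingHom.ker ε)
  let τ : O →ₐ[ℂ] Localization.AtPrime Q.asIdeal :=
    { Localization.localRingHom (RingHom.ker ε) Q.asIdeal χ.toRingHom hQ.symm with
      commutes' := fun z ↦ by
        have := Localization.localRingHom_to_map (RingHom.ker ε) Q.asIdeal χ.toRingHom hQ.symm
          (algebraMap ℂ A z)
        rw [← IsScalarTower.algebraMap_apply ℂ A O] at this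
        refine this.trans ?_
        refine (congrArg (algebraMap C _) (χ.commutes z)).trans ?_
        exact (IsScalarTower.algebraMap_apply ℂ C _ z).symm }
  have hτ (a : A) : τ (algebraMap A O a) = algebraMap C _ (χ a) :=
    Localization.localRingHom_to_map (RingHom.ker ε) Q.asIdeal χ.toRingHom hQ.symm a
  have hker : RingHom.ker τ = (RingHom.ker χ.toRingHom).map (algebraMap A O) :=
    mem_ker_of_isLocalization (χ := χ.toRingHom) (σ := τ.toRingHom) hχ hQ (RingHom.ext hτ)
  have hsurj : Function.Surjective τ := by
    intro w
    obtain ⟨⟨c, v⟩, hcv⟩ := IsLocalization.surj Q.asIdeal.primeCompl w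
    obtain ⟨a, rfl⟩ := hχ c
    obtain ⟨u, hu⟩ := hχ v
    have hu' : u ∈ (RingHom.ker ε).primeCompl := fun h ↦ v.2 (by
      rw [← hu]; exact (hQ.ge h :))
    obtain ⟨b, hb⟩ := IsLocalization.map_units O (⟨u, hu'⟩ : (RingHom.ker ε).primeCompl)
    refine ⟨algebraMap A O a * (b⁻¹ : Oˣ), ?_⟩
    have h3 : algebraMap C (Localization.AtPrime Q.asIdeal) v = τ b := by
      rw [hb, hτ, ← hu]
    refine (IsLocalization.map_units (Localization.AtPrime Q.asIdeal) v).mul_right_cancel ?_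
    rw [hcv, map_mul, h3, mul_assoc, ← map_mul, Units.inv_mul, map_one, mul_one, hτ]
  exact (Algebra.FormallySmooth.iff_of_equiv ((Ideal.quotientEquivAlgOfEq ℂ hker.symm).trans
    (Ideal.quotientKerAlgEquivOfSurjective hsurj))).symm

lemma HasAtMostQuadraticPoints.hasQuadraticSingularities [JacobsonSpace X]
    [LocallyOfFinitePresentation (i ≫ s)] {n r : ℕ} (h : HasAtMostQuadraticPoints s n i r)
    (hχ : Function.Surjective χ)
    (he : e ≫ s = Spec.map (CommRingCat.ofHom (algebraMap ℂ A)))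
    (hc : e' ≫ i = Spec.map (CommRingCat.ofHom χ.toRingHom) ≫ e) :
    HasQuadraticSingularities (RingHom.ker χ.toRingHom) n r := by
  intro ε hε
  let ε' : C →+* ℂ := χ.toRingHom.liftOfSurjective hχ ⟨ε.toRingHom, hε⟩
  have hε' (a : A) : ε' (χ a) = ε a := RingHom.liftOfRightInverse_comp_apply _ _ _ _ a
  have hmax : (RingHom.ker ε').IsMaximal := by
    refine RingHom.ker_isMaximal_of_surjective ε' fun z ↦ ⟨χ (algebraMap ℂ A z), ?_⟩
    rw [hε', ε.commutes]; rfl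
  let Q : PrimeSpectrum C := ⟨RingHom.ker ε', hmax.isPrime⟩
  have hQ : Q.asIdeal.comap χ.toRingHom = RingHom.ker ε := by
    ext a
    exact (hε' a ▸ Iff.rfl : ε' (χ a) = 0 ↔ ε a = 0)
  -- In a Jacobson space a point closed in an open subset is closed.
  have hcl : IsClosed ({e' Q} : Set X) := by
    have h1 := e'.isOpenEmbedding.preimage_closedPoints
    have h2 : Q ∈ closedPoints (PrimeSpectrum C) :=
      (PrimeSpectrum.isClosed_singleton_iff_isMaximal Q).mpr hmax
    exact h1.ge h2
  refine (h (e' Q) hcl).imp (isSmoothPoint_iff hχ he hc hQ).mp ?_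
  exact fun ⟨r', hr, hq⟩ ↦ ⟨r', hr, (isQuadraticPoint_iff hχ he hc hQ).mp hq⟩

/-- The Nullstellensatz: closed points of a complex algebra of finite type are ℂ-points. -/
lemma exists_ker_eq_of_isMaximal [Algebra.FiniteType ℂ A] (p : Ideal A) [p.IsMaximal] :
    ∃ ε : A →ₐ[ℂ] ℂ, RingHom.ker ε = p := by
  let := Ideal.Quotient.field p
  have : Module.Finite ℂ (A ⧸ p) := finite_of_finite_type_of_isJacobsonRing ℂ (A ⧸ p)
  have hb := IsAlgClosed.algebraMap_bijective_of_isIntegral (k := ℂ) (K := A ⧸ p)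
  let τ : ℂ ≃ₐ[ℂ] A ⧸ p := AlgEquiv.ofBijective (Algebra.ofId ℂ (A ⧸ p)) hb
  refine ⟨τ.symm.toAlgHom.comp (Ideal.Quotient.mkₐ ℂ p), ?_⟩
  ext a
  refine (map_eq_zero_iff τ.symm τ.symm.injective).trans ?_
  exact Ideal.Quotient.eq_zero_iff_mem

lemma HasQuadraticSingularities.of_isClosed [Algebra.FiniteType ℂ A]
    [LocallyOfFinitePresentation (i ≫ s)] {n r : ℕ} (hχ : Function.Surjective χ)
    (he : e ≫ s = Spec.map (CommRingCat.ofHom (algebraMap ℂ A)))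
    (hc : e' ≫ i = Spec.map (CommRingCat.ofHom χ.toRingHom) ≫ e)
    (h : HasQuadraticSingularities (RingHom.ker χ.toRingHom) n r) {Q : PrimeSpectrum C}
    (hcl : IsClosed ({e' Q} : Set X)) :
    IsSmoothPoint (i ≫ s) (e' Q) ∨ ∃ r' : ℕ, r ≤ r' ∧ IsQuadraticPoint s n i r' (e' Q) := by
  have hmax : Q.asIdeal.IsMaximal := by
    rw [← PrimeSpectrum.isClosed_singleton_iff_isMaximal]
    exact preimage_closedPoints_subset e'.isOpenEmbedding.injective e'.continuous hcl
  have hmax' : (Q.asIdeal.comap χ.toRingHom).IsMaximal :=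
    Ideal.comap_isMaximal_of_surjective χ.toRingHom hχ
  obtain ⟨ε, hε⟩ := exists_ker_eq_of_isMaximal (Q.asIdeal.comap χ.toRingHom)
  have hle : RingHom.ker χ.toRingHom ≤ RingHom.ker ε := by
    rw [hε]
    exact Ideal.comap_mono bot_le
  refine (h ε hle).imp (isSmoothPoint_iff hχ he hc hε.symm).mpr ?_
  exact fun ⟨r', hr, hq⟩ ↦ ⟨r', hr, (isQuadraticPoint_iff hχ he hc hε.symm).mpr hq⟩

lemma mem_minimalPrimes_iff_of_comp_eq (hχ : Function.Surjective χ) (Q : PrimeSpectrum C) :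
    closure {e' Q} ∈ irreducibleComponents X ↔
      Q.asIdeal.comap χ.toRingHom ∈ (RingHom.ker χ.toRingHom).minimalPrimes := by
  have hmin : Q.asIdeal.comap χ.toRingHom ∈ (RingHom.ker χ.toRingHom).minimalPrimes ↔
      Q.asIdeal ∈ minimalPrimes C := by
    rw [RingHom.ker_eq_comap_bot, Ideal.comap_minimalPrimes_eq_of_surjective hχ]
    exact (Ideal.comap_injective_of_surjective χ.toRingHom hχ).mem_set_image
  refine (closure_mem_irreducibleComponents_iff (e' Q)).trans (Iff.trans ?_ hmin.symm)
  rw [← Ideal.height_eq_zero_iff, ← coheight_chart e' Q]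

omit [IsOpenImmersion e'] in
lemma coheight_eq_height_of_comp_eq
    (hc : e' ≫ i = Spec.map (CommRingCat.ofHom χ.toRingHom) ≫ e) (Q : PrimeSpectrum C) :
    Order.coheight (i (e' Q)) = (Q.asIdeal.comap χ.toRingHom).height := by
  have h : i (e' Q) = e (Q.comap χ.toRingHom) := congr($(hc) Q)
  rw [h, coheight_chart]
  rfl

lemma height_eq_one_of_comp_eq
    (h : ∀ x : X, closure {x} ∈ irreducibleComponents X → Order.coheight (i x) = 1)
    (hχ : Function.Surjective χ)
    (hc : e' ≫ i = Spec.map (CommRingCat.ofHom χ.toRingHom) ≫ e) {q : Ideal A}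
    (hq : q ∈ (RingHom.ker χ.toRingHom).minimalPrimes) : q.height = 1 := by
  have hq' := hq
  rw [RingHom.ker_eq_comap_bot, Ideal.comap_minimalPrimes_eq_of_surjective hχ] at hq'
  obtain ⟨Q, hQ, rfl⟩ := hq'
  let Q' : PrimeSpectrum C := ⟨Q, hQ.isPrime⟩
  exact (coheight_eq_height_of_comp_eq hc Q').symm.trans
    (h _ ((mem_minimalPrimes_iff_of_comp_eq (e' := e') hχ Q').mpr hq))

end Pair

/-! ### Strict transforms as schemes -/

lemma specIdeal_ker {A C : Type} [CommRing A] [CommRing C] (φ : A →+* C) :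
    specIdeal (Spec.map (CommRingCat.ofHom φ)).ker = RingHom.ker φ := by
  ext a
  rw [specIdeal, Scheme.Hom.ker_apply, Ideal.mem_comap, RingHom.mem_ker, RingHom.mem_ker]
  have h := congr(($(Scheme.ΓSpecIso_inv_naturality (CommRingCat.ofHom φ))).hom a)
  refine (congrArg (· = 0) h.symm).to_iff.trans ?_
  exact map_eq_zero_iff _ (ΓSpecIso_inv_bijective (A := C)).1

namespace BlowUpAtlas

variable {A : Type} [CommRing A] {ι : Type} {x : ι → A} {J : Ideal A} (W : BlowUpAtlas x)
  (W' : BlowUpAtlas fun k ↦ Ideal.Quotient.mk J (x k))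

lemma span_range_mk : Ideal.span (Set.range fun k ↦ Ideal.Quotient.mk J (x k)) =
    (Ideal.span (Set.range x)).map (Ideal.Quotient.mk J) := by
  rw [Ideal.map_span, ← Set.range_comp]
  rfl

lemma map_quotient_eq (k : ι) :
    (Ideal.span (Set.range x)).map ((algebraMap (A ⧸ J) (W'.R k)).comp (Ideal.Quotient.mk J)) =
      Ideal.span {((algebraMap (A ⧸ J) (W'.R k)).comp (Ideal.Quotient.mk J)) (x k)} := by
  rw [← Ideal.map_map, ← span_range_mk, (W'.isBlowupChart k).map_eq]
  rfl

lemma exists_chart_hom (k : ι) : ∃ χ : W.R k →+* W'.R k,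
    ∀ a, χ (algebraMap A _ a) = algebraMap (A ⧸ J) _ (Ideal.Quotient.mk J a) := by
  let := ((algebraMap (A ⧸ J) (W'.R k)).comp (Ideal.Quotient.mk J)).toAlgebra
  obtain ⟨χ⟩ := (W.isBlowupChart k).exists_lift (C := W'.R k) (W'.isBlowupChart k).nzd
    (W'.map_quotient_eq k).le
  exact ⟨χ.toRingHom, χ.commutes⟩

/-- The ideal of the centre becomes Cartier on the blow-up of the subscheme, so the universal
property of the ambient blow-up applies. -/
lemma exists_hom : ∃ i' : W'.scheme ⟶ W.scheme,
    i' ≫ W.π = W'.π ≫ Spec.map (CommRingCat.ofHom (Ideal.Quotient.mk J)) := by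
  let K := (Spec.map (CommRingCat.ofHom (Ideal.Quotient.mk (Ideal.span (Set.range x))))).ker
  have hK : specIdeal K = Ideal.span (Set.range x) := by
    rw [specIdeal_ker, Ideal.mk_ker]
  refine W.exists_lift hK _ ?_
  rw [Scheme.IdealSheafData.comap_comp]
  refine W'.isCartier_comap_π ?_
  rw [specIdeal_comap, hK, span_range_mk]

variable {W W'} {i' : W'.scheme ⟶ W.scheme}

lemma chart_comp_eq {k : ι} {χ : W.R k →+* W'.R k}
    (hχ : ∀ a, χ (algebraMap A _ a) = algebraMap (A ⧸ J) _ (Ideal.Quotient.mk J a))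
    (hi : i' ≫ W.π = W'.π ≫ Spec.map (CommRingCat.ofHom (Ideal.Quotient.mk J))) :
    W'.chart k ≫ i' = Spec.map (CommRingCat.ofHom χ) ≫ W.chart k := by
  have hχ' : χ.comp (algebraMap A _) =
      (algebraMap (A ⧸ J) (W'.R k)).comp (Ideal.Quotient.mk J) := RingHom.ext hχ
  refine W.eq_of_comp_π_eq_spec (ψ := (algebraMap (A ⧸ J) (W'.R k)).comp (Ideal.Quotient.mk J))
    (k := k) ?_ ?_ (W'.isBlowupChart k).nzd (W'.map_quotient_eq k)
  · rw [Category.assoc, hi, ← Category.assoc, W'.chart_π, ← Spec.map_comp]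
    rfl
  · rw [Category.assoc, W.chart_π, ← Spec.map_comp, ← CommRingCat.ofHom_comp, hχ']

/-- The k-th chart upstairs is the full preimage of the k-th ambient chart, because x_k/x_l in the
ambient chart maps to x_k/x_l in the other. -/
lemma mem_range_chart_of_hom
    (hi : i' ≫ W.π = W'.π ≫ Spec.map (CommRingCat.ofHom (Ideal.Quotient.mk J)))
    {k : ι} {p : W'.scheme} (hp : i' p ∈ Set.range (W.chart k)) : p ∈ Set.range (W'.chart k) := by
  obtain ⟨l, Q, rfl⟩ := W'.covers p
  obtain ⟨χ, hχ⟩ := W.exists_chart_hom W' l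
  have hc := chart_comp_eq hχ hi
  obtain ⟨u, hu⟩ : ∃ u, u * algebraMap A (W.R l) (x l) = algebraMap A (W.R l) (x k) := by
    rw [← Ideal.mem_span_singleton', ← (W.isBlowupChart l).map_eq]
    exact Ideal.mem_map_of_mem _ (Ideal.subset_span ⟨k, rfl⟩)
  have h1 : i' (W'.chart l Q) = W.chart l (Spec.map (CommRingCat.ofHom χ) Q) := congr($(hc) Q)
  rw [h1, W.mem_range_iff l k u (by rw [mul_comm, hu])] at hp
  refine (W'.mem_range_iff l k (χ u) ?_ Q).mpr hp
  rw [← hχ, ← hχ, ← hu, map_mul, mul_comm]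

/-- The strict transform is a closed subscheme of the blow-up. -/
lemma isClosedImmersion_of_hom
    (hi : i' ≫ W.π = W'.π ≫ Spec.map (CommRingCat.ofHom (Ideal.Quotient.mk J))) :
    IsClosedImmersion i' := by
  let 𝒰 : W.scheme.OpenCover := Scheme.Cover.mkOfCovers ι (fun k ↦ Spec (.of (W.R k))) W.chart
    (fun p ↦ W.covers p) W.isOpenImmersion
  refine IsZariskiLocalAtTarget.of_openCover (P := @IsClosedImmersion) (𝒰 := 𝒰) fun (k : ι) ↦ ?_
  change IsClosedImmersion (Limits.pullback.snd i' (W.chart k))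
  obtain ⟨χ, hχ⟩ := W.exists_chart_hom W' k
  have hc := chart_comp_eq hχ hi
  let g := Limits.pullback.lift (W'.chart k) (Spec.map (CommRingCat.ofHom χ)) hc
  have hg1 : g ≫ Limits.pullback.fst i' (W.chart k) = W'.chart k := Limits.pullback.lift_fst _ _ _
  have hg2 : g ≫ Limits.pullback.snd i' (W.chart k) = Spec.map (CommRingCat.ofHom χ) :=
    Limits.pullback.lift_snd _ _ _
  have hopen : IsOpenImmersion (g ≫ Limits.pullback.fst i' (W.chart k)) := hg1 ▸ inferInstance
  have : IsOpenImmersion g := IsOpenImmersion.of_comp g (Limits.pullback.fst i' (W.chart k))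
  -- The preimage of an ambient chart is exactly one chart of W', so over it i' is Spec of the
  -- surjection χ.
  have hsurj : Surjective g := ⟨fun z ↦ by
    have hz : i' (Limits.pullback.fst i' (W.chart k) z) ∈ Set.range (W.chart k) :=
      ⟨Limits.pullback.snd i' (W.chart k) z,
        congr($(Limits.pullback.condition (f := i') (g := W.chart k)) z).symm⟩
    obtain ⟨Q, hQ⟩ := mem_range_chart_of_hom hi hz
    refine ⟨Q, (Limits.pullback.fst i' (W.chart k)).isOpenEmbedding.injective ?_⟩
    rw [← hQ, ← Scheme.Hom.comp_apply, hg1]⟩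
  have : IsIso g := (isIso_iff_isOpenImmersion_and_surjective g).mpr ⟨inferInstance, hsurj⟩
  have hcl : IsClosedImmersion (Spec.map (CommRingCat.ofHom χ)) :=
    IsClosedImmersion.spec_of_surjective _
      (IsBlowupChart.surjective (J := J) (W.isBlowupChart k)
        (by simpa only [span_range_mk] using W'.isBlowupChart k) hχ)
  have h : Limits.pullback.snd i' (W.chart k) = inv g ≫ Spec.map (CommRingCat.ofHom χ) := by
    rw [← hg2, IsIso.inv_hom_id_assoc]
  rw [h]
  infer_instance

variable (W) in
lemma isReduced_scheme [_root_.IsReduced A] : AlgebraicGeometry.IsReduced W.scheme := by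
  let 𝒰 : W.scheme.OpenCover := Scheme.Cover.mkOfCovers ι (fun k ↦ Spec (.of (W.R k))) W.chart
    (fun p ↦ W.covers p) W.isOpenImmersion
  have (k : 𝒰.I₀) : AlgebraicGeometry.IsReduced (𝒰.X k) := by
    let k' : ι := k
    have : _root_.IsReduced (W.R k') := (W.isBlowupChart k').isReduced
    exact inferInstanceAs (AlgebraicGeometry.IsReduced (Spec (.of (W.R k'))))
  exact .of_openCover _ 𝒰

variable (W) in
lemma compactSpace_scheme [Finite ι] : CompactSpace W.scheme := by
  have h : (Set.univ : Set W.scheme) = ⋃ k, Set.range (W.chart k) :=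
    (Set.eq_univ_of_forall fun p ↦ Set.mem_iUnion.mpr (W.covers p)).symm
  exact ⟨h ▸ isCompact_iUnion fun k ↦ isCompact_range (W.chart k).continuous⟩

end BlowUpAtlas

section

open MvPolynomial

/-! ### The blow-up of an affine scheme in adapted coordinates -/

instance isStandardSmoothOfRelativeDimension_poly (n : ℕ) :
    Algebra.IsStandardSmoothOfRelativeDimension n ℂ (Poly n) := by
  let b := KaehlerDifferential.mvPolynomialBasis ℂ (Fin n)
  have hb (i : Fin n) : b i = KaehlerDifferential.D ℂ (Poly n) (X i) :=
    KaehlerDifferential.mvPolynomialBasis_apply _ _ _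
  have : Algebra.IsStandardSmooth ℂ (Poly n) :=
    Algebra.IsStandardSmooth.iff_exists_basis_kaehlerDifferential.mpr
      ⟨inferInstance, Fin n, b, by rintro _ ⟨i, rfl⟩; exact ⟨X i, (hb i).symm⟩⟩
  rw [Algebra.IsStandardSmoothOfRelativeDimension.iff_of_isStandardSmooth]
  rw [rank_eq_card_basis b, Fintype.card_fin]

lemma isStandardSmoothOfRelativeDimension_of_etale (n : ℕ) (A : Type) [CommRing A]
    [Algebra (Poly n) A] [Algebra ℂ A] [IsScalarTower ℂ (Poly n) A] [Algebra.Etale (Poly n) A] :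
    Algebra.IsStandardSmoothOfRelativeDimension n ℂ A := by
  have : Algebra.IsStandardSmoothOfRelativeDimension 0 (Poly n) A :=
    Algebra.Etale.iff_isStandardSmoothOfRelativeDimension_zero.mp inferInstance
  have h := Algebra.IsStandardSmoothOfRelativeDimension.trans n 0 ℂ (Poly n) A
  rwa [zero_add] at h

section Chart

variable {n : ℕ} {A R : Type} [CommRing A] [Algebra (Poly n) A] [CommRing R] [Algebra A R]
  {S : Finset (Fin n)} {k : Fin n} [Algebra ℂ A] [IsScalarTower ℂ (Poly n) A] [Algebra ℂ R]
  [IsScalarTower ℂ A R] [Algebra.Etale (Poly n) A] {I : Ideal A}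

lemma exists_etale_algebra (hI : I = Ideal.span ((fun i ↦ algebraMap (Poly n) A (X i)) '' S))
    (hk : k ∈ S) (h : IsBlowupChart I (algebraMap (Poly n) A (X k)) R) :
    ∃ (_ : BlowupCoordinates S k A R) (_ : Algebra (Poly n) R), IsScalarTower ℂ (Poly n) R ∧
      Algebra.Etale (Poly n) R := by
  subst hI
  obtain ⟨c⟩ := exists_blowupCoordinates (S := S) (k := k) (A := A) (R := R) (hk := hk) (h := h)
  refine ⟨c, c.ψ.toAlgebra, ?_, c.etale⟩
  let := c.ψ.toAlgebra
  refine .of_algebraMap_eq fun z ↦ ?_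
  rw [IsScalarTower.algebraMap_apply ℂ A R, ← algebraMap_C (n := n) z, ← c.ψ_C z]
  rfl

/-- F is the part of f prime to the exceptional divisor; it remains a nonzerodivisor, so the
Jacobian criterion applies to it on the étale chart. -/
lemma exists_strict_transform [I.IsPrime]
    (hI : I = Ideal.span ((fun i ↦ algebraMap (Poly n) A (X i)) '' S))
    (hk : k ∈ S) (h : IsBlowupChart I (algebraMap (Poly n) A (X k)) R) {f : A} {r : ℕ}
    (hf : f ∈ nonZeroDivisors A) (hq : HasQuadraticPoints f n r)
    (hnf : HasNormalForm (fun i ↦ algebraMap (Poly n) A (X i)) S f)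
    {R' : Type} [CommRing R'] [Algebra (A ⧸ Ideal.span {f}) R']
    (h' : IsBlowupChart (I.map (Ideal.Quotient.mk (Ideal.span {f})))
      (Ideal.Quotient.mk _ (algebraMap (Poly n) A (X k))) R')
    {χ : R →+* R'} (hχ : ∀ a, χ (algebraMap A R a) =
      algebraMap (A ⧸ Ideal.span {f}) R' (Ideal.Quotient.mk _ a)) :
    ∃ F ∈ nonZeroDivisors R, RingHom.ker χ = Ideal.span {F} ∧
      HasQuadraticSingularities (Ideal.span {F}) n r := by
  obtain ⟨c, _, _, _⟩ := exists_etale_algebra hI hk h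
  have : IsNoetherianRing R := Algebra.FiniteType.isNoetherianRing (Poly n) R
  have hprime := c.prime_exceptional hk hI
  have hf' := h.mem_nonZeroDivisors hf
  obtain ⟨m, F, hF, hFt⟩ := exists_eq_pow_mul_of_isPrime hprime hf'
  have hFnzd : F ∈ nonZeroDivisors R := by
    rw [hF] at hf'
    exact (mul_mem_nonZeroDivisors.mp hf').2
  refine ⟨F, hFnzd, h.ker_eq_span h' hprime hF hFt hχ, ?_⟩
  rw [hasQuadraticSingularities_iff hFnzd]
  exact c.hasQuadraticPoints hk h hF hFt hq hnf

end Chart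

/-- The blow-up of an affine scheme and the strict transform of a hypersurface. -/
theorem exists_blowUp_affine {n r : ℕ} {A : Type} [CommRing A] [Algebra (Poly n) A] [Algebra ℂ A]
    [IsScalarTower ℂ (Poly n) A] [Algebra.Etale (Poly n) A] {I : Ideal A} [I.IsPrime]
    {S : Finset (Fin n)} (hI : I = Ideal.span ((fun i ↦ algebraMap (Poly n) A (X i)) '' S)) {f : A}
    (hf : f ∈ nonZeroDivisors A) (hred : _root_.IsReduced (A ⧸ Ideal.span {f}))
    (hq : HasQuadraticPoints f n r)
    (hnf : HasNormalForm (fun i ↦ algebraMap (Poly n) A (X i)) S f) :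
    ∃ (Y' X' : Scheme.{0}) (π : Y' ⟶ Spec (.of A)) (ρ : X' ⟶ Spec (.of (A ⧸ Ideal.span {f})))
      (i' : X' ⟶ Y'),
      (∀ {B : Scheme.{0}} (b : B ⟶ Spec (.of A)), specIdeal b.ker = I → IsBlowUp π b) ∧
      (∀ {B : Scheme.{0}} (b : B ⟶ Spec (.of (A ⧸ Ideal.span {f}))),
        specIdeal b.ker = I.map (Ideal.Quotient.mk _) → IsBlowUp ρ b) ∧
      i' ≫ π = ρ ≫ Spec.map (CommRingCat.ofHom (Ideal.Quotient.mk _)) ∧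
      IsSmoothVariety (π ≫ Spec.map (CommRingCat.ofHom (algebraMap ℂ A))) n ∧
      IsHypersurface i' ∧
      HasAtMostQuadraticPoints (π ≫ Spec.map (CommRingCat.ofHom (algebraMap ℂ A))) n i' r := by
  let x : S → A := fun k ↦ algebraMap (Poly n) A (X k)
  have hx : Ideal.span (Set.range x) = I := by
    rw [hI]
    congr 1
    ext a
    simp [x]
  let W := reesAtlas x
  let W' := reesAtlas fun k ↦ Ideal.Quotient.mk (Ideal.span {f}) (x k)
  obtain ⟨i', hi'⟩ := W.exists_hom W'
  let (k : S) : Algebra ℂ (W.R k) := ((algebraMap A (W.R k)).comp (algebraMap ℂ A)).toAlgebra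
  have (k : S) : IsScalarTower ℂ A (W.R k) := .of_algebraMap_eq fun _ ↦ rfl
  have hchart (k : S) : IsBlowupChart I (algebraMap (Poly n) A (X k)) (W.R k) :=
    hx ▸ W.isBlowupChart k
  have hchart' (k : S) : IsBlowupChart (I.map (Ideal.Quotient.mk (Ideal.span {f})))
      (Ideal.Quotient.mk _ (algebraMap (Poly n) A (X k))) (W'.R k) := by
    have := W'.isBlowupChart k
    rwa [BlowUpAtlas.span_range_mk, hx] at this
  have hstd (k : S) : Algebra.IsStandardSmoothOfRelativeDimension n ℂ (W.R k) := by
    obtain ⟨_, _, _, _⟩ := exists_etale_algebra hI k.2 (hchart k)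
    exact isStandardSmoothOfRelativeDimension_of_etale n (W.R k)
  have hcs (k : S) : W.chart k ≫ W.π ≫ Spec.map (CommRingCat.ofHom (algebraMap ℂ A)) =
      Spec.map (CommRingCat.ofHom (algebraMap ℂ (W.R k))) := by
    rw [← Category.assoc, W.chart_π, ← Spec.map_comp]
    rfl
  have hsmooth : SmoothOfRelativeDimension n
      (W.π ≫ Spec.map (CommRingCat.ofHom (algebraMap ℂ A))) := by
    let 𝒰 : W.scheme.OpenCover := Scheme.Cover.mkOfCovers S (fun k ↦ Spec (.of (W.R k))) W.chart
      (fun p ↦ W.covers p) W.isOpenImmersion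
    have : IsZariskiLocalAtSource (@SmoothOfRelativeDimension n) :=
      HasRingHomProperty.instIsZariskiLocalAtSource
        (Q := RingHom.Locally (RingHom.IsStandardSmoothOfRelativeDimension n))
    refine IsZariskiLocalAtSource.of_openCover (P := @SmoothOfRelativeDimension n) (𝒰 := 𝒰)
      fun (k : S) ↦ ?_
    change SmoothOfRelativeDimension n (W.chart k ≫ _)
    rw [hcs, HasRingHomProperty.Spec_iff (P := @SmoothOfRelativeDimension n)]
    refine RingHom.locally_of RingHom.isStandardSmoothOfRelativeDimension_respectsIso _ ?_
    exact (RingHom.isStandardSmoothOfRelativeDimension_algebraMap n).mpr (hstd k)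
  have hcl := BlowUpAtlas.isClosedImmersion_of_hom hi'
  have hcompact := W.compactSpace_scheme
  have hstrict (k : S) : ∃ χ : W.R k →+* W'.R k, Function.Surjective χ ∧
      W'.chart k ≫ i' = Spec.map (CommRingCat.ofHom χ) ≫ W.chart k ∧
      ∃ F ∈ nonZeroDivisors (W.R k), RingHom.ker χ = Ideal.span {F} ∧
        HasQuadraticSingularities (Ideal.span {F}) n r := by
    obtain ⟨χ, hχ⟩ := W.exists_chart_hom W' k
    exact ⟨χ, (hchart k).surjective (hchart' k) hχ, BlowUpAtlas.chart_comp_eq hχ hi',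
      exists_strict_transform hI k.2 (hchart k) hf hq hnf (hchart' k) hχ⟩
  have hft (k : S) : Algebra.FiniteType ℂ (W.R k) := by
    have := Algebra.IsStandardSmoothOfRelativeDimension.isStandardSmooth (R := ℂ) (S := W.R k) n
    infer_instance
  refine ⟨W.scheme, W'.scheme, W.π, W'.π, i', fun b hb ↦ W.isBlowUp b (hb.trans hx.symm),
    fun b hb ↦ W'.isBlowUp b (by rw [hb, BlowUpAtlas.span_range_mk, hx]), hi',
    ⟨inferInstance, inferInstance, hsmooth⟩, ⟨hcl, W'.isReduced_scheme, fun p hp ↦ ?_⟩,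
    fun p hp ↦ ?_⟩
  · obtain ⟨k, Q, rfl⟩ := W'.covers p
    obtain ⟨χ, hχ, hc, F, hF, hker, -⟩ := hstrict k
    let : Algebra ℂ (W'.R k) := (χ.comp (algebraMap ℂ (W.R k))).toAlgebra
    let χ' : W.R k →ₐ[ℂ] W'.R k := ⟨χ, fun _ ↦ rfl⟩
    have : IsNoetherianRing (W.R k) := Algebra.FiniteType.isNoetherianRing ℂ (W.R k)
    refine (coheight_eq_height_of_comp_eq (χ := χ') hc Q).trans ?_
    -- Codimension one is Krull's principal ideal theorem for the nonzerodivisor F.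
    refine height_eq_one_of_mem_nonZeroDivisors hF ?_
    rw [← hker]
    exact (mem_minimalPrimes_iff_of_comp_eq (χ := χ') hχ Q).mp hp
  · obtain ⟨k, Q, rfl⟩ := W'.covers p
    obtain ⟨χ, hχ, hc, F, hF, hker, hsing⟩ := hstrict k
    let : Algebra ℂ (W'.R k) := (χ.comp (algebraMap ℂ (W.R k))).toAlgebra
    let χ' : W.R k →ₐ[ℂ] W'.R k := ⟨χ, fun _ ↦ rfl⟩
    have := SmoothOfRelativeDimension.smooth n
      (W.π ≫ Spec.map (CommRingCat.ofHom (algebraMap ℂ A)))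
    have : LocallyOfFinitePresentation (i' ≫ W.π ≫
        Spec.map (CommRingCat.ofHom (algebraMap ℂ A))) :=
      LocallyOfFinitePresentation.iff_locallyOfFiniteType.mpr inferInstance
    exact HasQuadraticSingularities.of_isClosed (χ := χ') hχ (hcs k) hc (hker.symm ▸ hsing) hp

end

section

open MvPolynomial

/-! ### Closed subschemes in affine charts -/

lemma ker_eq_comap_of_isPullback {X Y Z P : Scheme.{0}} {g : P ⟶ X} {h : P ⟶ Z} {f : X ⟶ Y}
    {i : Z ⟶ Y} [IsClosedImmersion i] (H : IsPullback g h f i) : g.ker = i.ker.comap f := by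
  rw [← Scheme.IdealSheafData.ker_fst_of_isClosedImmersion, ← H.isoPullback_hom_fst,
    Scheme.Hom.ker_comp_of_isIso]

lemma comap_ker_comp {X Y B : Scheme.{0}} (i : X ⟶ Y) [Mono i] (j : B ⟶ X)
    [IsClosedImmersion (j ≫ i)] : (j ≫ i).ker.comap i = j.ker := by
  refine (ker_eq_comap_of_isPullback (g := j) (h := 𝟙 B) ⟨⟨by simp⟩, ⟨Limits.PullbackCone.IsLimit.mk
    _ (fun c ↦ c.snd) (fun c ↦ ?_) (fun c ↦ by simp) fun c m _ h ↦ by simpa using h⟩⟩).symm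
  rw [← cancel_mono i, Category.assoc]
  exact c.condition.symm

section

variable {A : Type} [CommRing A] {X Y : Scheme.{0}} (i : X ⟶ Y) [IsClosedImmersion i]
  (e : Spec (.of A) ⟶ Y)

lemma exists_isPullback_quotient :
    ∃ e' : Spec (.of (A ⧸ specIdeal (i.ker.comap e))) ⟶ X,
      IsPullback (Spec.map (CommRingCat.ofHom (Ideal.Quotient.mk _))) e' e i := by
  obtain ⟨K, w, hw⟩ := (IsClosedImmersion.Spec_iff (f := Limits.pullback.fst e i)).mp inferInstance
  let K' : Ideal A := K
  have hK : specIdeal (i.ker.comap e) = K' := by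
    rw [← Scheme.IdealSheafData.ker_fst_of_isClosedImmersion, hw, Scheme.Hom.ker_comp_of_isIso]
    exact (specIdeal_ker (Ideal.Quotient.mk K')).trans Ideal.mk_ker
  rw [hK]
  refine ⟨w.inv ≫ Limits.pullback.snd e i, ?_⟩
  refine IsPullback.of_iso (IsPullback.of_hasPullback e i) w (Iso.refl _) (Iso.refl _) (Iso.refl _)
    ?_ ?_ ?_ ?_
  · rw [hw]; simp
  · simp
  · simp
  · simp

variable {i e} {s : Y ⟶ SpecC} {n r : ℕ} [IsOpenImmersion e] [Algebra ℂ A]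

/-- A hypersurface with at most quadratic points in an affine chart. -/
lemma hasQuadraticSingularities_chart (hs : Smooth s)
    (hX : IsHypersurface i) (hXr : HasAtMostQuadraticPoints s n i r)
    (he : e ≫ s = Spec.map (CommRingCat.ofHom (algebraMap ℂ A))) :
    HasQuadraticSingularities (specIdeal (i.ker.comap e)) n r ∧
    (∀ q ∈ (specIdeal (i.ker.comap e)).minimalPrimes, q.height = 1) ∧
    _root_.IsReduced (A ⧸ specIdeal (i.ker.comap e)) := by
  obtain ⟨e', H⟩ := exists_isPullback_quotient i e
  have : IsOpenImmersion e' := MorphismProperty.of_isPullback H ‹_›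
  have : LocallyOfFinitePresentation (i ≫ s) :=
    LocallyOfFinitePresentation.iff_locallyOfFiniteType.mpr inferInstance
  have : JacobsonSpace X := LocallyOfFiniteType.jacobsonSpace (i ≫ s)
  let χ : A →ₐ[ℂ] A ⧸ specIdeal (i.ker.comap e) := Ideal.Quotient.mkₐ ℂ _
  have hχ : Function.Surjective χ := Ideal.Quotient.mk_surjective
  have hker : RingHom.ker χ.toRingHom = specIdeal (i.ker.comap e) := Ideal.mk_ker
  have hc : e' ≫ i = Spec.map (CommRingCat.ofHom χ.toRingHom) ≫ e := H.w.symm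
  refine ⟨?_, fun q hq ↦ ?_, ?_⟩
  · have := hXr.hasQuadraticSingularities hχ he hc
    rwa [hker] at this
  · rw [← hker] at hq
    exact height_eq_one_of_comp_eq hX.codim_one hχ hc hq
  · have := hX.reduced
    have h := isReduced_of_isOpenImmersion e'
    exact (affine_isReduced_iff (.of _)).mp h

omit [Algebra ℂ A] in
lemma isPrime_specIdeal_of_isIntegral [IsIntegral X] {x : X} (hx : i x ∈ Set.range e) :
    (specIdeal (i.ker.comap e)).IsPrime := by
  obtain ⟨e', H⟩ := exists_isPullback_quotient i e
  have : IsOpenImmersion e' := MorphismProperty.of_isPullback H ‹_›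
  obtain ⟨y, hy⟩ := hx
  obtain ⟨z, -, -⟩ := Scheme.exists_preimage_of_isPullback H y x hy
  have : Nonempty (Spec (.of (A ⧸ specIdeal (i.ker.comap e)))) := ⟨z⟩
  have h := isIntegral_of_isOpenImmersion e'
  rw [affine_isIntegral_iff] at h
  exact (Ideal.Quotient.isDomain_iff_prime _).mp h

omit [IsOpenImmersion e] [Algebra ℂ A] in
lemma specIdeal_comap_away (K : Y.IdealSheafData) (g : A) :
    specIdeal (K.comap (Spec.map (CommRingCat.ofHom (algebraMap A (Localization.Away g))) ≫ e)) =
      (specIdeal (K.comap e)).map (algebraMap A (Localization.Away g)) := by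
  rw [Scheme.IdealSheafData.comap_comp, specIdeal_comap]

end

lemma away_comp_eq {A : Type} [CommRing A] [Algebra ℂ A] {Y : Scheme.{0}} {s : Y ⟶ SpecC}
    {e : Spec (.of A) ⟶ Y} (he : e ≫ s = Spec.map (CommRingCat.ofHom (algebraMap ℂ A))) (g : A) :
    (Spec.map (CommRingCat.ofHom (algebraMap A (Localization.Away g))) ≫ e) ≫ s =
      Spec.map (CommRingCat.ofHom (algebraMap ℂ (Localization.Away g))) := by
  rw [Category.assoc, he, ← Spec.map_comp, IsScalarTower.algebraMap_eq ℂ A (Localization.Away g)]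
  rfl

lemma isOpenImmersion_away {A : Type} [CommRing A] (g : A) : IsOpenImmersion
    (Spec.map (CommRingCat.ofHom (algebraMap A (Localization.Away g)))) :=
  IsOpenImmersion.of_isLocalization g

lemma specIdeal_mono {A : Type} [CommRing A] {K L : (Spec (.of A)).IdealSheafData} (h : K ≤ L) :
    specIdeal K ≤ specIdeal L :=
  Ideal.comap_mono (h _)

/-- The quotient is the residue field at p, essentially of finite type over a perfect field. This is
generic smoothness of the subvariety with ideal p. -/
lemma formallySmooth_quotient_self {A : Type} [CommRing A] [Algebra ℂ A] [Algebra.FiniteType ℂ A]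
    (p : Ideal A) [p.IsPrime] : Algebra.FormallySmooth ℂ
      (Localization.AtPrime p ⧸ p.map (algebraMap A (Localization.AtPrime p))) := by
  let O := Localization.AtPrime p
  have hm : p.map (algebraMap A O) = IsLocalRing.maximalIdeal O :=
    IsLocalization.AtPrime.map_eq_maximalIdeal p O
  have hmax : (p.map (algebraMap A O)).IsMaximal := hm ▸ inferInstance
  let := Ideal.Quotient.field (p.map (algebraMap A O))
  have h1 : Algebra.EssFiniteType ℂ O := Algebra.EssFiniteType.comp ℂ A O
  have h2 : Algebra.EssFiniteType ℂ (O ⧸ p.map (algebraMap A O)) :=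
    Algebra.EssFiniteType.comp ℂ O _
  exact Algebra.FormallySmooth.of_perfectField

lemma isPrime_map_away {A : Type} [CommRing A] {p : Ideal A} [p.IsPrime] {g : A} (hg : g ∉ p) :
    (p.map (algebraMap A (Localization.Away g))).IsPrime :=
  IsLocalization.isPrime_of_isPrime_disjoint (Submonoid.powers g) _ p ‹_›
    ((Ideal.disjoint_powers_iff_notMem g (Ideal.IsPrime.isRadical ‹_›)).mpr hg)

/-! ### Charts in normal form -/

lemma exists_standardSmooth_chart {Y B : Scheme.{0}} {n : ℕ} {s : Y ⟶ SpecC}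
    (hs : SmoothOfRelativeDimension n s) (i : B ⟶ Y) [IsClosedImmersion i] [IsIntegral B]
    (O : Set Y) (hO : IsOpen O) {b : B} (hb : i b ∈ O) :
    ∃ (A : Type) (_ : CommRing A) (_ : Algebra ℂ A) (e : Spec (.of A) ⟶ Y)
      (_ : IsOpenImmersion e), Set.range e ⊆ O ∧
      e ≫ s = Spec.map (CommRingCat.ofHom (algebraMap ℂ A)) ∧
      Algebra.IsStandardSmoothOfRelativeDimension n ℂ A ∧
      (specIdeal (i.ker.comap e)).IsPrime := by
  obtain ⟨A₀, _, e₀, _, hb₀, hO₀⟩ := exists_spec_range_subset (i b) O hO hb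
  let : Algebra ℂ A₀ := (Spec.preimage (e₀ ≫ s)).hom.toAlgebra
  have he₀ : e₀ ≫ s = Spec.map (CommRingCat.ofHom (algebraMap ℂ A₀)) :=
    (Spec.map_preimage (e₀ ≫ s)).symm
  set I₀ := specIdeal (i.ker.comap e₀) with hI₀
  have hI₀p : I₀.IsPrime := isPrime_specIdeal_of_isIntegral (i := i) (x := b) hb₀
  have hloc : RingHom.Locally (RingHom.IsStandardSmoothOfRelativeDimension n)
      (algebraMap ℂ A₀) := by
    have : IsZariskiLocalAtSource (@SmoothOfRelativeDimension n) :=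
      HasRingHomProperty.instIsZariskiLocalAtSource
        (Q := RingHom.Locally (RingHom.IsStandardSmoothOfRelativeDimension n))
    have h1 : SmoothOfRelativeDimension n (e₀ ≫ s) := IsZariskiLocalAtSource.comp hs e₀
    rw [he₀, HasRingHomProperty.Spec_iff (P := @SmoothOfRelativeDimension n)] at h1
    exact h1
  obtain ⟨T, hT, hstd⟩ := hloc
  -- Elements of T generate the unit ideal, so one of the standard smooth pieces contains the
  -- generic point of the centre.
  obtain ⟨t, htT, htI⟩ : ∃ t ∈ T, t ∉ I₀ := by
    by_contra! h
    exact hI₀p.ne_top (top_le_iff.mp (hT ▸ Ideal.span_le.mpr h))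
  let A₁ := Localization.Away t
  let e₁ : Spec (.of A₁) ⟶ Y := Spec.map (CommRingCat.ofHom (algebraMap A₀ A₁)) ≫ e₀
  refine ⟨A₁, inferInstance, inferInstance, e₁, have := isOpenImmersion_away t; inferInstance, ?_,
    away_comp_eq he₀ t, (RingHom.isStandardSmoothOfRelativeDimension_algebraMap n).mp (hstd t htT),
    ?_⟩
  · rintro _ ⟨p, rfl⟩
    exact hO₀ ⟨_, rfl⟩
  · rw [specIdeal_comap_away]
    exact isPrime_map_away htI

lemma exists_etale_coordinates {n : ℕ} {A : Type} [CommRing A] [Algebra ℂ A]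
    [Algebra.IsStandardSmoothOfRelativeDimension n ℂ A] (I : Ideal A) [I.IsPrime] :
    ∃ g ∉ I, ∃ (_ : Algebra (Poly n) (Localization.Away g)),
      IsScalarTower ℂ (Poly n) (Localization.Away g) ∧
      Algebra.Etale (Poly n) (Localization.Away g) ∧
      ∃ S : Finset (Fin n), I.map (algebraMap A (Localization.Away g)) =
        Ideal.span ((fun k ↦ algebraMap (Poly n) (Localization.Away g) (X k)) '' S) := by
  have : Algebra.IsStandardSmooth ℂ A :=
    Algebra.IsStandardSmoothOfRelativeDimension.isStandardSmooth n
  have := formallySmooth_quotient_self I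
  obtain ⟨g, hg, c, S, hetale, hspan⟩ := exists_adapted_coordinates (n := n) I I le_rfl
  let τ : Poly n →+* Localization.Away g :=
    (algebraMap A (Localization.Away g)).comp (aeval c : Poly n →ₐ[ℂ] A).toRingHom
  refine ⟨g, hg, τ.toAlgebra, ?_, hetale, S, hspan.trans ?_⟩
  · let := τ.toAlgebra
    refine .of_algebraMap_eq fun z ↦ ?_
    refine (IsScalarTower.algebraMap_apply ℂ A (Localization.Away g) z).trans
      (congrArg (algebraMap A (Localization.Away g)) ?_)
    exact ((aeval c : Poly n →ₐ[ℂ] A).commutes z).symm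
  · refine congrArg (fun φ ↦ Ideal.span (φ '' (S : Set (Fin n)))) (funext fun k ↦ ?_)
    exact (congrArg (algebraMap A (Localization.Away g)) (aeval_X c k)).symm

lemma exists_normal_chart_of_etale {X Y B : Scheme.{0}} {n r : ℕ} {s : Y ⟶ SpecC}
    (hs : Smooth s) {i : X ⟶ Y} (hX : IsHypersurface i)
    (hXr : HasAtMostQuadraticPoints s n i r) (j : B ⟶ X) [IsClosedImmersion i]
    {A : Type} [CommRing A] [Algebra (Poly n) A] [Algebra ℂ A] [IsScalarTower ℂ (Poly n) A]
    [Algebra.Etale (Poly n) A] (e : Spec (.of A) ⟶ Y) [IsOpenImmersion e]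
    (he : e ≫ s = Spec.map (CommRingCat.ofHom (algebraMap ℂ A)))
    [hI : (specIdeal ((j ≫ i).ker.comap e)).IsPrime] {S : Finset (Fin n)}
    (hspan : specIdeal ((j ≫ i).ker.comap e) =
      Ideal.span ((fun k ↦ algebraMap (Poly n) A (MvPolynomial.X k)) '' S)) :
    ∃ (A' : Type) (_ : CommRing A') (_ : Algebra (Poly n) A') (_ : Algebra ℂ A')
      (_ : IsScalarTower ℂ (Poly n) A') (_ : Algebra.Etale (Poly n) A') (e' : Spec (.of A') ⟶ Y)
      (_ : IsOpenImmersion e'), Set.range e' ⊆ Set.range e ∧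
      e' ≫ s = Spec.map (CommRingCat.ofHom (algebraMap ℂ A')) ∧
      (specIdeal ((j ≫ i).ker.comap e')).IsPrime ∧
      specIdeal ((j ≫ i).ker.comap e') =
        Ideal.span ((fun k ↦ algebraMap (Poly n) A' (MvPolynomial.X k)) '' S) ∧
      ∃ f ∈ nonZeroDivisors A', specIdeal (i.ker.comap e') = Ideal.span {f} ∧
        _root_.IsReduced (A' ⧸ Ideal.span {f}) ∧ HasQuadraticPoints f n r ∧
        HasNormalForm (fun k ↦ algebraMap (Poly n) A' (MvPolynomial.X k)) S f := by
  have hstd₂ := isStandardSmoothOfRelativeDimension_of_etale n A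
  have : Algebra.IsStandardSmooth ℂ A :=
    Algebra.IsStandardSmoothOfRelativeDimension.isStandardSmooth n
  set I₂ := specIdeal ((j ≫ i).ker.comap e) with hI₂
  -- Singularities are controlled only at closed points, so the local equation of X is found at some
  -- closed point of the centre; the neighbourhood obtained contains the generic point.
  obtain ⟨m, hm, hIm⟩ := Ideal.exists_le_maximal I₂ hI.ne_top
  obtain ⟨ε, rfl⟩ := exists_ker_eq_of_isMaximal m
  set J₂ := specIdeal (i.ker.comap e) with hJ₂
  have hJI : J₂ ≤ I₂ :=
    specIdeal_mono (Scheme.IdealSheafData.comap_mono e (Scheme.Hom.le_ker_comp j i))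
  obtain ⟨hsing₂, hheight₂, -⟩ := hasQuadraticSingularities_chart hs hX hXr he
  obtain ⟨u, hu, f, hf, hfu⟩ := exists_locally_principal hsing₂ hheight₂ (hJI.trans hIm)
  obtain ⟨v, hv, hnf⟩ := exists_hasNormalForm hspan (hJI hf)
  -- Inverting u makes f generate the ideal of X, inverting v gives the normal form, and the centre
  -- still meets the smaller chart.
  have huv : u * v ∉ I₂ := fun h ↦ (hI.mem_or_mem h).elim (fun h ↦ hu (hIm h)) hv
  let A₃ := Localization.Away (u * v)
  let e₃ : Spec (.of A₃) ⟶ Y := Spec.map (CommRingCat.ofHom (algebraMap A A₃)) ≫ e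
  have hopen₃ : IsOpenImmersion e₃ := have := isOpenImmersion_away (u * v); inferInstance
  have he₃ : e₃ ≫ s = Spec.map (CommRingCat.ofHom (algebraMap ℂ A₃)) := away_comp_eq he (u * v)
  have hunit : IsUnit (algebraMap A A₃ (u * v)) :=
    IsLocalization.Away.algebraMap_isUnit (u * v)
  rw [map_mul, IsUnit.mul_iff] at hunit
  have hetale₃ : Algebra.Etale (Poly n) A₃ :=
    have : Algebra.Etale A A₃ := Algebra.Etale.of_isLocalizationAway (u * v)
    Algebra.Etale.comp (Poly n) A A₃
  have htower₃ : IsScalarTower ℂ (Poly n) A₃ := .of_algebraMap_eq fun z ↦ by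
    rw [IsScalarTower.algebraMap_apply (Poly n) A A₃,
      ← IsScalarTower.algebraMap_apply ℂ (Poly n) A, IsScalarTower.algebraMap_apply ℂ A A₃]
  have hX₃ (k : Fin n) : algebraMap (Poly n) A₃ (MvPolynomial.X k) =
      algebraMap A A₃ (algebraMap (Poly n) A (MvPolynomial.X k)) :=
    IsScalarTower.algebraMap_apply _ _ _ _
  have hJ₃ : specIdeal (i.ker.comap e₃) = Ideal.span {algebraMap A A₃ f} := by
    refine (specIdeal_comap_away _ (u * v)).trans (le_antisymm ?_ ?_)
    · refine Ideal.map_le_iff_le_comap.mpr fun x hx ↦ ?_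
      have := map_dvd (algebraMap A A₃) (hfu x hx)
      rw [map_mul, hunit.1.dvd_mul_left] at this
      exact Ideal.mem_span_singleton.mpr this
    · rw [Ideal.span_singleton_le_iff_mem]
      exact Ideal.mem_map_of_mem _ hf
  obtain ⟨hsing₃, hheight₃, hred₃⟩ := hasQuadraticSingularities_chart hs hX hXr he₃
  rw [hJ₃] at hsing₃ hheight₃ hred₃
  have : _root_.IsReduced A₃ := isReduced_of_etale (n := n) A₃
  -- Codimension one keeps f out of the minimal primes, and in a reduced ring this makes it a
  -- nonzerodivisor.
  have hnzd : algebraMap A A₃ f ∈ nonZeroDivisors A₃ := mem_nonZeroDivisors_of_isReduced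
    fun q hq ↦ not_mem_minimalPrimes_of_height_eq_one hheight₃ q hq
  refine ⟨A₃, inferInstance, inferInstance, inferInstance, htower₃, hetale₃, e₃, hopen₃, ?_, he₃,
    ?_, ?_, algebraMap A A₃ f, hnzd, hJ₃, hred₃, (hasQuadraticSingularities_iff hnzd).mp hsing₃,
    ?_⟩
  · rintro _ ⟨p, rfl⟩
    exact ⟨_, rfl⟩
  · rw [specIdeal_comap_away]
    exact isPrime_map_away huv
  · rw [specIdeal_comap_away]
    refine (congrArg (Ideal.map (algebraMap A A₃)) hspan).trans ?_
    rw [Ideal.map_span, Set.image_image]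
    simp only [hX₃]
  · simp only [hX₃]
    exact hnf (algebraMap A A₃) hunit.2

/-- Around the generic point of the centre, the ambient variety has étale coordinates such that the
centre is a coordinate subspace and the hypersurface is in normal form. -/
theorem exists_normal_chart {X Y B : Scheme.{0}} {n r : ℕ} {s : Y ⟶ SpecC}
    (hs : SmoothOfRelativeDimension n s) {i : X ⟶ Y} (hX : IsHypersurface i)
    (hXr : HasAtMostQuadraticPoints s n i r) (j : B ⟶ X) [IsClosedImmersion j] [IsIntegral B]
    [IsClosedImmersion i] (O : Set Y) (hO : IsOpen O) {b : B} (hb : i (j b) ∈ O) :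
    ∃ (A : Type) (_ : CommRing A) (_ : Algebra (Poly n) A) (_ : Algebra ℂ A)
      (_ : IsScalarTower ℂ (Poly n) A) (_ : Algebra.Etale (Poly n) A) (e : Spec (.of A) ⟶ Y)
      (_ : IsOpenImmersion e), Set.range e ⊆ O ∧
      e ≫ s = Spec.map (CommRingCat.ofHom (algebraMap ℂ A)) ∧
      (specIdeal ((j ≫ i).ker.comap e)).IsPrime ∧
      ∃ S : Finset (Fin n), specIdeal ((j ≫ i).ker.comap e) =
        Ideal.span ((fun k ↦ algebraMap (Poly n) A (MvPolynomial.X k)) '' S) ∧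
      ∃ f ∈ nonZeroDivisors A, specIdeal (i.ker.comap e) = Ideal.span {f} ∧
        _root_.IsReduced (A ⧸ Ideal.span {f}) ∧ HasQuadraticPoints f n r ∧
        HasNormalForm (fun k ↦ algebraMap (Poly n) A (MvPolynomial.X k)) S f := by
  have hsm : Smooth s := hs.smooth n
  obtain ⟨A, _, _, e, _, heO, he, _, hI⟩ := exists_standardSmooth_chart hs (j ≫ i) O hO hb
  obtain ⟨g, hg, _, _, _, S, hspan⟩ := exists_etale_coordinates (n := n)
    (specIdeal ((j ≫ i).ker.comap e))
  have := isOpenImmersion_away g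
  rw [← specIdeal_comap_away] at hspan
  have : (specIdeal ((j ≫ i).ker.comap (Spec.map (CommRingCat.ofHom
      (algebraMap A (Localization.Away g))) ≫ e))).IsPrime := by
    rw [specIdeal_comap_away]
    exact isPrime_map_away hg
  obtain ⟨A', _, _, _, h1, h2, e', h3, h4, h5, h6, h7⟩ := exists_normal_chart_of_etale hsm hX hXr j _
    (away_comp_eq he g) hspan
  refine ⟨A', _, _, _, h1, h2, e', h3, fun y hy ↦ heO ?_, h5, h6, S, h7⟩
  obtain ⟨p, rfl⟩ := h4 hy
  exact ⟨_, rfl⟩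

end

/-! ### Open subschemes of the base -/

lemma ker_morphismRestrict {X Y : Scheme.{0}} (i : X ⟶ Y) [IsClosedImmersion i] (U : Y.Opens) :
    (i ∣_ U).ker = i.ker.comap U.ι :=
  ker_eq_comap_of_isPullback (isPullback_morphismRestrict i U)

lemma ker_morphismRestrict_comp {X Y B : Scheme.{0}} (j : B ⟶ X) (i : X ⟶ Y)
    [IsClosedImmersion (j ≫ i)] (U : Y.Opens) :
    (j ∣_ (i ⁻¹ᵁ U) ≫ i ∣_ U).ker = (j ≫ i).ker.comap U.ι :=
  ker_eq_comap_of_isPullback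
    ((isPullback_morphismRestrict j (i ⁻¹ᵁ U)).paste_horiz (isPullback_morphismRestrict i U))

lemma exists_iso_preimage {X Y P Z : Scheme.{0}} {i : X ⟶ Y} {e : Z ⟶ Y} [IsOpenImmersion e]
    {g : P ⟶ Z} {e' : P ⟶ X} (H : IsPullback g e' e i) :
    ∃ E' : P ≅ i ⁻¹ᵁ e.opensRange, E'.hom ≫ i ∣_ e.opensRange = g ≫ e.isoOpensRange.hom ∧
      E'.hom ≫ (i ⁻¹ᵁ e.opensRange).ι = e' := by
  have h1 : IsPullback (g ≫ e.isoOpensRange.hom) e' e.opensRange.ι i :=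
    H.of_iso (Iso.refl _) e.isoOpensRange (Iso.refl _) (Iso.refl _) (by simp) (by simp) (by simp)
      (by simp)
  let E' := h1.isoIsPullback _ _ (isPullback_morphismRestrict i e.opensRange)
  exact ⟨E', h1.isoIsPullback_hom_fst _ _ _, h1.isoIsPullback_hom_snd _ _ _⟩

lemma exists_mem_range_of_isPrime {B Y : Scheme.{0}} (i : B ⟶ Y) [IsClosedImmersion i] {A : Type}
    [CommRing A] (e : Spec (.of A) ⟶ Y) (h : (specIdeal (i.ker.comap e)).IsPrime) :
    ∃ b : B, i b ∈ Set.range e := by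
  obtain ⟨e', H⟩ := exists_isPullback_quotient i e
  let Q : Spec (.of (A ⧸ specIdeal (i.ker.comap e))) :=
    (⊥ : PrimeSpectrum (A ⧸ specIdeal (i.ker.comap e)))
  exact ⟨e' Q, _, congr($(H.w) Q)⟩

/-- A closed integral subscheme of a complex scheme is generically smooth. -/
lemma exists_smooth_open {B Y : Scheme.{0}} [IsIntegral B] (i : B ⟶ Y) [IsClosedImmersion i]
    (s : Y ⟶ SpecC) [Smooth s] : ∃ O : Set Y, IsOpen O ∧
      (∀ U : Y.Opens, (U : Set Y) ⊆ O → Smooth ((i ⁻¹ᵁ U).ι ≫ i ≫ s)) ∧ i (genericPoint B) ∈ O := by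
  have : LocallyOfFinitePresentation (i ≫ s) :=
    LocallyOfFinitePresentation.iff_locallyOfFiniteType.mpr inferInstance
  obtain ⟨O, hO, hOs⟩ := i.isClosedEmbedding.isInducing.isOpen_iff.mp (i ≫ s).smoothLocus.2
  refine ⟨O, hO, fun U hU ↦ ?_, ?_⟩
  · rw [← Scheme.Hom.smoothLocus_eq_top_iff, ← Scheme.Hom.preimage_smoothLocus_eq]
    refine top_le_iff.mp fun y _ ↦ ?_
    have : (i ⁻¹ᵁ U).ι y ∈ i ⁻¹' O := hU y.2
    rw [hOs] at this
    exact this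
  · have : genericPoint B ∈ (i ≫ s).smoothLocus :=
      Scheme.Hom.genericPoint_mem_smoothLocus_of_perfectField (i ≫ s)
    exact hOs.ge this

end QuadraticPoints

end

theorem theorem4 {Y X B : Scheme.{0}} (n r : ℕ)
    -- the smooth complex variety `Y` of dimension `n`
    (s : Y ⟶ QuadraticPoints.SpecC) (hY : QuadraticPoints.IsSmoothVariety s n)
    -- the subvariety `X ⊂ Y` of codimension one and its singularities
    (i : X ⟶ Y) (hX : QuadraticPoints.IsHypersurface i)
    (hXr : QuadraticPoints.HasAtMostQuadraticPoints s n i r)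
    -- the irreducible subvariety `B ⊂ X`
    (j : B ⟶ X) (hj : IsClosedImmersion j) (hB : IsIntegral B) :
    ∃ U : Y.Opens,
      -- `B ∩ U` is nonempty and smooth
      (∃ b : B, i (j b) ∈ U) ∧
      Smooth ((j ⁻¹ᵁ i ⁻¹ᵁ U).ι ≫ j ≫ i ≫ s) ∧
      -- the blow-up `X'` of `X ∩ U` along `B ∩ U` is a hypersurface in the blow-up `Y'` of `U`
      -- along `B ∩ U`, with at most quadratic points of rank `≥ r`
      ∃ (Y' X' : Scheme.{0}) (π : Y' ⟶ U) (ρ : X' ⟶ i ⁻¹ᵁ U) (i' : X' ⟶ Y'),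
        QuadraticPoints.IsBlowUp π (j ∣_ (i ⁻¹ᵁ U) ≫ i ∣_ U) ∧
        QuadraticPoints.IsBlowUp ρ (j ∣_ (i ⁻¹ᵁ U)) ∧
        i' ≫ π = ρ ≫ i ∣_ U ∧
        QuadraticPoints.IsSmoothVariety (π ≫ U.ι ≫ s) n ∧
        QuadraticPoints.IsHypersurface i' ∧
        QuadraticPoints.HasAtMostQuadraticPoints (π ≫ U.ι ≫ s) n i' r := by
  have hs := hY.smooth
  have hsm : Smooth s := hs.smooth n
  have := hX.closedImmersion
  -- The chart is chosen inside an open set over which B is smooth; its image will be U.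
  obtain ⟨O, hO, hOsub, hOgen⟩ := QuadraticPoints.exists_smooth_open (j ≫ i) s
  obtain ⟨A, _, _, _, _, _, e, _, heO, he, hI, S, hspan, f, hf, hJ, hred, hq, hnf⟩ :=
    QuadraticPoints.exists_normal_chart hs hX hXr j O hO hOgen
  obtain ⟨Y', X', π, ρ, i', hπ, hρ, hcomm, hvar, hhyp, hquad⟩ :=
    QuadraticPoints.exists_blowUp_affine hspan hf hred hq hnf
  obtain ⟨e', H⟩ : ∃ e' : Spec (.of (A ⧸ Ideal.span {f})) ⟶ X,
      IsPullback (Spec.map (CommRingCat.ofHom (Ideal.Quotient.mk (Ideal.span {f})))) e' e i := by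
    rw [← hJ]
    exact QuadraticPoints.exists_isPullback_quotient i e
  let U : Y.Opens := e.opensRange
  let E : Spec (.of A) ≅ U := e.isoOpensRange
  have hE : E.hom ≫ U.ι = e := e.isoOpensRange_hom_ι
  obtain ⟨E', hE'₁, hE'₂⟩ := QuadraticPoints.exists_iso_preimage H
  have hπU : (π ≫ E.hom) ≫ U.ι ≫ s = π ≫ Spec.map (CommRingCat.ofHom (algebraMap ℂ A)) := by
    rw [Category.assoc, reassoc_of% hE, he]
  refine ⟨U, ?_, ?_, Y', X', π ≫ E.hom, ρ ≫ E'.hom, i', ?_, ?_, ?_, hπU.symm ▸ hvar, hhyp,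
    hπU.symm ▸ hquad⟩
  · exact QuadraticPoints.exists_mem_range_of_isPrime (j ≫ i) e hI
  · have := hOsub U heO
    rw [Category.assoc] at this
    exact this
  -- The affine blow-up is transported along Spec A ≅ U; only the ideals of the two centres have to
  -- be matched.
  · refine (hπ _ ((QuadraticPoints.specIdeal_ker _).trans Ideal.mk_ker)).of_iso E _ ?_
    apply QuadraticPoints.specIdeal_injective
    rw [QuadraticPoints.specIdeal_ker, Ideal.mk_ker,
      QuadraticPoints.ker_morphismRestrict_comp, ← Scheme.IdealSheafData.comap_comp, hE]
  · refine (hρ _ ((QuadraticPoints.specIdeal_ker _).trans Ideal.mk_ker)).of_iso E' _ ?_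
    apply QuadraticPoints.specIdeal_injective
    rw [QuadraticPoints.specIdeal_ker, Ideal.mk_ker, QuadraticPoints.ker_morphismRestrict,
      ← Scheme.IdealSheafData.comap_comp, hE'₂, ← QuadraticPoints.comap_ker_comp i j,
      ← Scheme.IdealSheafData.comap_comp, ← H.w, Scheme.IdealSheafData.comap_comp,
      QuadraticPoints.specIdeal_comap]
  · rw [Category.assoc, hE'₁, ← Category.assoc, hcomm, Category.assoc]
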